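/- Let $\mathbb F$ be a non-archimedean local field of characteristic $0$, $\chi$ a unitary character of $(\mathbb F,+)$ with kernel $\mathfrak o_{\mathbb F}$, $\Lambda\subseteq\mathbb F^\times$ a subgroup of finite index containing a uniformizer, and $\mathbb D$ a finite dimensional division $\mathbb F$-algebra. Let $\mathsf V,\mathsf V'$ be finite dimensional right $\mathbb D$-vector spaces. Consider an irreducible dual pair of one of the two types: (II) $\mathfrak g=\mathrm{End}_{\mathbb D}(\mathsf V)$, $\mathfrak g'=\mathrm{End}_{\mathbb D}(\mathsf V')$, acting on $\mathsf W=\mathrm{Hom}_{\mathbb D}(\mathsf V',\mathsf V)\oplus\mathrm{Hom}_{\mathbb D}(\mathsf V,\mathsf V')$ by $z(x,y)=(zx,-yz)$, $z'(x,y)=(-xz',z'y)$, with $\langle(x,y),(x',y')\rangle=\mathrm{tr}_{\mathbb F}(xy')-\mathrm{tr}_{\mathbb F}(x'y)$; (I) $\mathbb D$ has a (possibly trivial) involution $\sigma$ fixing $\mathbb F$ pointwise, $\mathsf V,\mathsf V'$ carry non-degenerate forms, one $\sigma$-hermitian and the other $\sigma$-skew-hermitian, $\mathfrak g,\mathfrak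 g'$ are the Lie algebras of the isometry groups, acting on $\mathsf W=\mathrm{Hom}_{\mathbb D}(\mathsf V',\mathsf V)$ by $z w$ and $-wz'$, with $\langle w',w\rangle=\mathrm{tr}_{\mathbb F}(w'w^*)$, where $(wv',v)=(v',w^*v)'$. Let $\mathfrak h'\subseteq\mathfrak g'$ be a Cartan subalgebra (the centralizer of a regular semisimple element) and let $\mathrm A'$ be the split part of the corresponding Cartan subgroup: the elements of the group $\mathrm G'$ that act on each $\mathfrak h'$-irreducible $\mathbb D$-subspace of $\mathsf V'$ by a scalar from $\mathbb F^\times$ and, in type I, trivially on those on which the form is non-degenerate. Let $\mathfrak a''\subseteq\mathfrak{sp}(\mathsf W)$ be the Lie algebra of the centralizer of $\mathrm A'$ in $\mathrm{Sp}(\mathsf W)$. Fix Haar measures $dw$, $da$, $dx$ on $\mathsf W$, on $\mathrm A'$ (viewed as a group of transformations of $\mathsf W$) and on $\mathfrak a''$. There is a unique measure $d(\mathrm A'w)$ on the orbit space with $\int_{\mathsf W}\phi(w)\,dw=\int_{\mathrm A'\backslash\mathsf W}\int_{\mathrm A'}\phi(aw)\,da\,d(\mathrm A'w)$ for all measurable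 $\phi\ge0$, and $$\mathrm{chc}(\psi)=\int_{\mathrm A'\backslash\mathsf W}\int_{\mathfrak a''}\psi(x)\,\chi\bigl(\tfrac14\langle x(w),w\rangle\bigr)\,dx\,d(\mathrm A'w)$$ converges absolutely (as an integral over the orbit space) for every locally constant compactly supported $\psi$ on $\mathfrak a''$ and defines a distribution on $\mathfrak a''$. The wave front set $\mathrm{WF}(u)$ of a distribution $u$ on a finite dimensional space $U$ is the set of $(x,\xi)\in U\times(U^*\setminus0)$ such that, for every locally constant compactly supported $\phi$ with $\phi(x)\ne0$, every open $\Lambda$-cone in $U^*\setminus 0$ containing $\xi$ meets the support of $\eta\mapsto u(\phi\,\chi(-\eta(\cdot)))$ in an unbounded set. Proposition. For every regular element $x'$ of $\mathfrak g'$ that lies in $\mathfrak h'$, the map $\mathfrak g\ni x\mapsto x'+x$ takes values in $\mathfrak a''$, and the intersection of $\mathrm{WF}(\mathrm{chc})$ with the conormal bundle $\{(x'+x,\xi):\ x\in\mathfrak g,\ \xi\in\mathfrak a''^*,\ \xi|_{\mathfrak g}=0\}$ of this map is empty. -/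

import Mathlib

open MeasureTheory Module

noncomputable section

namespace PadicPair

/-! ### Schwartz-Bruhat functions, distributions and wave front sets

Throughout, a finite dimensional vector space over the local field `F` carries its canonical
topology `moduleTopology F U`, the one that any linear isomorphism with `F ^ n` transports. -/

section Distributions

variable (F : Type*) [NontriviallyNormedField F]

/-- A unitary character of the additive group of `F` whose kernel is the ring of integers
(it is automatically continuous). -/
structure UnramifiedChar where
  toAddChar : AddChar F Circle
  ker_iff : ∀ a : F, toAddChar a = 1 ↔ ‖a‖ ≤ 1

variable {F}

/-- The character as a complex valued function. -/
def UnramifiedChar.val (χ : UnramifiedChar F) (a : F) : ℂ := (χ.toAddChar a : ℂ)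

theorem UnramifiedChar.isLocallyConstant [IsUltrametricDist F] (χ : UnramifiedChar F) :
    IsLocallyConstant χ.val := by
  rw [IsLocallyConstant.iff_eventually_eq]
  intro x
  filter_upwards [Metric.ball_mem_nhds x one_pos] with y hy
  have h1 : χ.toAddChar (y - x) = 1 := (χ.ker_iff _).2 (by
    rw [← dist_eq_norm]; exact (Metric.mem_ball.1 hy).le)
  have h2 : χ.toAddChar y = χ.toAddChar x := by
    have := AddChar.map_add_eq_mul χ.toAddChar (y - x) x
    rw [sub_add_cancel, h1, one_mul] at this
    exact this
  simp [UnramifiedChar.val, h2]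

variable (F)

/-- The Schwartz-Bruhat space: locally constant complex functions with compact support. -/
def SchwartzBruhat (U : Type*) [AddCommGroup U] [Module F U] : Submodule ℂ (U → ℂ) where
  carrier := {φ | @IsLocallyConstant U ℂ (moduleTopology F U) φ ∧
    @HasCompactSupport U ℂ (moduleTopology F U) _ φ}
  add_mem' := by
    let : TopologicalSpace U := moduleTopology F U
    rintro f g ⟨hf, hf'⟩ ⟨hg, hg'⟩
    exact ⟨hf.add hg, hf'.add hg'⟩
  zero_mem' := by
    let : TopologicalSpace U := moduleTopology F U
    exact ⟨IsLocallyConstant.const 0, HasCompactSupport.zero⟩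
  smul_mem' := by
    let : TopologicalSpace U := moduleTopology F U
    rintro c f ⟨hf, hf'⟩
    exact ⟨hf.comp (fun z => c • z), hf'.comp_left (g := fun z => c • z) (smul_zero c)⟩

/-- Distributions: all linear functionals on the Schwartz-Bruhat space. -/
abbrev Distribution (U : Type*) [AddCommGroup U] [Module F U] : Type _ :=
  SchwartzBruhat F U →ₗ[ℂ] ℂ

variable {F}
variable {U : Type*} [AddCommGroup U] [Module F U]

/-- The test function `x ↦ φ x * χ (- ξ x)`. -/
def modulate [IsUltrametricDist F] (χ : UnramifiedChar F) (φ : SchwartzBruhat F U)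
    (ξ : Dual F U) : SchwartzBruhat F U :=
  ⟨fun x => φ.1 x * χ.val (-(ξ x)), by
    let : TopologicalSpace U := moduleTopology F U
    have : IsModuleTopology F U := ⟨rfl⟩
    have hξ : Continuous fun x : U => -(ξ x) :=
      (IsModuleTopology.continuous_of_linearMap ξ).neg
    exact ⟨φ.2.1.mul (χ.isLocallyConstant.comp_continuous hξ), φ.2.2.mul_right⟩⟩

/-- The Fourier transform of the compactly supported distribution `φ u`:
it is the function `ξ ↦ u (φ χ(- ξ))` on the dual space. -/
def fourierCutoff [IsUltrametricDist F] (χ : UnramifiedChar F) (u : Distribution F U)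
    (φ : SchwartzBruhat F U) (ξ : Dual F U) : ℂ :=
  u (modulate χ φ ξ)

/-- Bounded subsets of a finite dimensional space (all linear coordinates are bounded). -/
def IsBddSet {E : Type*} [AddCommGroup E] [Module F E] (A : Set E) : Prop :=
  ∀ l : Dual F E, ∃ C : ℝ, ∀ v ∈ A, ‖l v‖ ≤ C

/-- Open cones in `E \ 0`, with respect to the group `Λ` of scalars. -/
def IsOpenCone (Λ : Subgroup Fˣ) {E : Type*} [AddCommGroup E] [Module F E] (C : Set E) : Prop :=
  @IsOpen E (moduleTopology F E) C ∧ (0 : E) ∉ C ∧ ∀ c ∈ Λ, ∀ v ∈ C, (c : F) • v ∈ C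

/-- The asymptotic cone: non-zero vectors all of whose open conic neighbourhoods meet `A` in an
unbounded set. -/
def asymptoticCone (Λ : Subgroup Fˣ) {E : Type*} [AddCommGroup E] [Module F E] (A : Set E) :
    Set E :=
  {v | v ≠ 0 ∧ ∀ C : Set E, IsOpenCone Λ C → v ∈ C → ¬ IsBddSet (F := F) (C ∩ A)}

/-- The wave front set of `u`: pairs `(x, ξ)` with `ξ ≠ 0` in the asymptotic cone of the support
of the Fourier transform of `φ u`, for every test function `φ` with `φ x ≠ 0`. -/
def waveFrontSet [IsUltrametricDist F] (χ : UnramifiedChar F) (Λ : Subgroup Fˣ)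
    (u : Distribution F U) : Set (U × Dual F U) :=
  {p | p.2 ≠ 0 ∧ ∀ φ : SchwartzBruhat F U, φ.1 p.1 ≠ 0 →
    p.2 ∈ asymptoticCone Λ
      (@closure (Dual F U) (moduleTopology F (Dual F U)) {ξ | fourierCutoff χ u φ ξ ≠ 0})}

end Distributions

/-! ### The measure on an orbit space -/

/-- `ν` is the measure on the space of `G`-orbits in `X` for which
`∫_X f(w) dw = ∫_{G\X} ∫_G f(a w) da dν(G w)`; the orbit space has the quotient measurable
structure. The group `G` is abelian in the application, so that the inner integral does not depend
on the representative. An invariant set that is null for `dw` has a null image for `ν`, so that `ν`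
lives on the orbits in any invariant conull set. -/
def IsOrbitMeasure {G X : Type*} [Group G] [MulAction G X] [MeasurableSpace G] [MeasurableSpace X]
    (dw : Measure X) (da : Measure G) (ν : Measure (MulAction.orbitRel.Quotient G X)) : Prop :=
  ∀ f : X → ENNReal, Measurable f →
    ∫⁻ w, f w ∂dw = ∫⁻ q, ∫⁻ a : G, f (a • (Quotient.out q : X)) ∂da ∂ν

/-! ### The distribution attached to a group of symplectic transformations -/

section Symplectic

variable {F : Type*} [NontriviallyNormedField F]
variable {W : Type*} [AddCommGroup W] [Module F W]

/-- The Lie algebra of the centralizer in `Sp(W, ω)` of a subgroup `A` of `Sp(W, ω)`: the elements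
of `sp(W, ω)` that commute with `A`. -/
def spCentralizer (ω : W →ₗ[F] W →ₗ[F] F) (A : Subgroup (W ≃ₗ[F] W)) :
    Submodule F (End F W) where
  carrier := {X | (∀ u v, ω (X u) v + ω u (X v) = 0) ∧ ∀ a ∈ A, ∀ w, X (a w) = a (X w)}
  add_mem' := by
    rintro X Y ⟨hX, hX'⟩ ⟨hY, hY'⟩
    refine ⟨fun u v => ?_, fun a ha w => ?_⟩
    · have h1 := hX u v
      have h2 := hY u v
      simp only [LinearMap.add_apply, map_add]
      linear_combination h1 + h2
    · simp [hX' a ha, hY' a ha]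
  zero_mem' := by simp
  smul_mem' := by
    rintro c X ⟨hX, hX'⟩
    refine ⟨fun u v => ?_, fun a ha w => ?_⟩
    · have h1 := hX u v
      simp only [LinearMap.smul_apply, map_smul, smul_eq_mul]
      linear_combination c * h1
    · simp [hX' a ha]

/-- `∫ ψ(x) χ(⟨x(w), w⟩ / 4) dx`, over `x` in the subspace `𝔞` of `sp(W)`. -/
def gaussianIntegral (χ : UnramifiedChar F) (ω : W →ₗ[F] W →ₗ[F] F) (𝔞 : Submodule F (End F W))
    [MeasurableSpace 𝔞] (dx : Measure 𝔞) (ψ : 𝔞 → ℂ) (w : W) : ℂ :=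
  ∫ x : 𝔞, ψ x * χ.val (4⁻¹ * ω ((x : End F W) w) w) ∂dx

/-- `chc` is the distribution `ψ ↦ ∫_{A\W} ∫_𝔞 ψ(x) χ(⟨x(w), w⟩ / 4) dx d(A w)`, the outer integral
being absolutely convergent for every test function `ψ`. (The inner integral is an `A`-invariant
function of `w` when `𝔞` commutes with `A` and `A` preserves `ω`, so that the representative of
the orbit does not matter.) -/
def IsChc (χ : UnramifiedChar F) (ω : W →ₗ[F] W →ₗ[F] F) (A : Subgroup (W ≃ₗ[F] W))
    (𝔞 : Submodule F (End F W)) [MeasurableSpace 𝔞] [MeasurableSpace W] (dx : Measure 𝔞)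
    (ν : Measure (MulAction.orbitRel.Quotient A W)) (chc : Distribution F 𝔞) : Prop :=
  ∀ ψ : SchwartzBruhat F 𝔞,
    Integrable (fun q : MulAction.orbitRel.Quotient A W =>
      gaussianIntegral χ ω 𝔞 dx ψ.1 (Quotient.out q)) ν ∧
    chc ψ = ∫ q : MulAction.orbitRel.Quotient A W,
      gaussianIntegral χ ω 𝔞 dx ψ.1 (Quotient.out q) ∂ν

/-- The conormal bundle to the embedding `𝔤 ∋ z ↦ X' + z ∈ 𝔞`, inside `T^*𝔞 = 𝔞 × 𝔞^*`. -/
def conormalBundle (𝔞 𝔤 : Submodule F (End F W)) (X' : End F W) : Set (𝔞 × Dual F 𝔞) :=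
  {p | (∃ z ∈ 𝔤, (p.1 : End F W) = X' + z) ∧ ∀ Y : 𝔞, (Y : End F W) ∈ 𝔤 → p.2 Y = 0}

/-- The assertion about `chc`, for a symplectic space `(W, ω)`, a subgroup `A` of `Sp(W, ω)`
(the split part `A'` of a Cartan subgroup), a subspace `𝔤` and an element `X'` of `sp(W, ω)`.
With `𝔞` (that is, `𝔞''`) the Lie algebra of the centralizer of `A`, and for any choice of Haar
measures on `W`, on `A` and on `𝔞`:
`z ↦ X' + z` maps `𝔤` into `𝔞`, the orbit space of `A` has exactly one quotient measure, the integral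
defining `chc` converges to a distribution, and its wave front set does not meet the conormal bundle
to `z ↦ X' + z`. The topology on `A` is the one induced by `End_F(W)`. -/
def ChcAvoidsConormal [IsUltrametricDist F] (χ : UnramifiedChar F) (Λ : Subgroup Fˣ)
    (ω : W →ₗ[F] W →ₗ[F] F) (A : Subgroup (W ≃ₗ[F] W)) (𝔤 : Submodule F (End F W))
    (X' : End F W) : Prop :=
  let 𝔞 : Submodule F (End F W) := spCentralizer ω A
  letI : TopologicalSpace W := moduleTopology F W
  letI : MeasurableSpace W := borel W
  letI : TopologicalSpace 𝔞 := moduleTopology F 𝔞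
  letI : MeasurableSpace 𝔞 := borel 𝔞
  letI : TopologicalSpace A :=
    TopologicalSpace.induced (fun a : A => ((a : W ≃ₗ[F] W) : End F W)) (moduleTopology F (End F W))
  letI : MeasurableSpace A := borel A
  (∀ z ∈ 𝔤, X' + z ∈ 𝔞) ∧
  ∀ (dw : Measure W) (da : Measure A) (dx : Measure 𝔞),
    dw.IsAddHaarMeasure → da.IsHaarMeasure → dx.IsAddHaarMeasure →
    (∃! ν : Measure (MulAction.orbitRel.Quotient A W), IsOrbitMeasure dw da ν) ∧
    ∀ ν : Measure (MulAction.orbitRel.Quotient A W), IsOrbitMeasure dw da ν →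
      ∃ chc : Distribution F 𝔞, IsChc χ ω A 𝔞 dx ν chc ∧
        waveFrontSet χ Λ chc ∩ conormalBundle 𝔞 𝔤 X' = ∅

end Symplectic

/-! ### Right vector spaces over a division algebra: Cartan subalgebras and their split parts

A right `D`-vector space is a module over `Dᵐᵒᵖ`. -/

section Division

variable {F : Type*} [Field F] {D : Type*} [DivisionRing D] [Algebra F D]
variable {V : Type*} [AddCommGroup V] [Module F V] [Module Dᵐᵒᵖ V] [IsScalarTower F Dᵐᵒᵖ V]
variable {V' : Type*} [AddCommGroup V'] [Module F V'] [Module Dᵐᵒᵖ V'] [IsScalarTower F Dᵐᵒᵖ V']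

/-- The commutator bracket on `End_D(V)`. -/
instance endLieRing : LieRing (End Dᵐᵒᵖ V) := LieRing.ofAssociativeRing

instance endLieAlgebra : LieAlgebra F (End Dᵐᵒᵖ V) := LieAlgebra.ofAssociativeAlgebra

instance finite_hom [FiniteDimensional F V] [FiniteDimensional F V'] :
    Module.Finite F (V' →ₗ[Dᵐᵒᵖ] V) :=
  Module.Finite.of_injective (LinearMap.restrictScalarsₗ F Dᵐᵒᵖ V' V F)
    (LinearMap.restrictScalars_injective F)

/-- `U` is a non-zero `D`-subspace, stable under the set `S` of endomorphisms, and minimal with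
these properties. -/
def IsIrreducibleUnder (S : Set (End Dᵐᵒᵖ V)) (U : Submodule Dᵐᵒᵖ V) : Prop :=
  U ≠ ⊥ ∧ (∀ s ∈ S, ∀ u ∈ U, s u ∈ U) ∧
    ∀ U₁ : Submodule Dᵐᵒᵖ V, U₁ ≤ U → (∀ s ∈ S, ∀ u ∈ U₁, s u ∈ U₁) → U₁ = ⊥ ∨ U₁ = U

/-- `V` is a (finite) direct sum of `x`-irreducible `D`-subspaces. -/
def IsSemisimpleEnd (x : End Dᵐᵒᵖ V) : Prop :=
  ∃ (n : ℕ) (U : Fin n → Submodule Dᵐᵒᵖ V),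
    (∀ i, IsIrreducibleUnder {x} (U i)) ∧ DirectSum.IsInternal U

/-- `𝔥` is a Cartan subalgebra of the Lie algebra `𝔤` of endomorphisms: the centralizer in `𝔤` of a
regular semisimple element of `𝔤`. -/
def IsCartan [FiniteDimensional F V] (𝔤 𝔥 : LieSubalgebra F (End Dᵐᵒᵖ V)) : Prop :=
  ∃ h : 𝔤, LieAlgebra.IsRegular F h ∧ IsSemisimpleEnd (h : End Dᵐᵒᵖ V) ∧
    ∀ z : End Dᵐᵒᵖ V, z ∈ 𝔥 ↔ z ∈ 𝔤 ∧ ⁅(h : End Dᵐᵒᵖ V), z⁆ = 0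

/-- The split part of the Cartan subgroup of `GL_D(V)` attached to the Cartan subalgebra `𝔥`: the
automorphisms that act on every `𝔥`-irreducible subspace by a scalar from `F^×`. -/
def splitPartGL (𝔥 : LieSubalgebra F (End Dᵐᵒᵖ V)) : Subgroup (V ≃ₗ[Dᵐᵒᵖ] V) where
  carrier := {a | ∀ U : Submodule Dᵐᵒᵖ V, IsIrreducibleUnder (𝔥 : Set (End Dᵐᵒᵖ V)) U →
    ∃ c : Fˣ, ∀ u ∈ U, a u = (c : F) • u}
  mul_mem' := by
    intro a b ha hb U hU
    obtain ⟨c, hc⟩ := ha U hU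
    obtain ⟨d, hd⟩ := hb U hU
    refine ⟨d * c, fun u hu => ?_⟩
    have : (d : F) • a u = a ((d : F) • u) := (LinearMap.map_smul_of_tower a.toLinearMap _ _).symm
    rw [LinearEquiv.mul_apply, hd u hu, ← this, hc u hu, smul_smul, Units.val_mul]
  one_mem' := fun U _ => ⟨1, fun u _ => by simp⟩
  inv_mem' := by
    intro a ha U hU
    obtain ⟨c, hc⟩ := ha U hU
    refine ⟨c⁻¹, fun u hu => ?_⟩
    have h1 : a (((c⁻¹ : Fˣ) : F) • u) = ((c⁻¹ : Fˣ) : F) • a u :=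
      LinearMap.map_smul_of_tower a.toLinearMap _ _
    rw [hc u hu, smul_smul, Units.inv_mul, one_smul] at h1
    exact a.symm_apply_eq.2 h1.symm

/-- The trace of a `D`-linear endomorphism viewed as an `F`-linear one. -/
def trF (f : V →ₗ[Dᵐᵒᵖ] V) : F := LinearMap.trace F V (f.restrictScalars F)

theorem trF_add (f g : V →ₗ[Dᵐᵒᵖ] V) : trF (F := F) (f + g) = trF f + trF g := by
  unfold trF
  rw [← map_add]; rfl

theorem trF_smul (c : F) (f : V →ₗ[Dᵐᵒᵖ] V) : trF (c • f) = c * trF (F := F) f := by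
  unfold trF
  rw [← smul_eq_mul, ← map_smul]; rfl

end Division

/-! ### Dual pairs of type II -/

section TypeII

variable (F : Type*) [Field F] (D : Type*) [DivisionRing D] [Algebra F D]
variable (V : Type*) [AddCommGroup V] [Module F V] [Module Dᵐᵒᵖ V] [IsScalarTower F Dᵐᵒᵖ V]
variable (V' : Type*) [AddCommGroup V'] [Module F V'] [Module Dᵐᵒᵖ V'] [IsScalarTower F Dᵐᵒᵖ V']

/-- `W = Hom_D(V', V) ⊕ Hom_D(V, V')`. -/
abbrev WII : Type _ := (V' →ₗ[Dᵐᵒᵖ] V) × (V →ₗ[Dᵐᵒᵖ] V')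

/-- `⟨(x, y), (x', y')⟩ = tr(x y') - tr(x' y)`. -/
def symplecticII : WII D V V' →ₗ[F] WII D V V' →ₗ[F] F :=
  LinearMap.mk₂ F (fun w w' => trF (w.1 ∘ₗ w'.2) - trF (w'.1 ∘ₗ w.2))
    (by
      intro a b c
      simp only [Prod.fst_add, Prod.snd_add, LinearMap.add_comp, LinearMap.comp_add, trF_add]
      ring)
    (by
      intro r a b
      simp only [Prod.smul_fst, Prod.smul_snd, LinearMap.smul_comp, LinearMap.comp_smul, trF_smul,
        smul_eq_mul]
      ring)
    (by
      intro a b c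
      simp only [Prod.fst_add, Prod.snd_add, LinearMap.add_comp, LinearMap.comp_add, trF_add]
      ring)
    (by
      intro r a b
      simp only [Prod.smul_fst, Prod.smul_snd, LinearMap.smul_comp, LinearMap.comp_smul, trF_smul,
        smul_eq_mul]
      ring)

/-- `End_D(V)` acts on `W` by `z · (x, y) = (z x, - y z)`. -/
def leftActII : End Dᵐᵒᵖ V →ₗ[F] End F (WII D V V') :=
  LinearMap.mk₂ F (fun z w => (z ∘ₗ w.1, -(w.2 ∘ₗ z)))
    (by intro a b c; ext <;> simp [add_comm])
    (by intro r a b; ext <;> simp)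
    (by intro a b c; ext <;> simp [add_comm])
    (by intro r a b; ext <;> simp)

/-- `End_D(V')` acts on `W` by `z' · (x, y) = (- x z', z' y)`. -/
def rightActII : End Dᵐᵒᵖ V' →ₗ[F] End F (WII D V V') :=
  LinearMap.mk₂ F (fun z w => (-(w.1 ∘ₗ z), z ∘ₗ w.2))
    (by intro a b c; ext <;> simp [add_comm])
    (by intro r a b; ext <;> simp)
    (by intro a b c; ext <;> simp [add_comm])
    (by intro r a b; ext <;> simp)

/-- `GL_D(V')` acts on `W` by `a · (x, y) = (x a⁻¹, a y)`. -/
def groupActII : (V' ≃ₗ[Dᵐᵒᵖ] V') →* (WII D V V' ≃ₗ[F] WII D V V') where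
  toFun a :=
    { toFun := fun w => (w.1 ∘ₗ a.symm.toLinearMap, a.toLinearMap ∘ₗ w.2)
      invFun := fun w => (w.1 ∘ₗ a.toLinearMap, a.symm.toLinearMap ∘ₗ w.2)
      map_add' := by intro u v; ext <;> simp
      map_smul' := by
        intro r u
        ext v
        · simp
        · exact LinearMap.map_smul_of_tower a.toLinearMap r (u.2 v)
      left_inv := by intro w; ext <;> simp
      right_inv := by intro w; ext <;> simp }
  map_one' := by ext w v <;> rfl
  map_mul' := by intro a b; ext w v <;> rfl

end TypeII

/-! ### Dual pairs of type I -/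

section TypeI

variable (D : Type*) [DivisionRing D] [StarRing D]

/-- A non-degenerate form on the right `D`-vector space `V` with `(u, v d) = (u, v) d` and
`(v, u) = ε (u, v)^σ`, where the involution `σ` is the `star` of `D`. It is hermitian for `ε = 1` and
skew-hermitian for `ε = - 1`. -/
structure HermForm (ε : ℤˣ) (V : Type*) [AddCommGroup V] [Module Dᵐᵒᵖ V] where
  form : V → V → D
  add_right : ∀ u v w, form u (v + w) = form u v + form u w
  smul_right : ∀ u v (d : D), form u (MulOpposite.op d • v) = form u v * d
  symm : ∀ u v, form v u = ((ε : ℤ) : D) * star (form u v)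
  nondegenerate : ∀ v, (∀ u, form u v = 0) → v = 0

variable {D}
variable {F : Type*} [Field F] [Algebra F D]
variable {ε ε' : ℤˣ}
variable {V : Type*} [AddCommGroup V] [Module F V] [Module Dᵐᵒᵖ V] [IsScalarTower F Dᵐᵒᵖ V]
variable {V' : Type*} [AddCommGroup V'] [Module F V'] [Module Dᵐᵒᵖ V'] [IsScalarTower F Dᵐᵒᵖ V']

set_option linter.unusedSectionVars false

namespace HermForm

theorem form_zero_right (B : HermForm D ε V) (u : V) : B.form u 0 = 0 := by
  have := B.add_right u 0 0
  simpa using this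

theorem form_neg_right (B : HermForm D ε V) (u v : V) : B.form u (-v) = -B.form u v := by
  have := B.add_right u v (-v)
  rw [add_neg_cancel, B.form_zero_right] at this
  exact (neg_eq_of_add_eq_zero_right this.symm).symm

theorem form_add_left (B : HermForm D ε V) (u v w : V) :
    B.form (u + v) w = B.form u w + B.form v w := by
  rw [B.symm w (u + v), B.symm w u, B.symm w v, B.add_right, star_add, mul_add]

theorem form_smulF_right (B : HermForm D ε V) (c : F) (u v : V) :
    B.form u (c • v) = c • B.form u v := by
  have h : c • v = MulOpposite.op (algebraMap F D c) • v := by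
    rw [← MulOpposite.algebraMap_apply, algebraMap_smul]
  rw [h, B.smul_right, ← Algebra.commutes, Algebra.smul_def]

theorem form_smulF_left (hσ : ∀ a : F, star (algebraMap F D a) = algebraMap F D a)
    (B : HermForm D ε V) (c : F) (u v : V) : B.form (c • u) v = c • B.form u v := by
  rw [B.symm v (c • u), B.symm v u, B.form_smulF_right, Algebra.smul_def, star_mul, hσ,
    ← Algebra.commutes, Algebra.smul_def, ← mul_assoc, ← mul_assoc, Algebra.commutes]

theorem form_left_injective (B : HermForm D ε V) {u v : V}
    (h : ∀ w, B.form u w = B.form v w) : u = v := by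
  rw [← sub_eq_zero]
  refine B.nondegenerate _ fun w => ?_
  rw [sub_eq_add_neg, B.add_right, B.form_neg_right, B.symm u w, B.symm v w, h w, add_neg_cancel]

/-- By non-degeneracy every `D`-linear functional on `V` is `v ↦ (y, v)` for some `y`. -/
theorem exists_form_eq [FiniteDimensional F D] [FiniteDimensional F V]
    (hσ : ∀ a : F, star (algebraMap F D a) = algebraMap F D a)
    (B : HermForm D ε V) (f : V →ₗ[Dᵐᵒᵖ] D) : ∃ y : V, ∀ v, B.form y v = f v := by
  let L : V →ₗ[F] (V →ₗ[Dᵐᵒᵖ] D) :=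
    { toFun := fun y =>
        { toFun := fun v => B.form y v
          map_add' := B.add_right y
          map_smul' := fun d v => B.smul_right y v d.unop }
      map_add' := fun y z => LinearMap.ext fun v => B.form_add_left y z v
      map_smul' := fun c y => LinearMap.ext fun v => B.form_smulF_left hσ c y v }
  have hL : Function.Injective L := fun y z h =>
    B.form_left_injective fun w => LinearMap.congr_fun h w
  have : Module.Finite Dᵐᵒᵖ V := Module.Finite.of_restrictScalars_finite F Dᵐᵒᵖ V
  let b := Module.finBasis Dᵐᵒᵖ V
  have hdim : finrank F V = finrank F (V →ₗ[Dᵐᵒᵖ] D) := by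
    let e₁ : V ≃ₗ[F] (Fin (finrank Dᵐᵒᵖ V) → Dᵐᵒᵖ) := b.equivFun.restrictScalars F
    let e₂ : (Fin (finrank Dᵐᵒᵖ V) → D) ≃ₗ[F] (V →ₗ[Dᵐᵒᵖ] D) := b.constr F
    rw [e₁.finrank_eq, ← e₂.finrank_eq, finrank_pi_fintype, finrank_pi_fintype,
      (MulOpposite.opLinearEquiv F (M := D)).finrank_eq]
  obtain ⟨y, hy⟩ := (LinearMap.injective_iff_surjective_of_finrank_eq_finrank hdim).1 hL f
  exact ⟨y, fun v => LinearMap.congr_fun hy v⟩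

theorem exists_adjoint_apply [FiniteDimensional F D] [FiniteDimensional F V']
    (hσ : ∀ a : F, star (algebraMap F D a) = algebraMap F D a)
    (B : HermForm D ε V) (B' : HermForm D ε' V') (w : V' →ₗ[Dᵐᵒᵖ] V) (v : V) :
    ∃ y : V', ∀ v', B.form (w v') v = B'.form v' y := by
  have hstar : ∀ e : ℤˣ, star (((e : ℤ) : D)) = ((e : ℤ) : D) := fun e => by
    rcases Int.units_eq_one_or e with rfl | rfl <;> simp
  have hcomm : ∀ (e : ℤˣ) (d : D), ((e : ℤ) : D) * d = d * ((e : ℤ) : D) := fun e d => by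
    rcases Int.units_eq_one_or e with rfl | rfl <;> simp
  have hsq : ∀ e : ℤˣ, ((e : ℤ) : D) * ((e : ℤ) : D) = 1 := fun e => by
    rcases Int.units_eq_one_or e with rfl | rfl <;> simp
  let f : V' →ₗ[Dᵐᵒᵖ] D :=
    { toFun := fun v' => ((ε' : ℤ) : D) * (((ε : ℤ) : D) * B.form v (w v'))
      map_add' := fun a b => by simp only [map_add, B.add_right, mul_add]
      map_smul' := fun d a => by
        have h := B.smul_right v (w a) d.unop
        rw [MulOpposite.op_unop] at h
        rw [map_smul, h, RingHom.id_apply, MulOpposite.smul_eq_mul_unop, mul_assoc, mul_assoc] }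
  obtain ⟨y, hy⟩ := exists_form_eq hσ B' f
  refine ⟨y, fun v' => ?_⟩
  rw [B'.symm y v', hy v', B.symm v (w v')]
  simp only [f, LinearMap.coe_mk, AddHom.coe_mk, star_mul, hstar]
  rw [← hcomm ε', ← mul_assoc, hsq, one_mul, hcomm ε]

/-- The map `w ↦ w^*` from `Hom_D(V', V)` to `Hom_D(V, V')`, with `(w v', v) = (v', w^* v)'`. -/
def adjoint [FiniteDimensional F D] [FiniteDimensional F V']
    (hσ : ∀ a : F, star (algebraMap F D a) = algebraMap F D a)
    (B : HermForm D ε V) (B' : HermForm D ε' V') :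
    (V' →ₗ[Dᵐᵒᵖ] V) →ₗ[F] (V →ₗ[Dᵐᵒᵖ] V') :=
  have key : ∀ (w : V' →ₗ[Dᵐᵒᵖ] V) (v : V) (v' : V'),
      B.form (w v') v = B'.form v' (exists_adjoint_apply hσ B B' w v).choose :=
    fun w v => (exists_adjoint_apply hσ B B' w v).choose_spec
  have uniq : ∀ y z : V', (∀ v', B'.form v' y = B'.form v' z) → y = z := fun y z h =>
    B'.form_left_injective fun v' => by rw [B'.symm v' y, B'.symm v' z, h]
  { toFun := fun w =>
      { toFun := fun v => (exists_adjoint_apply hσ B B' w v).choose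
        map_add' := fun a b => uniq _ _ fun v' => by
          rw [← key, B'.add_right, ← key, ← key, B.add_right]
        map_smul' := fun d a => uniq _ _ fun v' => by
          have h := fun (x : V') => B'.smul_right v' x d.unop
          have h' := B.smul_right (w v') a d.unop
          simp only [MulOpposite.op_unop] at h h'
          rw [← key, RingHom.id_apply, h, ← key, h'] }
    map_add' := fun w z => LinearMap.ext fun v => uniq _ _ fun v' => by
      change B'.form v' (exists_adjoint_apply hσ B B' (w + z) v).choose =
        B'.form v' ((exists_adjoint_apply hσ B B' w v).choose +
          (exists_adjoint_apply hσ B B' z v).choose)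
      rw [B'.add_right, ← key, ← key, ← key, LinearMap.add_apply, B.form_add_left]
    map_smul' := fun c w => LinearMap.ext fun v => uniq _ _ fun v' => by
      change B'.form v' (exists_adjoint_apply hσ B B' (c • w) v).choose =
        B'.form v' (c • (exists_adjoint_apply hσ B B' w v).choose)
      rw [B'.form_smulF_right, ← key, ← key, LinearMap.smul_apply, B.form_smulF_left hσ] }

theorem form_adjoint [FiniteDimensional F D] [FiniteDimensional F V']
    (hσ : ∀ a : F, star (algebraMap F D a) = algebraMap F D a)
    (B : HermForm D ε V) (B' : HermForm D ε' V') (w : V' →ₗ[Dᵐᵒᵖ] V) (v : V) (v' : V') :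
    B.form (w v') v = B'.form v' (adjoint hσ B B' w v) :=
  (exists_adjoint_apply hσ B B' w v).choose_spec v'

/-- The Lie algebra `{x ∈ End_D(V) : (x u, v) + (u, x v) = 0}` of the isometry group of the form. -/
def lieAlgebra (hσ : ∀ a : F, star (algebraMap F D a) = algebraMap F D a) (B : HermForm D ε V) : LieSubalgebra F (End Dᵐᵒᵖ V) where
  carrier := {x | ∀ u v, B.form (x u) v + B.form u (x v) = 0}
  add_mem' := by
    intro x y hx hy u v
    simp only [LinearMap.add_apply, B.form_add_left, B.add_right]
    rw [add_add_add_comm, hx, hy, add_zero]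
  zero_mem' := by
    intro u v
    simp only [LinearMap.zero_apply, B.form_zero_right, add_zero]
    rw [B.symm v 0, B.form_zero_right, star_zero, mul_zero]
  smul_mem' := by
    intro c x hx u v
    simp only [LinearMap.smul_apply]
    rw [B.form_smulF_left hσ, B.form_smulF_right, ← smul_add, hx, smul_zero]
  lie_mem' := by
    intro x y hx hy u v
    have e : ∀ z, ⁅x, y⁆ z = x (y z) + -(y (x z)) := fun z => sub_eq_add_neg _ _
    have hneg : B.form (-(y (x u))) v = -B.form (y (x u)) v := by
      have h := B.form_add_left (y (x u)) (-(y (x u))) v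
      have h0 : B.form 0 v = 0 := by rw [B.symm v 0, B.form_zero_right, star_zero, mul_zero]
      rw [add_neg_cancel, h0] at h
      exact (neg_eq_of_add_eq_zero_right h.symm).symm
    have h1 := hx (y u) v
    have h2 := hy (x u) v
    have h3 := hx u (y v)
    have h4 := hy u (x v)
    rw [e, e, B.form_add_left, B.add_right, hneg, B.form_neg_right]
    calc _ = (B.form (x (y u)) v + B.form (y u) (x v)) - (B.form (y (x u)) v + B.form (x u) (y v))
          + (B.form (x u) (y v) + B.form u (x (y v))) - (B.form (y u) (x v) + B.form u (y (x v))) := by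
            abel
      _ = 0 := by rw [h1, h2, h3, h4]; simp

/-- The split part of the Cartan subgroup of the isometry group of `V` attached to the Cartan
subalgebra `𝔥`: the isometries that act on every `𝔥`-irreducible subspace by a scalar from `F^×`,
and trivially if the restriction of the form to that subspace is non-degenerate. -/
def splitPart (B : HermForm D ε V) (𝔥 : LieSubalgebra F (End Dᵐᵒᵖ V)) :
    Subgroup (V ≃ₗ[Dᵐᵒᵖ] V) where
  carrier := {a | (∀ u v, B.form (a u) (a v) = B.form u v) ∧ a ∈ splitPartGL 𝔥 ∧
    ∀ U : Submodule Dᵐᵒᵖ V, IsIrreducibleUnder (𝔥 : Set (End Dᵐᵒᵖ V)) U →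
      (∀ v ∈ U, (∀ u ∈ U, B.form u v = 0) → v = 0) → ∀ u ∈ U, a u = u}
  mul_mem' := by
    rintro a b ⟨ha, ha', ha''⟩ ⟨hb, hb', hb''⟩
    refine ⟨fun u v => ?_, mul_mem ha' hb', fun U hU hn u hu => ?_⟩
    · rw [LinearEquiv.mul_apply, LinearEquiv.mul_apply, ha, hb]
    · rw [LinearEquiv.mul_apply, hb'' U hU hn u hu, ha'' U hU hn u hu]
  one_mem' := ⟨fun _ _ => rfl, one_mem _, fun _ _ _ _ _ => rfl⟩
  inv_mem' := by
    rintro a ⟨ha, ha', ha''⟩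
    refine ⟨fun u v => ?_, inv_mem ha', fun U hU hn u hu => ?_⟩
    · have h : ∀ x, a (a⁻¹ x) = x := a.apply_symm_apply
      rw [← ha, h, h]
    · exact a.symm_apply_eq.2 (ha'' U hU hn u hu).symm

end HermForm

/-- `⟨w', w⟩ = tr(w' w^*)` on `W = Hom_D(V', V)`. -/
def symplecticI [FiniteDimensional F D] [FiniteDimensional F V']
    (hσ : ∀ a : F, star (algebraMap F D a) = algebraMap F D a)
    (B : HermForm D ε V) (B' : HermForm D ε' V') :
    (V' →ₗ[Dᵐᵒᵖ] V) →ₗ[F] (V' →ₗ[Dᵐᵒᵖ] V) →ₗ[F] F :=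
  LinearMap.mk₂ F (fun w' w => trF (w' ∘ₗ HermForm.adjoint hσ B B' w))
    (by intro a b c; rw [LinearMap.add_comp, trF_add])
    (by intro r a b; rw [LinearMap.smul_comp, trF_smul, smul_eq_mul])
    (by intro a b c; rw [map_add, LinearMap.comp_add, trF_add])
    (by intro r a b; rw [map_smul, LinearMap.comp_smul, trF_smul, smul_eq_mul])

end TypeI

section TypeIActions

variable (F : Type*) [Field F] (D : Type*) [DivisionRing D] [Algebra F D]
variable (V : Type*) [AddCommGroup V] [Module F V] [Module Dᵐᵒᵖ V] [IsScalarTower F Dᵐᵒᵖ V]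
variable (V' : Type*) [AddCommGroup V'] [Module F V'] [Module Dᵐᵒᵖ V'] [IsScalarTower F Dᵐᵒᵖ V']

/-- `End_D(V)` acts on `Hom_D(V', V)` by `z · w = z w`. -/
def leftActI : End Dᵐᵒᵖ V →ₗ[F] End F (V' →ₗ[Dᵐᵒᵖ] V) :=
  LinearMap.mk₂ F (fun z w => z ∘ₗ w)
    (by intro a b c; ext; simp) (by intro r a b; ext; simp)
    (by intro a b c; ext; simp)
    (by intro r a b; ext v; exact LinearMap.map_smul_of_tower a r (b v))

/-- `End_D(V')` acts on `Hom_D(V', V)` by `z' · w = - w z'`. -/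
def rightActI : End Dᵐᵒᵖ V' →ₗ[F] End F (V' →ₗ[Dᵐᵒᵖ] V) :=
  LinearMap.mk₂ F (fun z w => -(w ∘ₗ z))
    (by intro a b c; ext; simp [add_comm]) (by intro r a b; ext; simp)
    (by intro a b c; ext; simp [add_comm]) (by intro r a b; ext; simp)

/-- `GL_D(V')` acts on `Hom_D(V', V)` by `a · w = w a⁻¹`. -/
def groupActI : (V' ≃ₗ[Dᵐᵒᵖ] V') →* ((V' →ₗ[Dᵐᵒᵖ] V) ≃ₗ[F] (V' →ₗ[Dᵐᵒᵖ] V)) where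
  toFun a :=
    { toFun := fun w => w ∘ₗ a.symm.toLinearMap
      invFun := fun w => w ∘ₗ a.toLinearMap
      map_add' := by intro u v; ext; simp
      map_smul' := by intro r u; ext; simp
      left_inv := by intro w; ext; simp
      right_inv := by intro w; ext; simp }
  map_one' := by ext w v; rfl
  map_mul' := by intro a b; ext w v; rfl

end TypeIActions

end PadicPair

end

/-!
The symplectic space `W` decomposes under the torus `A` into weight blocks `p k W`: dual blocks carry
inverse weights, self-dual blocks the trivial one, and `A` consists of all systems of scalars with
these two properties (`TorusBlocks`). Everything below uses `A` only through this decomposition. Let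
`𝔞` be the centralizer of `A` in `sp(W)` and `moment w ∈ 𝔞^*` the functional `x ↦ ⟨x w, w⟩ / 4`, so
that the inner integral in `chc` is the Fourier transform of `ψ` at `moment w`.

*Convergence.* Rank one elements of `𝔞` show that `moment w` bounds the products
`‖p k w‖ ‖p (bar k) w‖`. Scaling dual blocks against each other, the torus moves every `w` with
`‖moment w‖ ≤ R` into a fixed compact set (`TorusBlocks.exists_bounded_representative`). Hence such
`w` form a subset of finite measure in the orbit space (`TorusBlocks.measure_moment_le_lt_top`), while
the Fourier transform of `ψ` has bounded support: the outer integral is one of a bounded function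
over a set of finite measure (`TorusBlocks.integrable_gaussianIntegral`). The same reduction shows
that the cone over the image of `moment` is closed (`TorusBlocks.exists_moment_eq`).

*Wave front set.* Let `(x, ξ)` belong to the wave front set of `chc`. As `chc` is a superposition of
the characters given by the covectors `moment w`, the covector `ξ` lies in the closed cone above: it
is a multiple of some `moment w` (`TorusBlocks.exists_moment_eq_of_mem_waveFrontSet`). Moreover, an
element `k` of the commutant of `A` in `GL(W)` acts on `𝔞` by `x ↦ k^* x k`, and it multiplies `chc`
by a positive constant, because it scales the Haar measures of `W` and of `𝔞` and because the measure
on the orbit space is unique. A distribution with this property has only characteristic covectors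
in its wave front set: `ξ (Y^* x + x Y) = 0` for all `Y` in the commutant of `A`
(`TorusBlocks.apply_eq_zero_of_mem_waveFrontSet`). Taking for `Y` transformations of rank one and
`ξ = moment w` up to a factor, one finds that `x w` vanishes in the dual of every block in which `w`
does not vanish.

*Conclusion.* Now let `x = X' + z` with `z ∈ 𝔤`, and let `ξ` vanish on `𝔤`. Removing the blocks of `w`
whose dual blocks do not contribute to `w` does not change `moment w`, and since `x` preserves the
blocks, the new `w` satisfies `x w = 0` and `⟨Y w, w⟩ = 0` for `Y ∈ 𝔤`. This is where the regularity of
`x'` comes in (`ConormalCondition`): some element of `A` multiplies `w` by `2`, so that `moment w = 0`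
by the invariance of the moment under `A`, contradicting `ξ ≠ 0`.

*The dual pairs.* In type II let `w = (a, b)`. Then `x w = 0` shows that the image of `b` is stable under
`x'`, and the second condition shows that `a b = 0`. A Cartan subalgebra `𝔥'` is commutative without
nilpotent elements other than `0`, because the trace form is non-degenerate on it, and it is the
centralizer of each of its regular elements. By complete reducibility there is a projection onto the
image of `b` that commutes with `x'` and thus belongs to `𝔥'`. It acts as `0` or `1` on each
`𝔥'`-irreducible summand of `V'`; the scalars `1 / 2` and `2`, respectively, define the required element
of `A` (`conormalCondition_typeII`). In type I the image of the adjoint of `w` is stable under `x'` and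
isotropic, and the projection is replaced by a skew-adjoint element of `𝔥'` that acts on this image
by `1` and on a dual isotropic subspace by `-1` (`conormalCondition_typeI`).
-/

noncomputable section

namespace PadicPair

set_option linter.unusedSectionVars false

/-! ### The trace form of `End_D(V)` -/

section Trace

variable {F : Type*} [Field F] {D : Type*} [DivisionRing D] [Algebra F D]
variable {V : Type*} [AddCommGroup V] [Module F V] [Module Dᵐᵒᵖ V] [IsScalarTower F Dᵐᵒᵖ V]
variable {V' : Type*} [AddCommGroup V'] [Module F V'] [Module Dᵐᵒᵖ V'] [IsScalarTower F Dᵐᵒᵖ V']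

/-- Restriction of scalars, from `D`-linear to `F`-linear endomorphisms. -/
def restrictEnd : End Dᵐᵒᵖ V →ₐ[F] End F V where
  toFun f := f.restrictScalars F
  map_one' := rfl
  map_mul' _ _ := rfl
  map_zero' := rfl
  map_add' _ _ := rfl
  commutes' _ := rfl

theorem restrictEnd_injective :
    Function.Injective (restrictEnd : End Dᵐᵒᵖ V →ₐ[F] End F V) :=
  LinearMap.restrictScalars_injective F

theorem trF_eq_trace (f : End Dᵐᵒᵖ V) :
    trF (F := F) f = LinearMap.trace F V (restrictEnd f) := rfl

variable [FiniteDimensional F V] [FiniteDimensional F V']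

theorem trF_comp_comm (f : V →ₗ[Dᵐᵒᵖ] V') (g : V' →ₗ[Dᵐᵒᵖ] V) :
    trF (F := F) (g ∘ₗ f) = trF (f ∘ₗ g) :=
  LinearMap.trace_comp_comm' (f.restrictScalars F) (g.restrictScalars F)

theorem trF_mul_comm (f g : End Dᵐᵒᵖ V) : trF (F := F) (f * g) = trF (g * f) :=
  trF_comp_comm g f

theorem trF_eq_zero_of_isNilpotent {f : End Dᵐᵒᵖ V} (hf : IsNilpotent f) :
    trF (F := F) f = 0 := by
  rw [trF_eq_trace]
  exact (LinearMap.isNilpotent_trace_of_isNilpotent (hf.map restrictEnd)).eq_zero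

theorem trF_ne_zero_of_isIdempotentElem [CharZero F] {f : End Dᵐᵒᵖ V} (hf : IsIdempotentElem f)
    (h0 : f ≠ 0) : trF (F := F) f ≠ 0 := by
  rw [trF_eq_trace]
  intro h
  exact h0 (restrictEnd_injective (F := F) (by
    rw [map_zero]
    exact (LinearMap.IsIdempotentElem.trace_eq_zero_iff (hf.map restrictEnd)).1 h))

/-- The trace pairing between `Hom_D(V, V')` and `Hom_D(V', V)` is non-degenerate: a non-zero map
`y` has a partner `g` for which `g y` is a non-zero idempotent. -/
theorem exists_trF_comp_ne_zero [CharZero F] {y : V →ₗ[Dᵐᵒᵖ] V'} (hy : y ≠ 0) :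
    ∃ g : V' →ₗ[Dᵐᵒᵖ] V, trF (F := F) (g ∘ₗ y) ≠ 0 := by
  obtain ⟨v, hv⟩ : ∃ v, y v ≠ 0 := by
    by_contra! h
    exact hy (LinearMap.ext h)
  obtain ⟨f, hf⟩ := (LinearMap.toSpanSingleton Dᵐᵒᵖ V' (y v)).exists_leftInverse_of_injective
    (LinearMap.ker_toSpanSingleton _ hv)
  have hfv : f (y v) = 1 := by
    have := LinearMap.congr_fun hf 1
    simpa using this
  refine ⟨(LinearMap.toSpanSingleton Dᵐᵒᵖ V v) ∘ₗ f, ?_⟩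
  refine trF_ne_zero_of_isIdempotentElem (f := (LinearMap.toSpanSingleton Dᵐᵒᵖ V v ∘ₗ f) ∘ₗ y)
    ?_ fun h => hv ?_
  · ext u
    simp [Module.End.mul_apply, hfv]
  · have := LinearMap.congr_fun h v
    simp [hfv] at this
    simp [this]

theorem eq_zero_of_trF_comp_eq_zero [CharZero F] {y : V →ₗ[Dᵐᵒᵖ] V'}
    (h : ∀ g : V' →ₗ[Dᵐᵒᵖ] V, trF (F := F) (g ∘ₗ y) = 0) : y = 0 := by
  by_contra hy
  obtain ⟨g, hg⟩ := exists_trF_comp_ne_zero (F := F) hy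
  exact hg (h g)

end Trace

/-! ### Cartan subalgebras of reductive Lie algebras of endomorphisms -/

section Cartan

variable {F : Type*} [Field F] {D : Type*} [DivisionRing D] [Algebra F D]
variable {V : Type*} [AddCommGroup V] [Module F V] [Module Dᵐᵒᵖ V] [IsScalarTower F Dᵐᵒᵖ V]

theorem lie_eq_mul_sub_mul (x y : End Dᵐᵒᵖ V) : ⁅x, y⁆ = x * y - y * x := rfl

theorem lie_eq_zero_iff_commute (x y : End Dᵐᵒᵖ V) : ⁅x, y⁆ = 0 ↔ x * y = y * x := by
  rw [lie_eq_mul_sub_mul, sub_eq_zero]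

/-- On an irreducible subspace a nilpotent operator commuting with the irreducible action is zero,
because its image is a proper invariant subspace. -/
theorem IsIrreducibleUnder.apply_eq_zero_of_isNilpotent {S : Set (End Dᵐᵒᵖ V)}
    {U : Submodule Dᵐᵒᵖ V} (hU : IsIrreducibleUnder S U) {n : End Dᵐᵒᵖ V}
    (hn : IsNilpotent n) (hc : ∀ s ∈ S, s * n = n * s) (hnU : ∀ u ∈ U, n u ∈ U) :
    ∀ u ∈ U, n u = 0 := by
  obtain ⟨hU0, hUS, hmin⟩ := hU
  have hle : U.map n ≤ U := by
    rintro _ ⟨u, hu, rfl⟩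
    exact hnU u hu
  rcases hmin (U.map n) hle (by
    rintro s hs _ ⟨u, hu, rfl⟩
    exact ⟨s u, hUS s hs u hu, (LinearMap.congr_fun (hc s hs) u).symm⟩) with h | h
  · intro u hu
    have : n u ∈ U.map n := ⟨u, hu, rfl⟩
    rwa [h, Submodule.mem_bot] at this
  · exfalso
    obtain ⟨k, hk⟩ := hn
    have key : ∀ k : ℕ, U.map (n ^ k) = U := by
      intro k
      induction k with
      | zero => simp [Module.End.one_eq_id]
      | succ k ih =>
        rw [pow_succ, Module.End.mul_eq_comp, Submodule.map_comp, h, ih]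
    have := key k
    rw [hk, Submodule.map_zero] at this
    exact hU0 this.symm

/-- The algebra generated by a semisimple endomorphism is reduced. -/
theorem IsSemisimpleEnd.eq_zero_of_isNilpotent {x n : End Dᵐᵒᵖ V} (hx : IsSemisimpleEnd x)
    (hn : IsNilpotent n) (hc : n ∈ Algebra.adjoin F {x}) : n = 0 := by
  obtain ⟨m, U, hU, hint⟩ := hx
  have hcx : ∀ s ∈ ({x} : Set (End Dᵐᵒᵖ V)), s * n = n * s := by
    rintro s rfl
    exact (Algebra.commute_of_mem_adjoin_self hc).eq
  have hstab : ∀ i, ∀ u ∈ U i, n u ∈ U i := by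
    intro i
    refine Algebra.adjoin_induction (p := fun n _ => ∀ u ∈ U i, n u ∈ U i) ?_ ?_ ?_ ?_ hc
    · rintro s rfl u hu
      exact (hU i).2.1 _ rfl u hu
    · intro r u hu
      have : (algebraMap F (End Dᵐᵒᵖ V) r) u = r • u := rfl
      rw [this, ← algebraMap_smul Dᵐᵒᵖ r u]
      exact (U i).smul_mem _ hu
    · intro a b _ _ ha hb u hu
      exact (U i).add_mem (ha u hu) (hb u hu)
    · intro a b _ _ ha hb u hu
      exact ha _ (hb u hu)
  have hle : (⊤ : Submodule Dᵐᵒᵖ V) ≤ LinearMap.ker n := by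
    rw [← hint.submodule_iSup_eq_top]
    exact iSup_le fun i u hu => (hU i).apply_eq_zero_of_isNilpotent hn hcx (hstab i) u hu
  exact LinearMap.ext fun v => hle trivial

variable [FiniteDimensional F V]

theorem minpoly_squarefree_of_adjoin_reduced {x : End Dᵐᵒᵖ V}
    (hx : ∀ n ∈ Algebra.adjoin F {x}, IsNilpotent n → n = 0) : Squarefree (minpoly F x) := by
  have hint : IsIntegral F x := Algebra.IsIntegral.isIntegral x
  rintro a ⟨b, hb⟩
  have hn : Polynomial.aeval x (a * b) = 0 := by
    refine hx _ (Polynomial.aeval_mem_adjoin_singleton F x) ⟨2, ?_⟩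
    rw [← map_pow, show (a * b) ^ 2 = minpoly F x * b by rw [hb]; ring, map_mul, minpoly.aeval,
      zero_mul]
  have hdvd := minpoly.dvd F x hn
  have hne := minpoly.ne_zero hint
  -- `a * a * b` divides `a * b`, so that `a` is a unit
  obtain ⟨c, hc⟩ := hdvd
  have hab : a * b ≠ 0 := by
    rintro h
    rw [hb, mul_assoc, h, mul_zero] at hne
    exact hne rfl
  refine IsUnit.of_mul_eq_one c (mul_left_cancel₀ hab ?_)
  calc a * b * (a * c) = (a * a * b) * c := by ring
    _ = a * b * 1 := by rw [← hb, ← hc, mul_one]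

theorem aeval_mulLeft {A : Type*} [Ring A] [Algebra F A] (x : A) (p : Polynomial F) :
    Polynomial.aeval (R := F) (A := End F A) (LinearMap.mulLeft F x) p =
      LinearMap.mulLeft F (Polynomial.aeval x p) := by
  induction p using Polynomial.induction_on' with
  | add p q hp hq => rw [map_add, map_add, hp, hq]; ext y; simp [add_mul]
  | monomial n a =>
    ext y
    simp [Polynomial.aeval_monomial, Algebra.smul_def]

theorem aeval_mulRight {A : Type*} [Ring A] [Algebra F A] (x : A) (p : Polynomial F) :
    Polynomial.aeval (R := F) (A := End F A) (LinearMap.mulRight F x) p =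
      LinearMap.mulRight F (Polynomial.aeval x p) := by
  induction p using Polynomial.induction_on' with
  | add p q hp hq => rw [map_add, map_add, hp, hq]; ext y; simp [mul_add]
  | monomial n a =>
    ext y
    simp [Polynomial.aeval_monomial, Algebra.algebraMap_eq_smul_one]

/-- For semisimple `x` the operator `ad x` is semisimple, so that its generalized kernel is its
kernel. -/
theorem IsSemisimpleEnd.ad_eq_zero_of_pow [PerfectField F] {x : End Dᵐᵒᵖ V}
    (hx : IsSemisimpleEnd x) {k : ℕ} {y : End Dᵐᵒᵖ V}
    (h : ((LinearMap.mulLeft F x - LinearMap.mulRight F x) ^ k) y = 0) : x * y = y * x := by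
  have hsq := minpoly_squarefree_of_adjoin_reduced (F := F) fun _ hn hnil =>
    hx.eq_zero_of_isNilpotent (F := F) hnil hn
  have hl : Module.End.IsSemisimple (R := F) (LinearMap.mulLeft F x) :=
    Module.End.isSemisimple_of_squarefree_aeval_eq_zero hsq (by
      rw [aeval_mulLeft, minpoly.aeval]; ext; simp)
  have hr : Module.End.IsSemisimple (R := F) (LinearMap.mulRight F x) :=
    Module.End.isSemisimple_of_squarefree_aeval_eq_zero hsq (by
      rw [aeval_mulRight, minpoly.aeval]; ext; simp)
  have hs := Module.End.IsSemisimple.sub_of_commute (LinearMap.commute_mulLeft_right x x) hl hr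
  have h0 := hs.isFinitelySemisimple.maxGenEigenspace_eq_eigenspace 0
  have hy : y ∈ Module.End.maxGenEigenspace
      (LinearMap.mulLeft F x - LinearMap.mulRight F x) 0 := by
    rw [Module.End.mem_maxGenEigenspace]
    exact ⟨k, by simpa using h⟩
  rw [h0, Module.End.mem_eigenspace_iff] at hy
  simpa [sub_eq_zero] using hy

/-- The Engel subalgebra of a regular element is nilpotent. -/
theorem isNilpotent_engel_of_isRegular [Infinite F] {L : Type*} [LieRing L] [LieAlgebra F L]
    [Module.Finite F L] {x : L} (hx : LieAlgebra.IsRegular F x) :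
    LieRing.IsNilpotent (LieSubalgebra.engel F x) := by
  apply LieSubalgebra.isNilpotent_of_forall_le_engel (R := F)
  intro y hy
  set Ex : {LieSubalgebra.engel F z | z ∈ LieSubalgebra.engel F x} :=
    ⟨LieSubalgebra.engel F x, x, LieSubalgebra.self_mem_engel _ _, rfl⟩
  suffices IsBot Ex from @this ⟨LieSubalgebra.engel F y, y, hy, rfl⟩
  apply LieAlgebra.engel_isBot_of_isMin
    (Cardinal.natCast_le_aleph0.trans <| Cardinal.infinite_iff.mp ‹Infinite F›)
    (LieSubalgebra.engel F x) Ex le_rfl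
  rintro ⟨_, y, hy, rfl⟩ hyx
  suffices LieSubalgebra.engel F y = LieSubalgebra.engel F x from this.ge
  apply LieSubalgebra.toSubmodule_injective
  refine Submodule.eq_of_le_of_finrank_le hyx ?_
  have := (LieAlgebra.isRegular_iff_finrank_engel_eq_rank F x).mp hx
  exact this.le.trans (LieAlgebra.rank_le_finrank_engel F y)

/-- The non-degeneracy of the trace form `tr_F(y z)` of a Lie algebra of endomorphisms. -/
def TraceNondeg (L : LieSubalgebra F (End Dᵐᵒᵖ V)) : Prop :=
  ∀ y ∈ L, (∀ z ∈ L, trF (F := F) (y * z) = 0) → y = 0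

variable {L 𝔥 : LieSubalgebra F (End Dᵐᵒᵖ V)}

theorem IsCartan.le (h : IsCartan L 𝔥) : 𝔥 ≤ L := by
  obtain ⟨h, -, -, h𝔥⟩ := h
  exact fun z hz => ((h𝔥 z).1 hz).1

theorem ad_pow_coe (h y : L) (k : ℕ) :
    (((LieAlgebra.ad F L h ^ k) y : L) : End Dᵐᵒᵖ V) =
      ((LinearMap.mulLeft F (h : End Dᵐᵒᵖ V) - LinearMap.mulRight F (h : End Dᵐᵒᵖ V)) ^ k)
        (y : End Dᵐᵒᵖ V) := by
  induction k with
  | zero => rfl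
  | succ k ih =>
    rw [pow_succ', pow_succ', Module.End.mul_apply, Module.End.mul_apply, ← ih]
    rfl

/-- The Engel subalgebra of a semisimple element is its centralizer. -/
theorem mem_engel_iff_of_isSemisimpleEnd [CharZero F] {h : L}
    (hs : IsSemisimpleEnd (h : End Dᵐᵒᵖ V)) (y : L) :
    y ∈ LieSubalgebra.engel F h ↔ (h : End Dᵐᵒᵖ V) * y = y * h := by
  rw [LieSubalgebra.mem_engel_iff]
  constructor
  · rintro ⟨k, hk⟩
    refine hs.ad_eq_zero_of_pow (F := F) (k := k) ?_
    rw [← ad_pow_coe, hk]; rfl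
  · intro hy
    refine ⟨1, ?_⟩
    rw [pow_one]
    apply Subtype.ext
    exact (lie_eq_zero_iff_commute _ _).2 hy

/-- The trace form stays non-degenerate on a Cartan subalgebra: for semisimple `h` the Lie algebra
is the orthogonal sum of the kernel and the image of `ad h`. -/
theorem IsCartan.traceNondeg [CharZero F] (hL : TraceNondeg L) (h : IsCartan L 𝔥) :
    TraceNondeg 𝔥 := by
  have hle := h.le
  obtain ⟨h, hreg, hs, h𝔥⟩ := h
  intro y hy hy0
  refine hL y (hle hy) fun z hz => ?_
  let f : L →ₗ[F] L := LieAlgebra.ad F L h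
  have hdisj : Disjoint (LinearMap.ker f) (LinearMap.range f) := by
    rw [Submodule.disjoint_def]
    rintro _ h1 ⟨u, rfl⟩
    have h2 : (f ^ 2) u = 0 := by rw [pow_two]; exact h1
    have h3 : (u : L) ∈ LieSubalgebra.engel F h := (LieSubalgebra.mem_engel_iff _ _ _).2 ⟨2, h2⟩
    apply Subtype.ext
    exact (lie_eq_zero_iff_commute _ _).2 ((mem_engel_iff_of_isSemisimpleEnd hs u).1 h3)
  have htop : LinearMap.ker f ⊔ LinearMap.range f = ⊤ := by
    apply Submodule.eq_top_of_disjoint _ _ _ hdisj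
    rw [add_comm]
    exact (LinearMap.finrank_range_add_finrank_ker f).ge
  have hmem : (⟨z, hz⟩ : L) ∈ LinearMap.ker f ⊔ LinearMap.range f := by rw [htop]; trivial
  obtain ⟨a, ha, b, ⟨c, rfl⟩, hab⟩ := Submodule.mem_sup.1 hmem
  have ha' : (a : End Dᵐᵒᵖ V) ∈ 𝔥 := (h𝔥 _).2 ⟨a.2, congrArg Subtype.val ha⟩
  have hz' : z = a + ((h : End Dᵐᵒᵖ V) * c - c * h) := (congrArg Subtype.val hab).symm
  have hyh : (h : End Dᵐᵒᵖ V) * y = y * h := (lie_eq_zero_iff_commute _ _).1 ((h𝔥 y).1 hy).2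
  have hsub : ∀ p q : End Dᵐᵒᵖ V, trF (F := F) (p - q) = trF p - trF q := fun p q => by
    rw [trF_eq_trace, map_sub, map_sub]; rfl
  rw [hz', mul_add, trF_add, hy0 a ha', zero_add, mul_sub, hsub, ← mul_assoc, ← mul_assoc,
    ← hyh, mul_assoc (h : End Dᵐᵒᵖ V), trF_mul_comm, sub_self]

/-- A Cartan subalgebra of a Lie algebra with non-degenerate trace form is commutative. -/
theorem IsCartan.commute [CharZero F] (hL : TraceNondeg L) (h : IsCartan L 𝔥)
    {x y : End Dᵐᵒᵖ V} (hx : x ∈ 𝔥) (hy : y ∈ 𝔥) : x * y = y * x := by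
  have hle := h.le
  have hnd := h.traceNondeg hL
  obtain ⟨h, hreg, hs, h𝔥⟩ := h
  let H : LieSubalgebra F L := LieSubalgebra.engel F h
  have hnil : LieRing.IsNilpotent H := isNilpotent_engel_of_isRegular hreg
  have hmem : ∀ y : L, y ∈ H ↔ (y : End Dᵐᵒᵖ V) ∈ 𝔥 := fun y => by
    rw [mem_engel_iff_of_isSemisimpleEnd hs, h𝔥, lie_eq_zero_iff_commute]
    simp
  let : LieRingModule H V :=
    { bracket := fun a v => ((a : L) : End Dᵐᵒᵖ V) v
      add_lie := fun _ _ _ => rfl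
      lie_add := fun a => map_add ((a : L) : End Dᵐᵒᵖ V)
      leibniz_lie := fun _ _ _ => (sub_add_cancel _ _).symm }
  let : LieModule F H V :=
    { smul_lie := fun _ _ _ => rfl
      lie_smul := fun c a v => LinearMap.map_smul_of_tower ((a : L) : End Dᵐᵒᵖ V) c v }
  have hab : IsLieAbelian H := by
    apply LieModule.isLieAbelian_of_ker_traceForm_eq_bot F H V
    rw [LinearMap.ker_eq_bot']
    intro a ha
    have h1 : ((a : L) : End Dᵐᵒᵖ V) = 0 := by
      refine hnd _ ((hmem _).1 a.2) fun z hz => ?_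
      let z' : H := ⟨⟨z, hle hz⟩, (hmem _).2 hz⟩
      have h2 := LinearMap.congr_fun ha z'
      rw [LieModule.traceForm_apply_apply] at h2
      exact h2
    exact Subtype.ext (Subtype.ext h1)
  let x' : H := ⟨⟨x, hle hx⟩, (hmem _).2 hx⟩
  let y' : H := ⟨⟨y, hle hy⟩, (hmem _).2 hy⟩
  have h3 : ⁅x', y'⁆ = 0 := hab.trivial x' y'
  exact (lie_eq_zero_iff_commute x y).1 (congrArg (fun t : H => ((t : L) : End Dᵐᵒᵖ V)) h3)

theorem IsCartan.eq_zero_of_isNilpotent [CharZero F] (hL : TraceNondeg L) (h : IsCartan L 𝔥)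
    {n : End Dᵐᵒᵖ V} (hn : n ∈ 𝔥) (hnil : IsNilpotent n) : n = 0 :=
  h.traceNondeg hL n hn fun _ hz =>
    trF_eq_zero_of_isNilpotent (Commute.isNilpotent_mul_right (h.commute hL hn hz) hnil)

/-- The centralizer of a regular element of a Cartan subalgebra is contained in it: the Engel
subalgebra of that element contains the Cartan subalgebra and has the same dimension. -/
theorem IsCartan.mem_of_commute [CharZero F] (hL : TraceNondeg L) (h : IsCartan L 𝔥) {x : L}
    (hx : (x : End Dᵐᵒᵖ V) ∈ 𝔥) (hxr : LieAlgebra.IsRegular F x) {z : End Dᵐᵒᵖ V} (hz : z ∈ L)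
    (hxz : (x : End Dᵐᵒᵖ V) * z = z * x) : z ∈ 𝔥 := by
  have hcomm := fun y => h.commute hL hx (y := y)
  obtain ⟨h, hreg, hs, h𝔥⟩ := h
  have hmem : ∀ y : L, y ∈ LieSubalgebra.engel F h ↔ (y : End Dᵐᵒᵖ V) ∈ 𝔥 := fun y => by
    rw [mem_engel_iff_of_isSemisimpleEnd hs, h𝔥, lie_eq_zero_iff_commute]
    simp
  have hengel : ∀ y : L, (x : End Dᵐᵒᵖ V) * y = y * x → y ∈ LieSubalgebra.engel F x :=
    fun y hy => (LieSubalgebra.mem_engel_iff _ _ _).2 ⟨1, by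
      rw [pow_one]
      exact Subtype.ext ((lie_eq_zero_iff_commute _ _).2 hy)⟩
  have hsub : (LieSubalgebra.engel F h).toSubmodule ≤ (LieSubalgebra.engel F x).toSubmodule :=
    fun y hy => hengel y (hcomm _ ((hmem y).1 hy))
  have heq : (LieSubalgebra.engel F h).toSubmodule = (LieSubalgebra.engel F x).toSubmodule := by
    refine Submodule.eq_of_le_of_finrank_le hsub ?_
    exact (((LieAlgebra.isRegular_iff_finrank_engel_eq_rank F x).mp hxr).trans
      ((LieAlgebra.isRegular_iff_finrank_engel_eq_rank F h).mp hreg).symm).le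
  have : (⟨z, hz⟩ : L) ∈ (LieSubalgebra.engel F h).toSubmodule := by
    rw [heq]; exact hengel ⟨z, hz⟩ hxz
  exact (hmem _).1 this

end Cartan

/-! ### Idempotents of reduced commutative algebras -/

section ReducedAlgebra

open TensorProduct

variable (F : Type*) [Field F] {S : Type*} [CommRing S] [Algebra F S] [Module.Finite F S]
  [IsReduced S]

/-- A reduced finite dimensional commutative algebra is a product of fields; this is expressed by
its primitive idempotents. -/
theorem exists_primitive_idempotents (F : Type*) [Field F] {S : Type*} [CommRing S] [Algebra F S]
    [Module.Finite F S] [IsReduced S] : ∃ (n : ℕ) (e : Fin n → S),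
    (∀ i, e i * e i = e i) ∧ (∀ i j, i ≠ j → e i * e j = 0) ∧ ∑ i, e i = 1 ∧ (∀ i, e i ≠ 0) ∧
      ∀ i (r : S), r * e i = 0 ∨ ∃ r', r' * (r * e i) = e i := by
  classical
  have : IsArtinianRing S := IsArtinianRing.of_finite F S
  let : ∀ I : MaximalSpectrum S, Field (S ⧸ I.asIdeal) := fun I => Ideal.Quotient.field I.asIdeal
  let E := IsArtinianRing.equivPi S
  let : Fintype (MaximalSpectrum S) := Fintype.ofFinite _
  let φ := Fintype.equivFin (MaximalSpectrum S)
  let e : Fin (Fintype.card (MaximalSpectrum S)) → S := fun i =>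
    E.symm (Pi.single (φ.symm i) 1)
  refine ⟨_, e, fun i => ?_, fun i j hij => ?_, ?_, fun i h => ?_, fun i r => ?_⟩
  · rw [← map_mul, ← Pi.single_mul, one_mul]
  · have hij' : φ.symm i ≠ φ.symm j := fun h => hij (φ.symm.injective h)
    rw [← map_mul, ← map_zero E.symm]
    congr 1
    ext I
    by_cases h : I = φ.symm i
    · subst h
      simp [Pi.single_eq_of_ne hij']
    · simp [Pi.single_eq_of_ne h]
  · rw [← map_sum, ← map_one E.symm]
    congr 1
    rw [φ.symm.sum_comp
      (fun I => Pi.single (M := fun I : MaximalSpectrum S => S ⧸ I.asIdeal) I 1)]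
    exact Finset.univ_sum_single (1 : ∀ I : MaximalSpectrum S, S ⧸ I.asIdeal)
  · have h1 : (Pi.single (φ.symm i) 1 : ∀ I : MaximalSpectrum S, S ⧸ I.asIdeal) = 0 :=
      E.symm.injective (by rw [map_zero]; exact h)
    have h2 := congrFun h1 (φ.symm i)
    rw [Pi.single_eq_same] at h2
    exact one_ne_zero h2
  · have key : ∀ s : S, s * e i = E.symm (Pi.single (φ.symm i) (E s (φ.symm i))) := fun s => by
      apply E.injective
      rw [map_mul, E.apply_symm_apply, E.apply_symm_apply]
      ext I
      by_cases h : I = φ.symm i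
      · subst h; simp
      · simp [Pi.single_eq_of_ne h]
    by_cases h : E r (φ.symm i) = 0
    · left
      rw [key, h, Pi.single_zero, map_zero]
    · right
      refine ⟨E.symm (Pi.single (φ.symm i) (E r (φ.symm i))⁻¹), ?_⟩
      rw [key, ← map_mul, ← Pi.single_mul, inv_mul_cancel₀ h]

/-- In characteristic zero a reduced finite dimensional commutative algebra is separable. -/
theorem formallyUnramified_of_isReduced [CharZero F] : Algebra.FormallyUnramified F S := by
  have : IsArtinianRing S := IsArtinianRing.of_finite F S
  let : ∀ I : MaximalSpectrum S, Field (S ⧸ I.asIdeal) := fun I => Ideal.Quotient.field I.asIdeal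
  let : Fintype (MaximalSpectrum S) := Fintype.ofFinite _
  have h : Algebra.FormallyUnramified F (∀ I : MaximalSpectrum S, S ⧸ I.asIdeal) := by
    rw [Algebra.FormallyUnramified.pi_iff]
    intro I
    exact Algebra.FormallyUnramified.of_isSeparable F (S ⧸ I.asIdeal)
  exact Algebra.FormallyUnramified.of_equiv ((IsArtinianRing.equivPi S).symm.restrictScalars F)

/-- The separability idempotent of `S`. -/
theorem exists_separability_element [CharZero F] : ∃ t : S ⊗[F] S,
    (∀ s : S, (1 ⊗ₜ[F] s) * t = (s ⊗ₜ[F] 1) * t) ∧ Algebra.TensorProduct.lmul' F t = 1 := by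
  have := formallyUnramified_of_isReduced F (S := S)
  exact ⟨Algebra.FormallyUnramified.elem F S, Algebra.FormallyUnramified.one_tmul_mul_elem,
    Algebra.FormallyUnramified.lmul_elem⟩

end ReducedAlgebra

/-! ### Complete reducibility under reduced commutative algebras -/

section Maschke

open TensorProduct

variable {F : Type*} [Field F] {D : Type*} [DivisionRing D] [Algebra F D]
variable {V : Type*} [AddCommGroup V] [Module F V] [Module Dᵐᵒᵖ V] [IsScalarTower F Dᵐᵒᵖ V]
variable [FiniteDimensional F V]

/-- Complete reducibility for a reduced commutative algebra `S` of `D`-linear endomorphisms: an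
`S`-stable `D`-subspace is the image of an idempotent that commutes with `S`. A `D`-linear projection
is averaged with the separability idempotent of `S`. -/
theorem exists_commuting_projection [CharZero F] (S : Subalgebra F (End Dᵐᵒᵖ V))
    (hcomm : ∀ x ∈ S, ∀ y ∈ S, x * y = y * x) (hred : ∀ x ∈ S, IsNilpotent x → x = 0)
    (U : Submodule Dᵐᵒᵖ V) (hU : ∀ s ∈ S, ∀ u ∈ U, s u ∈ U) :
    ∃ p : End Dᵐᵒᵖ V, (∀ s ∈ S, s * p = p * s) ∧ (∀ v, p v ∈ U) ∧ ∀ u ∈ U, p u = u := by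
  let : CommRing S := { (inferInstance : Ring S) with
    mul_comm := fun x y => Subtype.ext (hcomm x x.2 y y.2) }
  have : IsReduced S := ⟨fun x hx => Subtype.ext (hred x x.2 (hx.map S.val))⟩
  obtain ⟨t, ht, ht1⟩ := exists_separability_element F (S := S)
  obtain ⟨q, hq⟩ := U.subtype.exists_leftInverse_of_injective U.ker_subtype
  let π : End Dᵐᵒᵖ V := U.subtype ∘ₗ q
  have hπ : ∀ u ∈ U, π u = u := fun u hu =>
    congrArg Subtype.val (LinearMap.congr_fun hq ⟨u, hu⟩)
  -- the map `a ⊗ b ↦ a π b`, which is to be evaluated at the separability idempotent `t`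
  let Φ : S ⊗[F] S →ₗ[F] End Dᵐᵒᵖ V := TensorProduct.lift
    (LinearMap.mk₂ F (fun a b : S => (a : End Dᵐᵒᵖ V) * π * (b : End Dᵐᵒᵖ V))
      (fun a b c => by simp [add_mul]) (fun r a b => by simp)
      (fun a b c => by simp [mul_add]) (fun r a b => by simp))
  have hΦ : ∀ a b : S, Φ (a ⊗ₜ b) = (a : End Dᵐᵒᵖ V) * π * (b : End Dᵐᵒᵖ V) := fun a b => rfl
  have h1 : ∀ (s : S) (z : S ⊗[F] S), Φ ((s ⊗ₜ 1) * z) = (s : End Dᵐᵒᵖ V) * Φ z := by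
    intro s z
    induction z with
    | zero => simp
    | add x y hx hy => rw [mul_add, map_add, hx, hy, map_add, mul_add]
    | tmul a b =>
      rw [Algebra.TensorProduct.tmul_mul_tmul, hΦ, hΦ, one_mul, Subalgebra.coe_mul]
      simp only [mul_assoc]
  have h2 : ∀ (s : S) (z : S ⊗[F] S), Φ ((1 ⊗ₜ s) * z) = Φ z * (s : End Dᵐᵒᵖ V) := by
    intro s z
    induction z with
    | zero => simp
    | add x y hx hy => rw [mul_add, map_add, hx, hy, map_add, add_mul]
    | tmul a b =>
      rw [Algebra.TensorProduct.tmul_mul_tmul, hΦ, hΦ, one_mul, mul_comm s b, Subalgebra.coe_mul]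
      simp only [mul_assoc]
  have h3 : ∀ (z : S ⊗[F] S) (v : V), Φ z v ∈ U := by
    intro z v
    induction z with
    | zero => simp
    | add x y hx hy => rw [map_add]; exact U.add_mem hx hy
    | tmul a b => exact hU a a.2 _ (q _).2
  have h4 : ∀ (z : S ⊗[F] S), ∀ u ∈ U,
      Φ z u = ((Algebra.TensorProduct.lmul' F z : S) : End Dᵐᵒᵖ V) u := by
    intro z u hu
    induction z with
    | zero => simp
    | add x y hx hy => rw [map_add, map_add, LinearMap.add_apply, hx, hy]; rfl
    | tmul a b =>
      rw [hΦ, Algebra.TensorProduct.lmul'_apply_tmul, Subalgebra.coe_mul, Module.End.mul_apply,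
        Module.End.mul_apply, Module.End.mul_apply, hπ _ (hU b b.2 u hu)]
  refine ⟨Φ t, fun s hs => ?_, h3 t, fun u hu => ?_⟩
  · rw [← h1 ⟨s, hs⟩, ← h2 ⟨s, hs⟩, ht]
  · rw [h4 t u hu, ht1]; rfl

/-- The primitive idempotents of a reduced commutative algebra `S` of endomorphisms. Primitivity is
expressed by `field`: every element of `S` is zero or invertible on the image of `e i`. -/
structure PrimitiveIdempotents (S : Subalgebra F (End Dᵐᵒᵖ V)) (n : ℕ)
    (e : Fin n → End Dᵐᵒᵖ V) : Prop where
  mem : ∀ i, e i ∈ S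
  idem : ∀ i, e i * e i = e i
  orth : ∀ i j, i ≠ j → e i * e j = 0
  sum : ∑ i, e i = 1
  ne_zero : ∀ i, e i ≠ 0
  field : ∀ i, ∀ r ∈ S, r * e i = 0 ∨ ∃ r' ∈ S, r' * (r * e i) = e i

theorem exists_primitiveIdempotents (S : Subalgebra F (End Dᵐᵒᵖ V))
    (hcomm : ∀ x ∈ S, ∀ y ∈ S, x * y = y * x) (hred : ∀ x ∈ S, IsNilpotent x → x = 0) :
    ∃ n e, PrimitiveIdempotents S n e := by
  let : CommRing S := { (inferInstance : Ring S) with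
    mul_comm := fun x y => Subtype.ext (hcomm x x.2 y y.2) }
  have : IsReduced S := ⟨fun x hx => Subtype.ext (hred x x.2 (hx.map S.val))⟩
  obtain ⟨n, e, h1, h2, h3, h4, h5⟩ := exists_primitive_idempotents F (S := S)
  refine ⟨n, fun i => e i, fun i => (e i).2, fun i => congrArg Subtype.val (h1 i),
    fun i j hij => congrArg Subtype.val (h2 i j hij), ?_, fun i h => h4 i (Subtype.ext h),
    fun i r hr => ?_⟩
  · have := congrArg S.val h3
    rwa [map_sum, map_one] at this
  · rcases h5 i ⟨r, hr⟩ with h | ⟨r', h⟩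
    · exact Or.inl (congrArg Subtype.val h)
    · exact Or.inr ⟨r', r'.2, congrArg Subtype.val h⟩

/-- An idempotent of a field is `0` or `1`. -/
theorem PrimitiveIdempotents.mul_eq_zero_or_eq {S : Subalgebra F (End Dᵐᵒᵖ V)} {n : ℕ}
    {e : Fin n → End Dᵐᵒᵖ V} (h : PrimitiveIdempotents S n e)
    {p : End Dᵐᵒᵖ V} (hp : p ∈ S) (hpp : p * p = p) (i : Fin n) (hc : p * e i = e i * p) :
    p * e i = 0 ∨ p * e i = e i := by
  rcases h.field i p hp with h0 | ⟨r, -, hr⟩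
  · exact Or.inl h0
  · right
    calc p * e i = (r * (p * e i)) * p := by rw [hr, hc]
      _ = r * (p * (p * e i)) := by rw [mul_assoc, mul_assoc, ← hc]
      _ = e i := by rw [← mul_assoc p, hpp, hr]

/-- An invariant irreducible subspace lies in the image of one primitive idempotent. -/
theorem PrimitiveIdempotents.exists_of_irreducible {S : Subalgebra F (End Dᵐᵒᵖ V)} {n : ℕ}
    {e : Fin n → End Dᵐᵒᵖ V} (h : PrimitiveIdempotents S n e) {T : Set (End Dᵐᵒᵖ V)}
    {U : Submodule Dᵐᵒᵖ V} (hU : IsIrreducibleUnder T U)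
    (hT : ∀ i, ∀ s ∈ T, s * e i = e i * s) (hSU : ∀ i, ∀ u ∈ U, e i u ∈ U) :
    ∃ i, ∀ u ∈ U, e i u = u := by
  by_contra! hne
  have hzero : ∀ i, ∀ u ∈ U, e i u = 0 := by
    intro i
    rcases hU.2.2 (U.map (e i)) (by rintro _ ⟨u, hu, rfl⟩; exact hSU i u hu) (by
      rintro s hs _ ⟨u, hu, rfl⟩
      exact ⟨s u, hU.2.1 s hs u hu, (LinearMap.congr_fun (hT i s hs) u).symm⟩) with h0 | h0
    · intro u hu
      have : e i u ∈ U.map (e i) := ⟨u, hu, rfl⟩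
      rwa [h0, Submodule.mem_bot] at this
    · exfalso
      obtain ⟨u, hu, hne⟩ := hne i
      rw [← h0] at hu
      obtain ⟨v, -, rfl⟩ := hu
      exact hne (LinearMap.congr_fun (h.idem i) v)
  apply hU.1
  rw [Submodule.eq_bot_iff]
  intro u hu
  have := LinearMap.congr_fun h.sum u
  rw [LinearMap.sum_apply, Finset.sum_eq_zero fun i _ => hzero i u hu] at this
  exact this.symm

/-- Every non-zero invariant subspace contains an irreducible one. -/
theorem exists_irreducible_le [Module.Finite Dᵐᵒᵖ V] (T : Set (End Dᵐᵒᵖ V))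
    (U : Submodule Dᵐᵒᵖ V) (hU : U ≠ ⊥) (hT : ∀ s ∈ T, ∀ u ∈ U, s u ∈ U) :
    ∃ U₁ ≤ U, IsIrreducibleUnder T U₁ := by
  let P : Set (Submodule Dᵐᵒᵖ V) := {U₁ | U₁ ≤ U ∧ U₁ ≠ ⊥ ∧ ∀ s ∈ T, ∀ u ∈ U₁, s u ∈ U₁}
  obtain ⟨U₁, ⟨h1, h2, h3⟩, hmin⟩ :=
    WellFounded.has_min (wellFounded_lt (α := Submodule Dᵐᵒᵖ V)) P ⟨U, le_rfl, hU, hT⟩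
  refine ⟨U₁, h1, h2, h3, fun U₂ hle hs => ?_⟩
  by_contra! hne
  exact hmin U₂ ⟨hle.trans h1, hne.1, hs⟩ (lt_of_le_of_ne hle hne.2)

end Maschke

/-! ### The weight decomposition of a split torus -/

section Blocks

variable {F : Type*} [Field F] {W : Type*} [AddCommGroup W] [Module F W]

/-- The weight blocks of a split torus `A` in `Sp(W, ω)`: a decomposition of `W` by projections
`p k`, dual to each other under `ω` according to the involution `bar`, such that `A` consists of all
transformations that act on the blocks by scalars, inverse to each other on dual blocks and trivial
on self-dual ones. -/
structure TorusBlocks (ω : W →ₗ[F] W →ₗ[F] F) (A : Subgroup (W ≃ₗ[F] W)) {K : Type*} [Fintype K]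
    (bar : K → K) (p : K → End F W) : Prop where
  nondeg : ∀ w, (∀ u, ω u w = 0) → w = 0
  skew : ∀ u v, ω u v = -ω v u
  bar_bar : ∀ k, bar (bar k) = k
  idem : ∀ k, p k * p k = p k
  orth : ∀ k l, k ≠ l → p k * p l = 0
  sum : ∑ k, p k = 1
  adj : ∀ k u v, ω (p k u) v = ω u (p (bar k) v)
  mem_iff : ∀ a : W ≃ₗ[F] W, a ∈ A ↔ ∃ c : K → Fˣ, (∀ k, c k * c (bar k) = 1) ∧
    (∀ k, bar k = k → c k = 1) ∧ ∀ w, a w = ∑ k, (c k : F) • p k w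

/-- The condition that makes the conormal directions harmless: an element `w` that is annihilated
by `X' + z` and at which the moment map of `𝔤` vanishes lies in a sum of blocks on which the
one-parameter subgroup of the torus with some exponents `ζ` acts as `t ↦ t`. -/
structure ConormalCondition (ω : W →ₗ[F] W →ₗ[F] F) (A : Subgroup (W ≃ₗ[F] W)) {K : Type*}
    [Fintype K] (bar : K → K) (p : K → End F W) (𝔤 : Submodule F (End F W)) (X' : End F W) :
    Prop where
  symplectic : ∀ z ∈ 𝔤, ∀ u v, ω ((X' + z) u) v + ω u ((X' + z) v) = 0
  commute_torus : ∀ z ∈ 𝔤, ∀ a ∈ A, ∀ w, (X' + z) (a w) = a ((X' + z) w)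
  commute_block : ∀ z ∈ 𝔤, ∀ k, (X' + z) * p k = p k * (X' + z)
  exponents : ∀ z ∈ 𝔤, ∀ w, (X' + z) w = 0 → (∀ Y ∈ 𝔤, ω (Y w) w = 0) →
    ∃ ζ : K → ℤ, (∀ k, ζ (bar k) = -ζ k) ∧ ∀ k, p k w ≠ 0 → ζ k = 1

end Blocks

/-! ### Diagonal automorphisms -/

section Scalars

variable {F : Type*} [Field F] {D : Type*} [DivisionRing D] [Algebra F D]
variable {V : Type*} [AddCommGroup V] [Module F V] [Module Dᵐᵒᵖ V] [IsScalarTower F Dᵐᵒᵖ V]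
variable [FiniteDimensional F V]
variable {S : Subalgebra F (End Dᵐᵒᵖ V)} {n : ℕ} {e : Fin n → End Dᵐᵒᵖ V}

theorem PrimitiveIdempotents.sum_smul_mul (h : PrimitiveIdempotents S n e) (c d : Fin n → F) :
    (∑ i, c i • e i) * (∑ i, d i • e i) = ∑ i, (c i * d i) • e i := by
  rw [Finset.sum_mul]
  refine Finset.sum_congr rfl fun i _ => ?_
  rw [Finset.mul_sum, Finset.sum_eq_single i]
  · rw [smul_mul_smul_comm, h.idem]
  · intro j _ hj
    rw [smul_mul_smul_comm, h.orth i j (Ne.symm hj), smul_zero]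
  · simp

/-- The automorphism with the eigenvalues `c i` on the images of the idempotents `e i`. -/
def PrimitiveIdempotents.diag (h : PrimitiveIdempotents S n e) (c : Fin n → Fˣ) :
    V ≃ₗ[Dᵐᵒᵖ] V :=
  LinearEquiv.ofLinearMap (∑ i, (c i : F) • e i) (∑ i, ((c i)⁻¹ : Fˣ).val • e i)
    (by
      have := h.sum_smul_mul (fun i => (c i : F)) (fun i => ((c i)⁻¹ : Fˣ).val)
      simp only [Units.mul_inv, one_smul, h.sum] at this
      exact this)
    (by
      have := h.sum_smul_mul (fun i => ((c i)⁻¹ : Fˣ).val) (fun i => (c i : F))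
      simp only [Units.inv_mul, one_smul, h.sum] at this
      exact this)

theorem PrimitiveIdempotents.diag_toLinearMap (h : PrimitiveIdempotents S n e) (c : Fin n → Fˣ) :
    (h.diag c).toLinearMap = ∑ i, (c i : F) • e i := rfl

theorem PrimitiveIdempotents.diag_symm_toLinearMap (h : PrimitiveIdempotents S n e)
    (c : Fin n → Fˣ) :
    (h.diag c).symm.toLinearMap = ∑ i, ((c i)⁻¹ : Fˣ).val • e i := rfl

theorem PrimitiveIdempotents.diag_apply_of_fixed (h : PrimitiveIdempotents S n e)
    (c : Fin n → Fˣ) {i : Fin n} {u : V} (hu : e i u = u) : h.diag c u = (c i : F) • u := by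
  change (∑ i, (c i : F) • e i) u = _
  rw [LinearMap.sum_apply, Finset.sum_eq_single i]
  · rw [LinearMap.smul_apply, hu]
  · intro j _ hj
    rw [← hu, LinearMap.smul_apply, ← Module.End.mul_apply, h.orth j i hj]
    simp
  · simp

theorem PrimitiveIdempotents.eq_diag (h : PrimitiveIdempotents S n e) {a : V ≃ₗ[Dᵐᵒᵖ] V}
    {c : Fin n → Fˣ} (ha : ∀ i, ∀ v, a (e i v) = (c i : F) • e i v) : a = h.diag c := by
  ext v
  have h1 : ∀ v, v = ∑ i, e i v := fun v => by
    rw [← LinearMap.sum_apply, h.sum]; rfl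
  change a v = (∑ i, (c i : F) • e i) v
  conv_lhs => rw [h1 v]
  rw [map_sum, LinearMap.sum_apply]
  exact Finset.sum_congr rfl fun i _ => ha i v

theorem commute_sum_smul {x : End Dᵐᵒᵖ V} (hx : ∀ i, x * e i = e i * x) (c : Fin n → F) :
    x * (∑ i, c i • e i) = (∑ i, c i • e i) * x := by
  rw [Finset.mul_sum, Finset.sum_mul]
  exact Finset.sum_congr rfl fun i _ => by rw [mul_smul_comm, smul_mul_assoc, hx]

theorem smulF_mem (U : Submodule Dᵐᵒᵖ V) (c : F) {u : V} (hu : u ∈ U) : c • u ∈ U := by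
  rw [← algebraMap_smul Dᵐᵒᵖ c u]
  exact U.smul_mem _ hu

/-- A `D`-subspace stable under `T` is stable under the algebra generated by `T`. -/
theorem adjoin_stable {T : Set (End Dᵐᵒᵖ V)} {U : Submodule Dᵐᵒᵖ V}
    (hU : ∀ x ∈ T, ∀ u ∈ U, x u ∈ U) {s : End Dᵐᵒᵖ V}
    (hs : s ∈ Algebra.adjoin F T) : ∀ u ∈ U, s u ∈ U := by
  refine Algebra.adjoin_induction (p := fun n _ => ∀ u ∈ U, n u ∈ U) hU ?_ ?_ ?_ hs
  · intro r u hu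
    exact smulF_mem U r hu
  · intro a b _ _ ha hb u hu
    exact U.add_mem (ha u hu) (hb u hu)
  · intro a b _ _ ha hb u hu
    exact ha _ (hb u hu)

end Scalars

/-! ### Pairs of type II -/

section TypeII

variable {F : Type*} [Field F] [CharZero F] {D : Type*} [DivisionRing D] [Algebra F D]
variable {V : Type*} [AddCommGroup V] [Module F V] [Module Dᵐᵒᵖ V] [IsScalarTower F Dᵐᵒᵖ V]
variable {V' : Type*} [AddCommGroup V'] [Module F V'] [Module Dᵐᵒᵖ V'] [IsScalarTower F Dᵐᵒᵖ V']
variable [FiniteDimensional F V] [FiniteDimensional F V']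

theorem traceNondeg_top : TraceNondeg (⊤ : LieSubalgebra F (End Dᵐᵒᵖ V)) := by
  intro y _ hy
  refine eq_zero_of_trF_comp_eq_zero (F := F) fun g => ?_
  have := hy g trivial
  rw [trF_mul_comm] at this
  exact this

/-- A Cartan subalgebra of `End_D(V')` as an associative algebra; it is its own centralizer. -/
theorem IsCartan.exists_subalgebra {𝔥 : LieSubalgebra F (End Dᵐᵒᵖ V')} (h : IsCartan ⊤ 𝔥) :
    ∃ S : Subalgebra F (End Dᵐᵒᵖ V'), (∀ z, z ∈ S ↔ z ∈ 𝔥) ∧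
      ∀ z, (∀ s ∈ S, s * z = z * s) → z ∈ S := by
  obtain ⟨h, -, -, hh⟩ := h
  refine ⟨Subalgebra.centralizer F {(h : End Dᵐᵒᵖ V')}, fun z => ?_, fun z hz => ?_⟩
  · rw [Subalgebra.mem_centralizer_iff, hh, lie_eq_zero_iff_commute]
    simp [eq_comm]
  · rw [Subalgebra.mem_centralizer_iff]
    rintro _ rfl
    refine hz _ ?_
    rw [Subalgebra.mem_centralizer_iff]
    rintro _ rfl
    rfl

/-- In `GL_D(V')` the split part of a Cartan subgroup consists of the automorphisms acting by
scalars on the images of the primitive idempotents of the Cartan subalgebra, because these images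
are irreducible. -/
theorem mem_splitPartGL_iff {𝔥 : LieSubalgebra F (End Dᵐᵒᵖ V')} (h𝔥 : IsCartan ⊤ 𝔥)
    {S : Subalgebra F (End Dᵐᵒᵖ V')} (hS : ∀ z, z ∈ S ↔ z ∈ 𝔥)
    (hSc : ∀ z, (∀ s ∈ S, s * z = z * s) → z ∈ S) {n : ℕ} {e : Fin n → End Dᵐᵒᵖ V'}
    (he : PrimitiveIdempotents S n e) (a : V' ≃ₗ[Dᵐᵒᵖ] V') :
    a ∈ splitPartGL 𝔥 ↔ ∃ c : Fin n → Fˣ, a = he.diag c := by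
  have hcomm : ∀ x ∈ S, ∀ y ∈ S, x * y = y * x := fun x hx y hy =>
    h𝔥.commute traceNondeg_top ((hS x).1 hx) ((hS y).1 hy)
  have hred : ∀ x ∈ S, IsNilpotent x → x = 0 := fun x hx hn =>
    h𝔥.eq_zero_of_isNilpotent traceNondeg_top ((hS x).1 hx) hn
  constructor
  · intro ha
    have hirr : ∀ i, IsIrreducibleUnder (𝔥 : Set (End Dᵐᵒᵖ V')) (LinearMap.range (e i)) := by
      intro i
      refine ⟨fun h => he.ne_zero i (LinearMap.range_eq_bot.1 h), ?_, fun U hU hs => ?_⟩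
      · rintro s hs _ ⟨v, rfl⟩
        exact ⟨s v, (LinearMap.congr_fun (hcomm s ((hS s).2 hs) _ (he.mem i)) v).symm⟩
      · obtain ⟨p, hp1, hp2, hp3⟩ := exists_commuting_projection S hcomm hred U
          fun s hs' => hs s ((hS s).1 hs')
        have hpS : p ∈ S := hSc p hp1
        rcases he.mul_eq_zero_or_eq hpS (LinearMap.ext fun v => hp3 _ (hp2 v)) i
          (hcomm p hpS _ (he.mem i)) with h0 | h0
        · left
          rw [Submodule.eq_bot_iff]
          intro u hu
          obtain ⟨v, hv⟩ := hU hu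
          rw [← hp3 u hu, ← hv]
          exact LinearMap.congr_fun h0 v
        · right
          refine le_antisymm hU ?_
          rintro _ ⟨v, rfl⟩
          rw [← h0]
          exact hp2 _
    choose c hc using fun i => ha _ (hirr i)
    exact ⟨c, he.eq_diag fun i v => hc i _ ⟨v, rfl⟩⟩
  · rintro ⟨c, rfl⟩ U hU
    obtain ⟨i, hi⟩ := he.exists_of_irreducible hU
      (fun i s hs => hcomm s ((hS s).2 hs) _ (he.mem i))
      (fun i u hu => hU.2.1 _ ((hS _).1 (he.mem i)) u hu)
    exact ⟨c i, fun u hu => he.diag_apply_of_fixed c (hi u hu)⟩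

variable (V) in
/-- The projections of `W` to `Hom_D(e V', V)` and to `Hom_D(V, e V')`, for an endomorphism `e`. -/
def blockII (e : End Dᵐᵒᵖ V') : Bool → End F (WII D V V')
  | true =>
    { toFun := fun w => (w.1 ∘ₗ e, 0)
      map_add' := fun u v => by ext <;> simp
      map_smul' := fun r u => by ext <;> simp }
  | false =>
    { toFun := fun w => (0, e ∘ₗ w.2)
      map_add' := fun u v => by ext <;> simp
      map_smul' := fun r u => by
        ext v
        · simp
        · exact LinearMap.map_smul_of_tower e r (u.2 v) }

theorem blockII_true (e : End Dᵐᵒᵖ V') (w : WII D V V') :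
    blockII (F := F) V e true w = (w.1 ∘ₗ e, 0) := rfl

theorem blockII_false (e : End Dᵐᵒᵖ V') (w : WII D V V') :
    blockII (F := F) V e false w = (0, e ∘ₗ w.2) := rfl

theorem symplecticII_apply (u v : WII D V V') :
    symplecticII F D V V' u v = trF (u.1 ∘ₗ v.2) - trF (v.1 ∘ₗ u.2) := rfl

theorem sum_smul_comp {ι : Type*} [Fintype ι] (c : ι → F) (f : ι → End Dᵐᵒᵖ V')
    (y : V →ₗ[Dᵐᵒᵖ] V') : (∑ i, c i • f i) ∘ₗ y = ∑ i, c i • (f i ∘ₗ y) := by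
  ext v; simp [LinearMap.sum_apply]

theorem comp_sum_smul {ι : Type*} [Fintype ι] (c : ι → F) (f : ι → End Dᵐᵒᵖ V')
    (x : V' →ₗ[Dᵐᵒᵖ] V) : x ∘ₗ (∑ i, c i • f i) = ∑ i, c i • (x ∘ₗ f i) := by
  ext v
  simp only [LinearMap.comp_apply, LinearMap.sum_apply, LinearMap.smul_apply, map_sum]
  exact Finset.sum_congr rfl fun i _ => LinearMap.map_smul_of_tower x _ _

/-- The weight blocks for pairs of type II. -/
theorem torusBlocks_typeII {𝔥 : LieSubalgebra F (End Dᵐᵒᵖ V')} (h𝔥 : IsCartan ⊤ 𝔥)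
    {S : Subalgebra F (End Dᵐᵒᵖ V')} (hS : ∀ z, z ∈ S ↔ z ∈ 𝔥)
    (hSc : ∀ z, (∀ s ∈ S, s * z = z * s) → z ∈ S) {n : ℕ} {e : Fin n → End Dᵐᵒᵖ V'}
    (he : PrimitiveIdempotents S n e) :
    TorusBlocks (symplecticII F D V V') ((splitPartGL 𝔥).map (groupActII F D V V'))
      (K := Fin n × Bool) (fun k => (k.1, !k.2)) (fun k => blockII V (e k.1) k.2) where
  nondeg := by
    rintro ⟨x, y⟩ h
    have hx : x = 0 := eq_zero_of_trF_comp_eq_zero (F := F) fun g => by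
      have := h (0, g)
      simp only [symplecticII_apply, LinearMap.zero_comp] at this
      rw [trF_comp_comm]
      simpa [trF_eq_trace] using this
    have hy : y = 0 := eq_zero_of_trF_comp_eq_zero (F := F) fun g => by
      have := h (g, 0)
      simp only [symplecticII_apply, LinearMap.comp_zero] at this
      simpa [trF_eq_trace] using this
    rw [hx, hy]; rfl
  skew := fun u v => by
    rw [symplecticII_apply, symplecticII_apply, neg_sub]
  bar_bar := fun k => by simp
  idem := by
    rintro ⟨i, b⟩
    have := he.idem i
    rw [Module.End.mul_eq_comp] at this
    apply LinearMap.ext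
    rintro ⟨x, y⟩
    cases b <;> simp only [Module.End.mul_apply, blockII_true, blockII_false]
    · rw [← LinearMap.comp_assoc, this]
    · rw [LinearMap.comp_assoc, this]
  orth := by
    rintro ⟨i, b⟩ ⟨j, b'⟩ hne
    apply LinearMap.ext
    rintro ⟨x, y⟩
    cases b <;> cases b' <;> simp only [Module.End.mul_apply, blockII_true, blockII_false]
    · have hij : i ≠ j := fun h => hne (by rw [h])
      rw [← LinearMap.comp_assoc, ← Module.End.mul_eq_comp, he.orth i j hij]
      simp
    · simp
    · simp
    · have hij : j ≠ i := fun h => hne (by rw [h])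
      rw [LinearMap.comp_assoc, ← Module.End.mul_eq_comp, he.orth j i hij]
      simp
  sum := by
    apply LinearMap.ext
    rintro ⟨x, y⟩
    rw [LinearMap.sum_apply, Fintype.sum_prod_type]
    simp only [Fintype.sum_bool, blockII_true, blockII_false, Prod.mk_add_mk, add_zero, zero_add]
    have h1 := comp_sum_smul (F := F) 1 e x
    have h2 := sum_smul_comp (F := F) 1 e y
    simp only [Pi.one_apply, one_smul, he.sum] at h1 h2
    ext : 1
    · rw [Prod.fst_sum]; exact h1.symm
    · rw [Prod.snd_sum]; exact h2.symm
  adj := by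
    rintro ⟨i, b⟩ ⟨x, y⟩ ⟨x', y'⟩
    cases b <;> simp [blockII_true, blockII_false, symplecticII_apply, LinearMap.comp_assoc,
      trF_eq_trace]
  mem_iff := by
    intro a
    have hact : ∀ (c : Fin n → Fˣ) (w : WII D V V'), groupActII F D V V' (he.diag c) w =
        ∑ k : Fin n × Bool, ((if k.2 then (c k.1)⁻¹ else c k.1 : Fˣ) : F) •
          blockII (F := F) (V' := V') V (e k.1) k.2 w := by
      rintro c ⟨x, y⟩
      rw [Fintype.sum_prod_type]
      simp only [Fintype.sum_bool, blockII_true, blockII_false, Prod.smul_mk, smul_zero,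
        Prod.mk_add_mk, add_zero, zero_add, if_true, Bool.false_eq_true, if_false]
      ext : 1
      · rw [Prod.fst_sum]
        exact comp_sum_smul (F := F) (fun i => ((c i)⁻¹ : Fˣ).val) e x
      · rw [Prod.snd_sum]
        exact sum_smul_comp (F := F) (fun i => (c i : F)) e y
    rw [Subgroup.mem_map]
    constructor
    · rintro ⟨b, hb, rfl⟩
      obtain ⟨c, rfl⟩ := (mem_splitPartGL_iff h𝔥 hS hSc he b).1 hb
      refine ⟨fun k => if k.2 then (c k.1)⁻¹ else c k.1, ?_, ?_, hact c⟩
      · rintro ⟨i, b⟩; cases b <;> simp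
      · rintro ⟨i, b⟩ h; cases b <;> simp at h
    · rintro ⟨c, hc, -, hac⟩
      refine ⟨he.diag fun i => c (i, false), (mem_splitPartGL_iff h𝔥 hS hSc he _).2 ⟨_, rfl⟩, ?_⟩
      ext1 w
      rw [hact, hac]
      refine Finset.sum_congr rfl ?_
      rintro ⟨i, b⟩ -
      cases b
      · simp
      · have : c (i, true) = (c (i, false))⁻¹ := eq_inv_of_mul_eq_one_left (hc (i, true))
        simp [this]

/-- The condition on conormal directions for pairs of type II. Write `w = (x, y)`. From `x y = 0`
and `x' y = y z` the image of `y` is an `x'`-stable subspace of the kernel of `x`; a projection `π` to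
it that commutes with `x'` belongs to the Cartan subalgebra, and it gives the exponents. -/
theorem conormalCondition_typeII {𝔥 : LieSubalgebra F (End Dᵐᵒᵖ V')} (h𝔥 : IsCartan ⊤ 𝔥)
    {S : Subalgebra F (End Dᵐᵒᵖ V')} (hS : ∀ z, z ∈ S ↔ z ∈ 𝔥)
    (hSc : ∀ z, (∀ s ∈ S, s * z = z * s) → z ∈ S) {n : ℕ} {e : Fin n → End Dᵐᵒᵖ V'}
    (he : PrimitiveIdempotents S n e) (x' : (⊤ : LieSubalgebra F (End Dᵐᵒᵖ V')))
    (hx' : (x' : End Dᵐᵒᵖ V') ∈ 𝔥) (hreg : LieAlgebra.IsRegular F x') :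
    ConormalCondition (symplecticII F D V V') ((splitPartGL 𝔥).map (groupActII F D V V'))
      (K := Fin n × Bool) (fun k => (k.1, !k.2)) (fun k => blockII V (e k.1) k.2)
      (LinearMap.range (leftActII F D V V')) (rightActII F D V V' (x' : End Dᵐᵒᵖ V')) := by
  have hcomm : ∀ x ∈ S, ∀ y ∈ S, x * y = y * x := fun x hx y hy =>
    h𝔥.commute traceNondeg_top ((hS x).1 hx) ((hS y).1 hy)
  have hred : ∀ x ∈ S, IsNilpotent x → x = 0 := fun x hx hn =>
    h𝔥.eq_zero_of_isNilpotent traceNondeg_top ((hS x).1 hx) hn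
  have hcx : ∀ i, (x' : End Dᵐᵒᵖ V') * e i = e i * x' := fun i =>
    hcomm _ ((hS _).2 hx') _ (he.mem i)
  have hT : ∀ (z : End Dᵐᵒᵖ V) (w : WII D V V'),
      (rightActII F D V V' (x' : End Dᵐᵒᵖ V') + leftActII F D V V' z) w =
        (-(w.1 ∘ₗ (x' : End Dᵐᵒᵖ V')) + z ∘ₗ w.1, (x' : End Dᵐᵒᵖ V') ∘ₗ w.2 + -(w.2 ∘ₗ z)) :=
    fun z w => rfl
  have tneg : ∀ f : End Dᵐᵒᵖ V, trF (F := F) (-f) = -trF (F := F) f := fun f => by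
    rw [trF_eq_trace, map_neg, map_neg]; rfl
  refine ⟨?_, ?_, ?_, ?_⟩
  · rintro _ ⟨z, rfl⟩ ⟨x₁, y₁⟩ ⟨x₂, y₂⟩
    have c1 := trF_comp_comm (F := F) (x₁ ∘ₗ y₂) z
    have c2 := trF_comp_comm (F := F) (x₂ ∘ₗ y₁) z
    simp only [LinearMap.comp_assoc] at c1 c2
    rw [hT, hT]
    simp only [symplecticII_apply, LinearMap.add_comp, LinearMap.comp_add, LinearMap.neg_comp,
      LinearMap.comp_neg, trF_add, tneg, LinearMap.comp_assoc, c1, c2]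
    ring
  · rintro _ ⟨z, rfl⟩ _ ⟨a, ha, rfl⟩ ⟨x, y⟩
    obtain ⟨c, rfl⟩ := (mem_splitPartGL_iff h𝔥 hS hSc he a).1 ha
    have h1 := commute_sum_smul hcx (fun i => (c i : F))
    have h2 := commute_sum_smul hcx (fun i => ((c i)⁻¹ : Fˣ).val)
    rw [← he.diag_toLinearMap, Module.End.mul_eq_comp, Module.End.mul_eq_comp] at h1
    rw [← he.diag_symm_toLinearMap, Module.End.mul_eq_comp, Module.End.mul_eq_comp] at h2
    have hg : ∀ w : WII D V V', groupActII F D V V' (he.diag c) w =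
      (w.1 ∘ₗ (he.diag c).symm.toLinearMap, (he.diag c).toLinearMap ∘ₗ w.2) := fun w => rfl
    rw [hT, hg, hT, hg]
    simp only [LinearMap.add_comp, LinearMap.comp_add, LinearMap.neg_comp, LinearMap.comp_neg,
      LinearMap.comp_assoc]
    rw [← h2, ← LinearMap.comp_assoc y (x' : End Dᵐᵒᵖ V'), ← h1, LinearMap.comp_assoc]
  · rintro _ ⟨z, rfl⟩ ⟨i, b⟩
    have h1 := hcx i
    rw [Module.End.mul_eq_comp, Module.End.mul_eq_comp] at h1
    apply LinearMap.ext
    rintro ⟨x, y⟩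
    rw [Module.End.mul_apply, Module.End.mul_apply, hT, hT]
    cases b
    · simp only [blockII_false, LinearMap.comp_add, LinearMap.comp_neg, LinearMap.comp_assoc]
      rw [← LinearMap.comp_assoc _ y, ← LinearMap.comp_assoc y, h1]
      simp [LinearMap.comp_assoc]
    · simp only [blockII_true, LinearMap.add_comp, LinearMap.neg_comp, LinearMap.comp_assoc]
      rw [h1]
      simp
  · rintro _ ⟨z, rfl⟩ ⟨x, y⟩ h0 hY
    rw [hT] at h0
    have h2 : (x' : End Dᵐᵒᵖ V') ∘ₗ y = y ∘ₗ z := by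
      have := (Prod.mk.inj h0).2
      rwa [← sub_eq_add_neg, sub_eq_zero] at this
    have hxy : x ∘ₗ y = 0 := eq_zero_of_trF_comp_eq_zero (F := F) fun s => by
      have h3 := hY (leftActII F D V V' s) ⟨s, rfl⟩
      have h4 : leftActII F D V V' s (x, y) = (s ∘ₗ x, -(y ∘ₗ s)) := rfl
      have c1 := trF_comp_comm (F := F) (x ∘ₗ y) s
      rw [h4, symplecticII_apply] at h3
      simp only [LinearMap.comp_neg, tneg, LinearMap.comp_assoc] at h3 c1
      rw [sub_neg_eq_add, ← c1, ← two_mul] at h3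
      exact (mul_eq_zero.1 h3).resolve_left two_ne_zero
    have hadj : ∀ s ∈ Algebra.adjoin F {(x' : End Dᵐᵒᵖ V')}, s ∈ S := fun s hs =>
      (Algebra.adjoin_le (by
        rintro _ rfl
        exact (hS _).2 hx') : Algebra.adjoin F {(x' : End Dᵐᵒᵖ V')} ≤ S) hs
    -- a projection to the image of `y` that commutes with `x'`, and thus belongs to `𝔥`
    obtain ⟨π, hπ1, hπ2, hπ3⟩ := exists_commuting_projection
      (Algebra.adjoin F {(x' : End Dᵐᵒᵖ V')})
      (fun a ha b hb => hcomm a (hadj a ha) b (hadj b hb)) (fun a ha => hred a (hadj a ha))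
      (LinearMap.range y) (fun s hs => adjoin_stable (by
        rintro _ rfl _ ⟨v, rfl⟩
        exact ⟨z v, (LinearMap.congr_fun h2 v).symm⟩) hs)
    have hπS : π ∈ S := (hS _).2 (h𝔥.mem_of_commute traceNondeg_top hx' hreg trivial
      (hπ1 _ (Algebra.subset_adjoin rfl)))
    have hdich := fun i => he.mul_eq_zero_or_eq hπS (LinearMap.ext fun v => hπ3 _ (hπ2 v)) i
      (hcomm π hπS _ (he.mem i))
    -- `π` acts by `0` or `1` on each irreducible summand; the signs are opposite on dual blocks
    -- because the torus acts on `x` by `a⁻¹` and on `y` by `a`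
    classical
    refine ⟨fun k => if k.2 then (if π * e k.1 = e k.1 then -1 else 1)
      else (if π * e k.1 = e k.1 then 1 else -1), ?_, ?_⟩
    · rintro ⟨i, b⟩
      cases b <;> simp <;> split_ifs <;> rfl
    · rintro ⟨i, b⟩ hne
      cases b
      · have h5 : π * e i = e i := by
          refine (hdich i).resolve_left fun h => hne ?_
          rw [blockII_false]
          ext v
          · rfl
          · change e i (y v) = 0
            rw [← hπ3 (y v) ⟨v, rfl⟩]
            have := LinearMap.congr_fun ((hcomm π hπS _ (he.mem i)).symm.trans h) (y v)
            exact this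
        simp [h5]
      · have h5 : π * e i ≠ e i := by
          intro h
          apply hne
          rw [blockII_true]
          ext v
          · change x (e i v) = 0
            rw [← h]
            obtain ⟨u, hu⟩ := hπ2 (e i v)
            change x (π (e i v)) = 0
            rw [← hu]
            exact LinearMap.congr_fun hxy u
          · rfl
        simp [h5]

end TypeII

/-! ### Adjoints with respect to hermitian forms -/

section Adjoint

variable {D : Type*} [DivisionRing D] [StarRing D]
variable {F : Type*} [Field F] [Algebra F D] [FiniteDimensional F D]
variable {ε ε' ε'' : ℤˣ}
variable {V : Type*} [AddCommGroup V] [Module F V] [Module Dᵐᵒᵖ V] [IsScalarTower F Dᵐᵒᵖ V]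
variable {V' : Type*} [AddCommGroup V'] [Module F V'] [Module Dᵐᵒᵖ V'] [IsScalarTower F Dᵐᵒᵖ V']
variable {V'' : Type*} [AddCommGroup V''] [Module F V''] [Module Dᵐᵒᵖ V'']
  [IsScalarTower F Dᵐᵒᵖ V'']
variable [FiniteDimensional F V] [FiniteDimensional F V'] [FiniteDimensional F V'']

namespace HermForm

theorem form_right_injective (B : HermForm D ε V) {u v : V}
    (h : ∀ w, B.form w u = B.form w v) : u = v :=
  B.form_left_injective fun w => by rw [B.symm w u, B.symm w v, h]

theorem form_zero_left (B : HermForm D ε V) (v : V) : B.form 0 v = 0 := by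
  rw [B.symm v 0, B.form_zero_right, star_zero, mul_zero]

theorem adjoint_eq (hσ : ∀ a : F, star (algebraMap F D a) = algebraMap F D a)
    (B : HermForm D ε V) (B' : HermForm D ε' V') {w : V' →ₗ[Dᵐᵒᵖ] V} {y : V →ₗ[Dᵐᵒᵖ] V'}
    (h : ∀ v' v, B.form (w v') v = B'.form v' (y v)) : adjoint hσ B B' w = y :=
  LinearMap.ext fun v => B'.form_right_injective fun v' => by rw [← form_adjoint, h]

theorem adjoint_comp (hσ : ∀ a : F, star (algebraMap F D a) = algebraMap F D a)
    (B : HermForm D ε V) (B' : HermForm D ε' V') (B'' : HermForm D ε'' V'')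
    (w : V' →ₗ[Dᵐᵒᵖ] V) (u : V'' →ₗ[Dᵐᵒᵖ] V') :
    adjoint hσ B B'' (w ∘ₗ u) = adjoint hσ B' B'' u ∘ₗ adjoint hσ B B' w :=
  adjoint_eq hσ B B'' fun v' v => by
    rw [LinearMap.comp_apply, LinearMap.comp_apply, form_adjoint hσ B B', form_adjoint hσ B' B'']

theorem form_adjoint_left (hσ : ∀ a : F, star (algebraMap F D a) = algebraMap F D a)
    (B : HermForm D ε V) (B' : HermForm D ε' V') (w : V' →ₗ[Dᵐᵒᵖ] V) (v : V) (v' : V') :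
    B'.form (adjoint hσ B B' w v) v' = ((ε' : ℤ) : D) * (((ε : ℤ) : D) * B.form v (w v')) := by
  rw [B'.symm v' _, ← form_adjoint, B.symm v (w v'), star_mul, star_star]
  rcases Int.units_eq_one_or ε with rfl | rfl <;> simp

theorem adjoint_adjoint_of_eq (hσ : ∀ a : F, star (algebraMap F D a) = algebraMap F D a)
    (B : HermForm D ε V) (B' : HermForm D ε V') (w : V' →ₗ[Dᵐᵒᵖ] V) :
    adjoint hσ B' B (adjoint hσ B B' w) = w :=
  adjoint_eq hσ B' B fun v v' => by
    rw [form_adjoint_left]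
    rcases Int.units_eq_one_or ε with rfl | rfl <;> simp

theorem adjoint_adjoint_of_neg (hσ : ∀ a : F, star (algebraMap F D a) = algebraMap F D a)
    (B : HermForm D ε V) (B' : HermForm D (-ε) V') (w : V' →ₗ[Dᵐᵒᵖ] V) :
    adjoint hσ B' B (adjoint hσ B B' w) = -w :=
  adjoint_eq hσ B' B fun v v' => by
    rw [form_adjoint_left, LinearMap.neg_apply, B.form_neg_right]
    rcases Int.units_eq_one_or ε with rfl | rfl <;> simp

/-- The adjoint involution on `End_D(V)`. -/
def adj (hσ : ∀ a : F, star (algebraMap F D a) = algebraMap F D a) (B : HermForm D ε V) :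
    End Dᵐᵒᵖ V →ₗ[F] End Dᵐᵒᵖ V :=
  adjoint hσ B B

variable (hσ : ∀ a : F, star (algebraMap F D a) = algebraMap F D a) (B : HermForm D ε V)

theorem form_adj (f : End Dᵐᵒᵖ V) (u v : V) : B.form (f u) v = B.form u (B.adj hσ f v) :=
  form_adjoint hσ B B f v u

theorem adj_mul (f g : End Dᵐᵒᵖ V) : B.adj hσ (f * g) = B.adj hσ g * B.adj hσ f :=
  adjoint_comp hσ B B B f g

theorem adj_adj (f : End Dᵐᵒᵖ V) : B.adj hσ (B.adj hσ f) = f :=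
  adjoint_adjoint_of_eq hσ B B f

theorem adj_one : B.adj hσ 1 = 1 :=
  adjoint_eq hσ B B fun _ _ => rfl

theorem adj_algebraMap (c : F) : B.adj hσ (algebraMap F _ c) = algebraMap F _ c := by
  rw [Algebra.algebraMap_eq_smul_one, map_smul, adj_one]

theorem mem_lieAlgebra_iff (f : End Dᵐᵒᵖ V) : f ∈ B.lieAlgebra hσ ↔ B.adj hσ f = -f := by
  constructor
  · intro h
    refine adjoint_eq hσ B B fun u v => ?_
    rw [LinearMap.neg_apply, form_neg_right]
    exact eq_neg_of_add_eq_zero_left (h u v)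
  · intro h u v
    rw [B.form_adj hσ, h, LinearMap.neg_apply, form_neg_right, neg_add_cancel]

theorem isNilpotent_adj {f : End Dᵐᵒᵖ V} (hf : IsNilpotent f) : IsNilpotent (B.adj hσ f) := by
  obtain ⟨k, hk⟩ := hf
  refine ⟨k, ?_⟩
  have : ∀ k : ℕ, B.adj hσ f ^ k = B.adj hσ (f ^ k) := by
    intro k
    induction k with
    | zero => rw [pow_zero, pow_zero, adj_one]
    | succ k ih => rw [pow_succ, pow_succ', adj_mul, ih]
  rw [this, hk, map_zero]

theorem form_smul_left (d : D) (u v : V) :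
    B.form (MulOpposite.op d • u) v = star d * B.form u v := by
  rw [B.symm v, B.smul_right, star_mul, B.symm v u]
  rcases Int.units_eq_one_or ε with rfl | rfl <;> simp

include hσ in
/-- Adjoint endomorphisms have the same trace over `F`: they are transposes of each other for an
`F`-valued form obtained from the given one. -/
theorem trF_adj (f : End Dᵐᵒᵖ V) : trF (F := F) (B.adj hσ f) = trF f := by
  obtain ⟨l, hl⟩ : ∃ l : Dual F D, l 1 ≠ 0 := by
    by_contra! h
    exact one_ne_zero ((Module.forall_dual_apply_eq_zero_iff F (1 : D)).1 h)
  let φ : V →ₗ[F] Dual F V := LinearMap.mk₂ F (fun v u => l (B.form u v))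
    (fun a b c => by simp only [B.add_right, map_add])
    (fun c a b => by simp only [B.form_smulF_right, map_smul])
    (fun a b c => by simp only [B.form_add_left, map_add])
    (fun c a b => by simp only [B.form_smulF_left hσ, map_smul])
  have hφ : ∀ v u, φ v u = l (B.form u v) := fun _ _ => rfl
  have hinj : Function.Injective φ := by
    rw [← LinearMap.ker_eq_bot, LinearMap.ker_eq_bot']
    intro v hv
    by_contra hne
    obtain ⟨u, hu⟩ : ∃ u, B.form u v ≠ 0 := by
      by_contra! h
      exact hne (B.nondegenerate v h)
    have := hφ v (MulOpposite.op (star (B.form u v)⁻¹) • u)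
    rw [hv, form_smul_left, star_star, inv_mul_cancel₀ hu] at this
    exact hl this.symm
  let e : V ≃ₗ[F] Dual F V := LinearEquiv.ofBijective φ ⟨hinj,
    (LinearMap.injective_iff_surjective_of_finrank_eq_finrank
      (Subspace.dual_finrank_eq).symm).1 hinj⟩
  have hconj : e.conj (restrictEnd (B.adj hσ f)) = Module.Dual.transpose (restrictEnd (F := F) f) := by
    apply LinearMap.ext
    intro ξ
    obtain ⟨v, rfl⟩ := e.surjective ξ
    rw [LinearEquiv.conj_apply_apply, e.symm_apply_apply]
    ext u
    change l (B.form u (B.adj hσ f v)) = l (B.form (f u) v)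
    rw [B.form_adj hσ]
  rw [trF_eq_trace, trF_eq_trace, ← LinearMap.trace_conj' _ e, hconj, LinearMap.trace_transpose']

variable [CharZero F]

/-- For skew-adjoint `y` one has `tr(y (g - g^*)) = 2 tr(y g)`, so that the trace form of the full
endomorphism algebra restricts to a non-degenerate form on the skew-adjoint elements. -/
theorem traceNondeg_lieAlgebra : TraceNondeg (B.lieAlgebra hσ) := by
  intro y hy h0
  have hy' := (B.mem_lieAlgebra_iff hσ y).1 hy
  refine eq_zero_of_trF_comp_eq_zero (F := F) fun g => ?_
  change trF (F := F) (g * y) = 0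
  rw [trF_mul_comm]
  have tneg : ∀ f : End Dᵐᵒᵖ V, trF (F := F) (-f) = -trF (F := F) f := fun f => by
    rw [trF_eq_trace, map_neg, map_neg]; rfl
  have h1 : trF (F := F) (y * (g + -B.adj hσ g)) = 0 := h0 _ (by
    rw [mem_lieAlgebra_iff, map_add, map_neg, adj_adj]; abel)
  have h2 : trF (F := F) (y * B.adj hσ g) = -trF (F := F) (y * g) := by
    rw [← B.trF_adj hσ, adj_mul, adj_adj, hy', mul_neg, tneg, trF_mul_comm]
  rw [mul_add, mul_neg, trF_add, tneg, h2, neg_neg, ← two_mul] at h1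
  exact (mul_eq_zero.1 h1).resolve_left two_ne_zero

end HermForm

end Adjoint

/-! ### The algebra generated by a Cartan subalgebra of a unitary Lie algebra -/

section CartanTypeI

variable {D : Type*} [DivisionRing D] [StarRing D]
variable {F : Type*} [Field F] [Algebra F D] [FiniteDimensional F D] [CharZero F]
variable {ε : ℤˣ}
variable {V : Type*} [AddCommGroup V] [Module F V] [Module Dᵐᵒᵖ V] [IsScalarTower F Dᵐᵒᵖ V]
variable [FiniteDimensional F V]
variable {hσ : ∀ a : F, star (algebraMap F D a) = algebraMap F D a} {B : HermForm D ε V}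
variable {𝔥 : LieSubalgebra F (End Dᵐᵒᵖ V)}

theorem IsCartan.mem_of_commute_all {L : LieSubalgebra F (End Dᵐᵒᵖ V)} (h : IsCartan L 𝔥)
    {z : End Dᵐᵒᵖ V} (hz : z ∈ L) (hc : ∀ s ∈ 𝔥, s * z = z * s) : z ∈ 𝔥 := by
  obtain ⟨h, -, -, hh⟩ := h
  rw [hh, lie_eq_zero_iff_commute]
  refine ⟨hz, hc _ ?_⟩
  rw [hh, lie_eq_zero_iff_commute]
  exact ⟨h.2, rfl⟩

theorem IsCartan.commute_of_mem_adjoin (h : IsCartan (B.lieAlgebra hσ) 𝔥) {x y : End Dᵐᵒᵖ V}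
    (hx : x ∈ Algebra.adjoin F (𝔥 : Set (End Dᵐᵒᵖ V)))
    (hy : y ∈ Algebra.adjoin F (𝔥 : Set (End Dᵐᵒᵖ V))) : x * y = y * x := by
  have hL := B.traceNondeg_lieAlgebra hσ
  have h1 : ∀ b ∈ 𝔥, Commute x b := fun b hb =>
    (Algebra.commute_of_mem_adjoin_of_forall_mem_commute hx fun c hc => h.commute hL hb hc).symm
  exact Algebra.commute_of_mem_adjoin_of_forall_mem_commute hy h1

theorem IsCartan.adj_mem_adjoin (h : IsCartan (B.lieAlgebra hσ) 𝔥) {x : End Dᵐᵒᵖ V}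
    (hx : x ∈ Algebra.adjoin F (𝔥 : Set (End Dᵐᵒᵖ V))) :
    B.adj hσ x ∈ Algebra.adjoin F (𝔥 : Set (End Dᵐᵒᵖ V)) := by
  refine Algebra.adjoin_induction
    (p := fun x _ => B.adj hσ x ∈ Algebra.adjoin F (𝔥 : Set (End Dᵐᵒᵖ V))) ?_ ?_ ?_ ?_ hx
  · intro x hx
    rw [(B.mem_lieAlgebra_iff hσ x).1 (h.le hx)]
    exact neg_mem (Algebra.subset_adjoin hx)
  · intro r
    rw [B.adj_algebraMap]
    exact Subalgebra.algebraMap_mem _ r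
  · intro x y _ _ hx hy
    rw [map_add]
    exact add_mem hx hy
  · intro x y _ _ hx hy
    rw [B.adj_mul]
    exact mul_mem hy hx

/-- The skew-adjoint part of the algebra generated by a Cartan subalgebra `𝔥` is `𝔥`. -/
theorem IsCartan.mem_of_mem_adjoin (h : IsCartan (B.lieAlgebra hσ) 𝔥) {x : End Dᵐᵒᵖ V}
    (hx : x ∈ Algebra.adjoin F (𝔥 : Set (End Dᵐᵒᵖ V))) (hx' : B.adj hσ x = -x) : x ∈ 𝔥 :=
  h.mem_of_commute_all ((B.mem_lieAlgebra_iff hσ x).2 hx') fun _ hs =>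
    h.commute_of_mem_adjoin (Algebra.subset_adjoin hs) hx

/-- The algebra generated by an element `x` of a Cartan subalgebra is reduced. A skew-adjoint
nilpotent element of it is zero, and hence a nilpotent `r` is self-adjoint and `x r = 0`. If `c` is the
constant term of `r` as a polynomial in `x`, then `r ^ 2 = c r`, so that `c = 0` or `r = 0`. For `c = 0`
one has `2 r = x y` with a skew-adjoint polynomial `y` in `x`, and `y` is nilpotent as well. -/
theorem IsCartan.adjoin_singleton_reduced (h : IsCartan (B.lieAlgebra hσ) 𝔥) {x : End Dᵐᵒᵖ V}
    (hx : x ∈ 𝔥) {r : End Dᵐᵒᵖ V} (hr : r ∈ Algebra.adjoin F {x}) (hnil : IsNilpotent r) :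
    r = 0 := by
  have hL := B.traceNondeg_lieAlgebra hσ
  set R := Algebra.adjoin F (𝔥 : Set (End Dᵐᵒᵖ V)) with hR
  have hle : Algebra.adjoin F {x} ≤ R := Algebra.adjoin_mono (by simpa using hx)
  have hcomm : ∀ a ∈ R, ∀ b ∈ R, a * b = b * a := fun a ha b hb => h.commute_of_mem_adjoin ha hb
  have hxR : x ∈ R := Algebra.subset_adjoin hx
  have hxa : B.adj hσ x = -x := (B.mem_lieAlgebra_iff hσ x).1 (h.le hx)
  have hadj : ∀ a ∈ R, B.adj hσ a ∈ R := fun a ha => h.adj_mem_adjoin ha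
  have hodd : ∀ s ∈ R, IsNilpotent s → B.adj hσ s = -s → s = 0 := fun s hs hn ha =>
    h.eq_zero_of_isNilpotent hL (h.mem_of_mem_adjoin hs ha) hn
  have hdec : ∀ a ∈ Algebra.adjoin F {x}, ∃ (c : F) (b : End Dᵐᵒᵖ V),
      b ∈ Algebra.adjoin F {x} ∧ a = algebraMap F _ c + x * b := by
    intro a ha
    rw [Algebra.adjoin_singleton_eq_range_aeval] at ha
    obtain ⟨P, rfl⟩ := ha
    refine ⟨P.coeff 0, Polynomial.aeval x P.divX, Polynomial.aeval_mem_adjoin_singleton F x, ?_⟩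
    have hP := congrArg (Polynomial.aeval x) (Polynomial.X_mul_divX_add P)
    rw [map_add, map_mul, Polynomial.aeval_X, Polynomial.aeval_C, add_comm] at hP
    exact hP.symm
  have hrR := hle hr
  have hra : B.adj hσ r = r := by
    have := hodd (r - B.adj hσ r) (sub_mem hrR (hadj r hrR))
      (Commute.isNilpotent_sub (hcomm r hrR _ (hadj r hrR)) hnil (B.isNilpotent_adj hσ hnil))
      (by rw [map_sub, B.adj_adj]; abel)
    exact (sub_eq_zero.1 this).symm
  have hxr : x * r = 0 := hodd _ (mul_mem hxR hrR)
    (Commute.isNilpotent_mul_left (hcomm x hxR r hrR) hnil)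
    (by rw [B.adj_mul, hra, hxa, mul_neg, hcomm x hxR r hrR])
  obtain ⟨c, b, hb, hrb⟩ := hdec r hr
  have hrr : r * r = c • r := by
    calc r * r = (algebraMap F _ c + x * b) * r := congrArg (· * r) hrb
      _ = c • r := by
        rw [add_mul, mul_assoc, hcomm b (hle hb) r hrR, ← mul_assoc x, hxr, zero_mul, add_zero,
          Algebra.smul_def]
  by_cases hc : c = 0
  · -- twice the odd part of `b` is denoted by `y`, and `x y = 2 r`
    have hrb' : r = x * b := by rw [hrb, hc, map_zero, zero_add]
    have hxb : x * B.adj hσ b = -r := by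
      have h1 := hra
      conv_lhs at h1 => rw [hrb', B.adj_mul, hxa, mul_neg]
      rw [hcomm x hxR _ (hadj b (hle hb)), ← h1, neg_neg]
    obtain ⟨c', b', hb', hbb'⟩ := hdec b hb
    let y := b - B.adj hσ b
    have hyR : y ∈ R := sub_mem (hle hb) (hadj b (hle hb))
    have hxy : x * y = (2 : F) • r := by
      rw [mul_sub, hxb, ← hrb', sub_neg_eq_add, two_smul]
    have hy : y = x * (b' + B.adj hσ b') := by
      change b - B.adj hσ b = _
      rw [hbb', map_add, B.adj_algebraMap, B.adj_mul, hxa, mul_add,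
        hcomm x hxR (B.adj hσ b') (hadj b' (hle hb')), mul_neg]
      abel
    have hyn : IsNilpotent y := by
      have hs : b' + B.adj hσ b' ∈ R := add_mem (hle hb') (hadj b' (hle hb'))
      have h2 : y * y = ((2 : F) • (b' + B.adj hσ b')) * r := by
        calc y * y = (x * (b' + B.adj hσ b')) * y := congrArg (· * y) hy
          _ = (b' + B.adj hσ b') * (x * y) := by rw [hcomm x hxR _ hs, mul_assoc]
          _ = _ := by rw [hxy, mul_smul_comm, smul_mul_assoc]
      have h3 : IsNilpotent (y * y) := by
        rw [h2]
        exact Commute.isNilpotent_mul_left (hcomm _ (Subalgebra.smul_mem _ hs _) r hrR) hnil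
      obtain ⟨k, hk⟩ := h3
      exact ⟨2 * k, by rw [pow_mul, pow_two, hk]⟩
    have hy0 : y = 0 := hodd y hyR hyn (by
      change B.adj hσ (b - B.adj hσ b) = -(b - B.adj hσ b)
      rw [map_sub, B.adj_adj]; abel)
    rw [hy0, mul_zero] at hxy
    exact (smul_eq_zero.1 hxy.symm).resolve_left two_ne_zero
  · obtain ⟨k, hk⟩ := hnil
    have hpow : ∀ k : ℕ, r ^ (k + 1) = c ^ k • r := by
      intro k
      induction k with
      | zero => simp
      | succ k ih => rw [pow_succ, ih, smul_mul_assoc, hrr, smul_smul, pow_succ]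
    have := hpow k
    rw [pow_succ, hk, zero_mul] at this
    exact (smul_eq_zero.1 this.symm).resolve_left (pow_ne_zero k hc)

/-- The algebra generated by a Cartan subalgebra is reduced: it consists of semisimple elements. -/
theorem IsCartan.adjoin_reduced (h : IsCartan (B.lieAlgebra hσ) 𝔥) {r : End Dᵐᵒᵖ V}
    (hr : r ∈ Algebra.adjoin F (𝔥 : Set (End Dᵐᵒᵖ V))) (hnil : IsNilpotent r) : r = 0 := by
  have hss : (restrictEnd (F := F) r).IsSemisimple := by
    refine Algebra.adjoin_induction
      (p := fun x _ => (restrictEnd (F := F) x).IsSemisimple) ?_ ?_ ?_ ?_ hr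
    · intro x hx
      refine Module.End.isSemisimple_of_squarefree_aeval_eq_zero
        (minpoly_squarefree_of_adjoin_reduced (F := F) (x := x)
          fun n hn hnn => h.adjoin_singleton_reduced hx hn hnn) ?_
      rw [Polynomial.aeval_algHom_apply, minpoly.aeval, map_zero]
    · intro c
      rw [AlgHom.commutes, Algebra.algebraMap_eq_smul_one]
      exact Module.End.IsSemisimple_smul c Module.End.isSemisimple_id
    · intro x y hx hy h1 h2
      rw [map_add]
      refine Module.End.IsSemisimple.add_of_commute ?_ h1 h2
      exact (show Commute x y from h.commute_of_mem_adjoin hx hy).map (restrictEnd (F := F))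
    · intro x y hx hy h1 h2
      rw [map_mul]
      refine Module.End.IsSemisimple.mul_of_commute ?_ h1 h2
      exact (show Commute x y from h.commute_of_mem_adjoin hx hy).map (restrictEnd (F := F))
  apply restrictEnd_injective (F := F)
  rw [map_zero]
  exact Module.End.eq_zero_of_isNilpotent_isSemisimple (hnil.map restrictEnd) hss

end CartanTypeI

/-! ### Isotropic invariant subspaces -/

section IsotropicProjection

variable {D : Type*} [DivisionRing D] [StarRing D]
variable {F : Type*} [Field F] [Algebra F D] [FiniteDimensional F D] [CharZero F]
variable {ε : ℤˣ}
variable {V : Type*} [AddCommGroup V] [Module F V] [Module Dᵐᵒᵖ V] [IsScalarTower F Dᵐᵒᵖ V]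
variable [FiniteDimensional F V]
variable (hσ : ∀ a : F, star (algebraMap F D a) = algebraMap F D a) (B : HermForm D ε V)

/-- For a projection `p` to an isotropic subspace, `q = p - p p^* / 2` is a projection to the same
subspace with `q q^* = q^* q = 0`. The difference `q - q^*` is a skew-adjoint element that acts by `1`
on the subspace and by `-1` on a dual isotropic subspace. -/
theorem HermForm.exists_skew_of_isotropic {p : End Dᵐᵒᵖ V} (hp : p * p = p)
    (hp' : B.adj hσ p * p = 0) : ∃ z : End Dᵐᵒᵖ V, B.adj hσ z = -z ∧ z * z * z = z ∧
      z * p = p ∧ ∀ s, s * p = p * s → s * B.adj hσ p = B.adj hσ p * s → s * z = z * s := by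
  set p' := B.adj hσ p with hp'_def
  have hpp : p' * p' = p' := by rw [hp'_def, ← B.adj_mul, hp]
  have hp'' : B.adj hσ p' = p := B.adj_adj hσ p
  have h2 : (2⁻¹ : F) + 2⁻¹ = 1 := by norm_num
  set q : End Dᵐᵒᵖ V := p - (2⁻¹ : F) • (p * p') with hq
  set q' : End Dᵐᵒᵖ V := p' - (2⁻¹ : F) • (p * p') with hq'
  have e1 : p * p' * p = 0 := by rw [mul_assoc, hp', mul_zero]
  have e2 : p * p' * p' = p * p' := by rw [mul_assoc, hpp]
  have e3 : p * (p * p') = p * p' := by rw [← mul_assoc, hp]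
  have e4 : p' * (p * p') = 0 := by rw [← mul_assoc, hp', zero_mul]
  have e5 : p * p' * (p * p') = 0 := by rw [← mul_assoc, e1, zero_mul]
  have hqa : B.adj hσ q = q' := by
    rw [hq, hq', map_sub, map_smul, B.adj_mul, hp'', ← hp'_def]
  have hqa' : B.adj hσ q' = q := by rw [← hqa, B.adj_adj]
  have hqq : q * q = q := by
    rw [hq, sub_mul, mul_sub, mul_sub, smul_mul_assoc, smul_mul_assoc, mul_smul_comm, mul_smul_comm,
      hp, e1, e3, e5, smul_zero, smul_zero, sub_zero, sub_zero]
  have hq'q : q' * q = 0 := by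
    rw [hq, hq', sub_mul, mul_sub, mul_sub, smul_mul_assoc, smul_mul_assoc, mul_smul_comm,
      mul_smul_comm, hp', e1, e4, e5]
    simp
  have hqq' : q * q' = 0 := by
    rw [hq, hq', sub_mul, mul_sub, mul_sub, smul_mul_assoc, smul_mul_assoc, mul_smul_comm,
      mul_smul_comm, e2, e3, e5, smul_zero, smul_zero, sub_zero, sub_sub, ← add_smul, h2, one_smul,
      sub_self]
  have hq'q' : q' * q' = q' := by rw [← hqa, ← B.adj_mul, hqq]
  have hqp : q * p = p := by rw [hq, sub_mul, smul_mul_assoc, e1, hp, smul_zero, sub_zero]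
  have hq'p : q' * p = 0 := by
    rw [hq', sub_mul, smul_mul_assoc, e1, hp', smul_zero, sub_zero]
  have hqs : ∀ s, s * p = p * s → s * p' = p' * s → s * (q - q') = (q - q') * s := by
    intro s hs hs'
    have e : s * (p * p') = p * p' * s := by rw [← mul_assoc, hs, mul_assoc, hs', mul_assoc]
    rw [hq, hq']
    simp only [mul_sub, sub_mul, mul_smul_comm, smul_mul_assoc, hs, hs', e]
  clear_value q q'
  refine ⟨q - q', by rw [map_sub, hqa, hqa']; abel, ?_, by rw [sub_mul, hqp, hq'p, sub_zero], hqs⟩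
  · have : (q - q') * (q - q') = q + q' := by
      rw [sub_mul, mul_sub, mul_sub, hqq, hqq', hq'q, hq'q']; abel
    rw [this, add_mul, mul_sub, mul_sub, hqq, hqq', hq'q, hq'q']; abel

theorem HermForm.adj_commute {s p : End Dᵐᵒᵖ V} (hs : B.adj hσ s = -s) (h : s * p = p * s) :
    s * B.adj hσ p = B.adj hσ p * s := by
  have := congrArg (B.adj hσ) h
  rw [B.adj_mul, B.adj_mul, hs, mul_neg, neg_mul, neg_inj] at this
  exact this.symm

theorem HermForm.adj_mul_self_eq_zero {U : Submodule Dᵐᵒᵖ V}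
    (hU : ∀ u ∈ U, ∀ v ∈ U, B.form u v = 0) {p : End Dᵐᵒᵖ V} (hp : ∀ v, p v ∈ U) :
    B.adj hσ p * p = 0 :=
  LinearMap.ext fun v => B.nondegenerate _ fun u => by
    rw [Module.End.mul_apply, ← B.form_adj hσ]
    exact hU _ (hp u) _ (hp v)

end IsotropicProjection

/-! ### Irreducible summands and the split torus of a unitary group -/

section TypeITorus

variable {D : Type*} [DivisionRing D] [StarRing D]
variable {F : Type*} [Field F] [Algebra F D] [FiniteDimensional F D] [CharZero F]
variable {ε : ℤˣ}
variable {V : Type*} [AddCommGroup V] [Module F V] [Module Dᵐᵒᵖ V] [IsScalarTower F Dᵐᵒᵖ V]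
variable [FiniteDimensional F V]
variable {hσ : ∀ a : F, star (algebraMap F D a) = algebraMap F D a} {B : HermForm D ε V}
variable {𝔥 : LieSubalgebra F (End Dᵐᵒᵖ V)}
variable {n : ℕ} {e : Fin n → End Dᵐᵒᵖ V}

/-- The adjoint involution permutes the primitive idempotents. -/
theorem IsCartan.exists_adj_perm (h : IsCartan (B.lieAlgebra hσ) 𝔥)
    (he : PrimitiveIdempotents (Algebra.adjoin F (𝔥 : Set (End Dᵐᵒᵖ V))) n e) :
    ∃ σ : Fin n → Fin n, (∀ i, σ (σ i) = i) ∧ ∀ i, B.adj hσ (e i) = e (σ i) := by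
  have hinj : ∀ i j, e i = e j → i = j := by
    intro i j hij
    by_contra hne
    have h1 := he.orth i j hne
    rw [← hij, he.idem] at h1
    exact he.ne_zero i h1
  have hmem := fun i => h.adj_mem_adjoin (he.mem i)
  have hidem : ∀ i, B.adj hσ (e i) * B.adj hσ (e i) = B.adj hσ (e i) := fun i => by
    rw [← B.adj_mul, he.idem]
  have hne : ∀ i, B.adj hσ (e i) ≠ 0 := fun i h0 => he.ne_zero i (by
    rw [← B.adj_adj hσ (e i), h0, map_zero])
  have key : ∀ i, ∃ k, B.adj hσ (e i) = e k := by
    intro i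
    obtain ⟨k, hk⟩ : ∃ k, B.adj hσ (e i) * e k ≠ 0 := by
      by_contra! h0
      apply hne i
      rw [← mul_one (B.adj hσ (e i)), ← he.sum, Finset.mul_sum]
      exact Finset.sum_eq_zero fun k _ => h0 k
    have h1 : B.adj hσ (e i) * e k = e k := (he.mul_eq_zero_or_eq (hmem i) (hidem i) k
      (h.commute_of_mem_adjoin (hmem i) (he.mem k))).resolve_left hk
    have h2 : B.adj hσ (e k) * e i = B.adj hσ (e k) := by
      have := congrArg (B.adj hσ) h1
      rwa [B.adj_mul, B.adj_adj] at this
    have h3 : B.adj hσ (e k) * e i = e i := (he.mul_eq_zero_or_eq (hmem k) (hidem k) i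
      (h.commute_of_mem_adjoin (hmem k) (he.mem i))).resolve_left (by rw [h2]; exact hne k)
    exact ⟨k, by rw [← h3, h2, B.adj_adj]⟩
  choose σ hσ' using key
  exact ⟨σ, fun i => hinj _ _ (by rw [← hσ', ← hσ', B.adj_adj]), hσ'⟩

/-- An element `z` of a product of fields with `z ^ 3 = z` has components `0`, `1` and `-1`. -/
theorem PrimitiveIdempotents.exists_sign {S : Subalgebra F (End Dᵐᵒᵖ V)}
    (he : PrimitiveIdempotents S n e) {z : End Dᵐᵒᵖ V} (hz : z ∈ S) (hzzz : z * z * z = z)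
    (i : Fin n) (hc : z * e i = e i * z) :
    z * e i = 0 ∨ z * e i = e i ∨ z * e i = -e i := by
  have key : ∀ s : F, s * s = 1 →
      ((2⁻¹ : F) • (z * z + s • z)) * e i = 0 ∨ ((2⁻¹ : F) • (z * z + s • z)) * e i = e i := by
    intro s hs
    refine he.mul_eq_zero_or_eq ?_ ?_ i ?_
    · exact S.smul_mem (add_mem (mul_mem hz hz) (S.smul_mem hz s)) _
    · have h4 : z * z * (z * z) = z * z := by rw [← mul_assoc, hzzz]
      have h3 : z * (z * z) = z := by rw [← mul_assoc, hzzz]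
      simp only [smul_mul_assoc, mul_smul_comm, add_mul, mul_add, h4, hzzz, h3, smul_smul,
        smul_add]
      match_scalars
      · linear_combination (1 / 4) * hs
      · ring
    · have h5 : z * z * e i = e i * (z * z) := by rw [mul_assoc, hc, ← mul_assoc, hc, mul_assoc]
      simp only [smul_mul_assoc, mul_smul_comm, add_mul, mul_add, hc, h5]
  have hsum : z * e i = ((2⁻¹ : F) • (z * z + (1 : F) • z)) * e i -
      ((2⁻¹ : F) • (z * z + (-1 : F) • z)) * e i := by
    rw [← sub_mul, ← smul_sub, add_sub_add_left_eq_sub, neg_smul, one_smul, sub_neg_eq_add,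
      ← two_smul F z, smul_smul, inv_mul_cancel₀ two_ne_zero, one_smul]
  rcases key 1 (by norm_num) with h1 | h1 <;> rcases key (-1) (by norm_num) with h2 | h2 <;>
    rw [h1, h2] at hsum
  · left; simpa using hsum
  · right; right; simpa using hsum
  · right; left; simpa using hsum
  · left; simpa using hsum

/-- If the primitive idempotent `e i` is not self-adjoint, then its image is irreducible: a
projection `p` to an invariant subspace gives the skew-adjoint `p - p^*`, which lies in the Cartan
subalgebra. -/
theorem IsCartan.isIrreducibleUnder_range (h : IsCartan (B.lieAlgebra hσ) 𝔥)
    (he : PrimitiveIdempotents (Algebra.adjoin F (𝔥 : Set (End Dᵐᵒᵖ V))) n e)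
    {σ : Fin n → Fin n} (hσe : ∀ i, B.adj hσ (e i) = e (σ i)) {i : Fin n} (hi : σ i ≠ i) :
    IsIrreducibleUnder (𝔥 : Set (End Dᵐᵒᵖ V)) (LinearMap.range (e i)) := by
  set R := Algebra.adjoin F (𝔥 : Set (End Dᵐᵒᵖ V))
  have hcomm : ∀ a ∈ R, ∀ b ∈ R, a * b = b * a := fun a ha b hb => h.commute_of_mem_adjoin ha hb
  have hsub : ∀ s ∈ 𝔥, s ∈ R := fun s hs => Algebra.subset_adjoin hs
  refine ⟨fun h0 => he.ne_zero i (LinearMap.range_eq_bot.1 h0), ?_, fun U hU hs => ?_⟩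
  · rintro s hs _ ⟨v, rfl⟩
    exact ⟨s v, (LinearMap.congr_fun (hcomm s (hsub s hs) _ (he.mem i)) v).symm⟩
  obtain ⟨p, hp1, hp2, hp3⟩ := exists_commuting_projection R hcomm
    (fun x hx hn => h.adjoin_reduced hx hn) U fun s hs' => adjoin_stable hs hs'
  have heU : ∀ u ∈ U, e i u = u := by
    intro u hu
    obtain ⟨v, rfl⟩ := hU hu
    exact LinearMap.congr_fun (he.idem i) v
  have hep : e i * p = p := LinearMap.ext fun v => heU _ (hp2 v)
  have hpp : p * p = p := LinearMap.ext fun v => hp3 _ (hp2 v)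
  -- the part of `p` on the image of `e i`; as `e (σ i)` is orthogonal to `e i`, it can be recovered
  -- from `p' - p'^*`, and so it belongs to the algebra generated by `𝔥`
  set p' := p * e i with hp'
  have hzR : p' - B.adj hσ p' ∈ 𝔥 := by
    refine h.mem_of_commute_all ((B.mem_lieAlgebra_iff hσ _).2 ?_) fun s hs => ?_
    · rw [map_sub, B.adj_adj]; abel
    · have h1 : s * p' = p' * s := by
        rw [hp', ← mul_assoc, hp1 s (hsub s hs), mul_assoc, hcomm s (hsub s hs) _ (he.mem i),
          mul_assoc]
      rw [mul_sub, sub_mul, h1, B.adj_commute hσ ((B.mem_lieAlgebra_iff hσ s).1 (h.le hs)) h1]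
  have hep' : e i * (p' - B.adj hσ p') = p' := by
    rw [mul_sub, hp', B.adj_mul, ← mul_assoc, ← mul_assoc, hep, hσe, he.orth i (σ i) hi.symm,
      zero_mul, sub_zero]
  have hp'R : p' ∈ R := by rw [← hep']; exact mul_mem (he.mem i) (hsub _ hzR)
  have hp'p' : p' * p' = p' := by
    rw [hp', mul_assoc, ← mul_assoc (e i), hep, ← mul_assoc, hpp]
  have hp'e : p' * e i = p' := by rw [hp', mul_assoc, he.idem]
  rcases he.mul_eq_zero_or_eq hp'R hp'p' i (hcomm _ hp'R _ (he.mem i)) with h0 | h0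
  · left
    rw [Submodule.eq_bot_iff]
    intro u hu
    rw [hp'e] at h0
    have := LinearMap.congr_fun h0 u
    rwa [hp', Module.End.mul_apply, heU u hu, hp3 u hu] at this
  · right
    refine le_antisymm hU ?_
    rintro _ ⟨v, rfl⟩
    rw [← h0, hp'e]
    exact hp2 _

/-- If the primitive idempotent `e i` is self-adjoint, then the form is non-degenerate on the
irreducible subspaces of its image. An isotropic one would give an element of the Cartan subalgebra
with the eigenvalues `1` and `-1` on the image of `e i`. -/
theorem IsCartan.nondegenerate_of_le_range (h : IsCartan (B.lieAlgebra hσ) 𝔥)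
    (he : PrimitiveIdempotents (Algebra.adjoin F (𝔥 : Set (End Dᵐᵒᵖ V))) n e)
    {i : Fin n} (hi : B.adj hσ (e i) = e i) {U : Submodule Dᵐᵒᵖ V}
    (hU : IsIrreducibleUnder (𝔥 : Set (End Dᵐᵒᵖ V)) U) (hUi : U ≤ LinearMap.range (e i)) :
    ∀ v ∈ U, (∀ u ∈ U, B.form u v = 0) → v = 0 := by
  set R := Algebra.adjoin F (𝔥 : Set (End Dᵐᵒᵖ V))
  have hcomm : ∀ a ∈ R, ∀ b ∈ R, a * b = b * a := fun a ha b hb => h.commute_of_mem_adjoin ha hb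
  have hsub : ∀ s ∈ 𝔥, s ∈ R := fun s hs => Algebra.subset_adjoin hs
  -- the radical of the form on `U`, which is `0` or `U`
  let N : Submodule Dᵐᵒᵖ V :=
    { carrier := {v | v ∈ U ∧ ∀ u ∈ U, B.form u v = 0}
      add_mem' := fun {a b} ha hb => ⟨U.add_mem ha.1 hb.1, fun u hu => by
        rw [B.add_right, ha.2 u hu, hb.2 u hu, add_zero]⟩
      zero_mem' := ⟨U.zero_mem, fun u _ => B.form_zero_right u⟩
      smul_mem' := fun d a ha => ⟨U.smul_mem d ha.1, fun u hu => by
        have := B.smul_right u a d.unop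
        rw [MulOpposite.op_unop] at this
        rw [this, ha.2 u hu, zero_mul]⟩ }
  have hNU : N ≤ U := fun v hv => hv.1
  rcases hU.2.2 N hNU (by
    rintro s hs v ⟨hv, hv0⟩
    refine ⟨hU.2.1 s hs v hv, fun u hu => ?_⟩
    have h1 := h.le hs u v
    rw [hv0 _ (hU.2.1 s hs u hu), zero_add] at h1
    exact h1) with h0 | h0
  · intro v hv hv0
    have : v ∈ N := ⟨hv, hv0⟩
    rwa [h0, Submodule.mem_bot] at this
  exfalso
  have hiso : ∀ u ∈ U, ∀ v ∈ U, B.form u v = 0 := fun u hu v hv => by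
    have : v ∈ N := by rw [h0]; exact hv
    exact this.2 u hu
  obtain ⟨p, hp1, hp2, hp3⟩ := exists_commuting_projection R hcomm
    (fun x hx hn => h.adjoin_reduced hx hn) U fun s hs' => adjoin_stable hU.2.1 hs'
  have hpp : p * p = p := LinearMap.ext fun v => hp3 _ (hp2 v)
  obtain ⟨z, hz1, hz2, hz3, hz4⟩ :=
    B.exists_skew_of_isotropic hσ hpp (B.adj_mul_self_eq_zero hσ hiso hp2)
  have hz𝔥 : z ∈ 𝔥 := h.mem_of_commute_all ((B.mem_lieAlgebra_iff hσ _).2 hz1) fun s hs =>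
    hz4 s (hp1 s (hsub s hs))
      (B.adj_commute hσ ((B.mem_lieAlgebra_iff hσ s).1 (h.le hs)) (hp1 s (hsub s hs)))
  obtain ⟨u, hu, hu0⟩ := U.ne_bot_iff.1 hU.1
  have hc := hcomm z (hsub z hz𝔥) _ (he.mem i)
  have h1u : e i u = u := by
    obtain ⟨v, hv⟩ := hUi hu
    rw [← hv]
    exact LinearMap.congr_fun (he.idem i) v
  have hzu : (z * e i) u = u := by
    rw [Module.End.mul_apply, h1u]
    conv_lhs => rw [← hp3 u hu]
    rw [← Module.End.mul_apply, hz3, hp3 u hu]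
  -- `z` acts by `1` on the image of `e i`, contrary to `z^* = -z` and `(e i)^* = e i`
  have hze : z * e i = e i := by
    rcases he.exists_sign (hsub z hz𝔥) hz2 i hc with h1 | h1 | h1
    · rw [h1] at hzu
      exact absurd hzu.symm hu0
    · exact h1
    · exfalso
      rw [h1, LinearMap.neg_apply, h1u] at hzu
      refine hu0 ((smul_eq_zero.1 (?_ : (2 : F) • u = 0)).resolve_left two_ne_zero)
      rw [two_smul]
      nth_rewrite 1 [← hzu]
      exact neg_add_cancel u
  have h6 := congrArg (B.adj hσ) hze
  rw [B.adj_mul, hz1, hi, mul_neg, ← hc, hze] at h6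
  have h7 : e i = 0 := by
    have : (2 : F) • e i = 0 := by rw [two_smul]; nth_rewrite 1 [← h6]; exact neg_add_cancel _
    exact (smul_eq_zero.1 this).resolve_left two_ne_zero
  exact he.ne_zero i h7

/-- The split part of a Cartan subgroup of an isometry group consists of the automorphisms acting by
scalars on the images of the primitive idempotents, the scalars being inverse to each other for
adjoint idempotents and trivial for self-adjoint ones. -/
theorem mem_splitPart_iff (h : IsCartan (B.lieAlgebra hσ) 𝔥)
    (he : PrimitiveIdempotents (Algebra.adjoin F (𝔥 : Set (End Dᵐᵒᵖ V))) n e)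
    {σ : Fin n → Fin n} (hσσ : ∀ i, σ (σ i) = i) (hσe : ∀ i, B.adj hσ (e i) = e (σ i))
    (a : V ≃ₗ[Dᵐᵒᵖ] V) :
    a ∈ B.splitPart 𝔥 ↔ ∃ c : Fin n → Fˣ, (∀ i, c i * c (σ i) = 1) ∧ (∀ i, σ i = i → c i = 1) ∧
      a = he.diag c := by
  set R := Algebra.adjoin F (𝔥 : Set (End Dᵐᵒᵖ V)) with hR
  have hcomm : ∀ a ∈ R, ∀ b ∈ R, a * b = b * a := fun a ha b hb => h.commute_of_mem_adjoin ha hb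
  have hsub : ∀ s ∈ 𝔥, s ∈ R := fun s hs => Algebra.subset_adjoin hs
  have hadj : ∀ c : Fin n → Fˣ, B.adj hσ (∑ i, (c i : F) • e i) * (∑ i, (c i : F) • e i) =
      ∑ i, ((c i : F) * (c (σ i) : F)) • e i := by
    intro c
    have : B.adj hσ (∑ i, (c i : F) • e i) = ∑ i, (c (σ i) : F) • e i := by
      rw [map_sum]
      let E : Equiv.Perm (Fin n) := ⟨σ, σ, hσσ, hσσ⟩
      refine (Finset.sum_congr rfl fun i _ => ?_).trans
        (Equiv.sum_comp E fun i => (c (σ i) : F) • e i)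
      change _ = (c (σ (σ i)) : F) • e (σ i)
      rw [map_smul, hσe, hσσ]
    rw [this, he.sum_smul_mul]
    exact Finset.sum_congr rfl fun i _ => by rw [mul_comm]
  have hiso : ∀ c : Fin n → Fˣ, (∀ u v, B.form (he.diag c u) (he.diag c v) = B.form u v) ↔
      ∀ i, c i * c (σ i) = 1 := by
    intro c
    have h1 : ∀ u v, B.form (he.diag c u) (he.diag c v) =
        B.form u ((∑ i, ((c i : F) * (c (σ i) : F)) • e i) v) := fun u v => by
      rw [← hadj, Module.End.mul_apply, ← B.form_adj hσ]; rfl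
    simp only [h1]
    constructor
    · intro h2 i
      have h3 : (∑ i, ((c i : F) * (c (σ i) : F)) • e i) = 1 :=
        LinearMap.ext fun v => B.form_right_injective fun u => h2 u v
      have h4 := congrArg (· * e i) h3
      simp only [Finset.sum_mul, smul_mul_assoc, one_mul] at h4
      rw [Finset.sum_eq_single i (fun j _ hj => by rw [he.orth j i hj, smul_zero])
        (by simp), he.idem] at h4
      have h5 : ((c i : F) * (c (σ i) : F) - 1) • e i = 0 := by
        rw [sub_smul, one_smul, h4, sub_self]
      have h6 := (smul_eq_zero.1 h5).resolve_right (he.ne_zero i)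
      exact Units.ext (by rw [Units.val_mul]; exact sub_eq_zero.1 h6)
    · intro h2 u v
      have h3 : (∑ i, ((c i : F) * (c (σ i) : F)) • e i) = 1 := by
        rw [← he.sum]
        refine Finset.sum_congr rfl fun i _ => ?_
        rw [← Units.val_mul, h2, Units.val_one, one_smul]
      rw [h3]; rfl
  have hrange : ∀ i v, e i v ∈ LinearMap.range (e i) := fun i v => ⟨v, rfl⟩
  constructor
  · rintro ⟨ha1, ha2, ha3⟩
    have key : ∀ i, ∃ c : Fˣ, (σ i = i → c = 1) ∧ ∀ v, a (e i v) = (c : F) • e i v := by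
      intro i
      by_cases hi : σ i = i
      · refine ⟨1, fun _ => rfl, ?_⟩
        have hi' : B.adj hσ (e i) = e i := by rw [hσe, hi]
        -- the sum of the irreducible subspaces of the image of `e i`; it has an invariant complement
        -- in this image, which must be zero
        let N : Submodule Dᵐᵒᵖ V := sSup {U | IsIrreducibleUnder (𝔥 : Set (End Dᵐᵒᵖ V)) U ∧
          U ≤ LinearMap.range (e i)}
        have hN1 : N ≤ LinearMap.range (e i) := sSup_le fun U hU => hU.2
        have hN2 : N ≤ LinearMap.eqLocus a.toLinearMap LinearMap.id := sSup_le fun U hU u hu =>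
          ha3 U hU.1 (h.nondegenerate_of_le_range he hi' hU.1 hU.2) u hu
        have hN3 : ∀ s ∈ (𝔥 : Set (End Dᵐᵒᵖ V)), ∀ u ∈ N, s u ∈ N := by
          intro s hs
          have : N ≤ N.comap s := sSup_le fun U hU u hu =>
            (le_sSup (a := U) (s := {U | IsIrreducibleUnder (𝔥 : Set (End Dᵐᵒᵖ V)) U ∧
              U ≤ LinearMap.range (e i)}) hU : U ≤ N) (hU.1.2.1 s hs u hu)
          exact this
        obtain ⟨p, hp1, hp2, hp3⟩ := exists_commuting_projection R hcomm
          (fun x hx hn => h.adjoin_reduced hx hn) N fun s hs' => adjoin_stable hN3 hs'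
        have hT : LinearMap.range ((1 - p) * e i) = ⊥ := by
          by_contra hne
          have : Module.Finite Dᵐᵒᵖ V := Module.Finite.of_restrictScalars_finite F Dᵐᵒᵖ V
          obtain ⟨U, hU1, hU2⟩ := exists_irreducible_le (𝔥 : Set (End Dᵐᵒᵖ V)) _ hne (by
            rintro s hs _ ⟨v, rfl⟩
            refine ⟨s v, ?_⟩
            rw [← Module.End.mul_apply, ← Module.End.mul_apply]
            congr 1
            rw [mul_assoc, ← hcomm s (hsub s hs) _ (he.mem i), ← mul_assoc, ← mul_assoc, sub_mul,
              mul_sub, one_mul, mul_one, hp1 s (hsub s hs)])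
          have hUi : U ≤ LinearMap.range (e i) := by
            refine hU1.trans ?_
            rintro _ ⟨v, rfl⟩
            rw [sub_mul, one_mul, LinearMap.sub_apply]
            exact Submodule.sub_mem _ (hrange i v) (hN1 (hp2 _))
          have hUN : U ≤ N := le_sSup ⟨hU2, hUi⟩
          apply hU2.1
          rw [Submodule.eq_bot_iff]
          intro u hu
          rw [← hp3 u (hUN hu)]
          obtain ⟨v, rfl⟩ := hU1 hu
          rw [sub_mul, one_mul, LinearMap.sub_apply, map_sub, Module.End.mul_apply, hp3 _ (hp2 _),
            sub_self]
        intro v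
        have h1 : e i v = p (e i v) := by
          have := LinearMap.congr_fun (LinearMap.range_eq_bot.1 hT) v
          rw [sub_mul, one_mul, LinearMap.sub_apply] at this
          exact sub_eq_zero.1 this
        rw [Units.val_one, one_smul, h1]
        exact hN2 (hp2 _)
      · obtain ⟨c, hc⟩ := ha2 _ (h.isIrreducibleUnder_range he hσe hi)
        exact ⟨c, fun h => absurd h hi, fun v => hc _ (hrange i v)⟩
    choose c hc1 hc2 using key
    have hac := he.eq_diag hc2
    refine ⟨c, (hiso c).1 ?_, hc1, hac⟩
    rw [← hac]
    exact ha1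
  · rintro ⟨c, hc1, hc2, rfl⟩
    have key : ∀ U : Submodule Dᵐᵒᵖ V, IsIrreducibleUnder (𝔥 : Set (End Dᵐᵒᵖ V)) U →
        ∃ i, ∀ u ∈ U, e i u = u := fun U hU => he.exists_of_irreducible hU
      (fun i s hs => hcomm s (hsub s hs) _ (he.mem i))
      (fun i => adjoin_stable hU.2.1 (he.mem i))
    refine ⟨(hiso c).2 hc1, fun U hU => ?_, fun U hU hnd u hu => ?_⟩
    · obtain ⟨i, hi⟩ := key U hU
      exact ⟨c i, fun u hu => he.diag_apply_of_fixed c (hi u hu)⟩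
    · obtain ⟨i, hi⟩ := key U hU
      rw [he.diag_apply_of_fixed c (hi u hu), hc2 i, Units.val_one, one_smul]
      by_contra hne
      apply hU.1
      rw [Submodule.eq_bot_iff]
      refine fun v hv => hnd v hv fun u hu => ?_
      rw [← hi u hu, B.form_adj hσ, hσe, ← hi v hv, ← Module.End.mul_apply, he.orth _ _ hne,
        LinearMap.zero_apply, B.form_zero_right]

end TypeITorus

/-! ### Pairs of type I -/

section TypeI

variable {D : Type*} [DivisionRing D] [StarRing D]
variable {F : Type*} [Field F] [Algebra F D] [FiniteDimensional F D] [CharZero F]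
variable {ε : ℤˣ}
variable {V : Type*} [AddCommGroup V] [Module F V] [Module Dᵐᵒᵖ V] [IsScalarTower F Dᵐᵒᵖ V]
variable {V' : Type*} [AddCommGroup V'] [Module F V'] [Module Dᵐᵒᵖ V'] [IsScalarTower F Dᵐᵒᵖ V']
variable [FiniteDimensional F V] [FiniteDimensional F V']
variable {hσ : ∀ a : F, star (algebraMap F D a) = algebraMap F D a}
variable {B : HermForm D ε V} {B' : HermForm D (-ε) V'}
variable {𝔥 : LieSubalgebra F (End Dᵐᵒᵖ V')}
variable {n : ℕ} {e : Fin n → End Dᵐᵒᵖ V'}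

variable (V) in
/-- The projection of `W` to `Hom_D(e V', V)`, for an endomorphism `e`. -/
def blockI (e : End Dᵐᵒᵖ V') : End F (V' →ₗ[Dᵐᵒᵖ] V) where
  toFun := fun w => w ∘ₗ e
  map_add' := fun u v => by ext; simp
  map_smul' := fun r u => by ext; simp

theorem blockI_apply (e : End Dᵐᵒᵖ V') (w : V' →ₗ[Dᵐᵒᵖ] V) :
    blockI (F := F) V e w = w ∘ₗ e := rfl

theorem symplecticI_apply (u v : V' →ₗ[Dᵐᵒᵖ] V) :
    symplecticI hσ B B' u v = trF (u ∘ₗ HermForm.adjoint hσ B B' v) := rfl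

theorem trF_neg (f : End Dᵐᵒᵖ V) : trF (F := F) (-f) = -trF (F := F) f := by
  rw [← neg_one_smul F f, trF_smul, neg_one_mul]

theorem HermForm.adjoint_mul_right (w : V' →ₗ[Dᵐᵒᵖ] V) (x : End Dᵐᵒᵖ V') :
    HermForm.adjoint hσ B B' (w ∘ₗ x) = B'.adj hσ x ∘ₗ HermForm.adjoint hσ B B' w :=
  HermForm.adjoint_comp hσ B B' B' w x

theorem HermForm.adjoint_mul_left (w : V' →ₗ[Dᵐᵒᵖ] V) (x : End Dᵐᵒᵖ V) :
    HermForm.adjoint hσ B B' (x ∘ₗ w) = HermForm.adjoint hσ B B' w ∘ₗ B.adj hσ x :=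
  HermForm.adjoint_comp hσ B B B' x w

theorem HermForm.adj_comp_adjoint (u v : V' →ₗ[Dᵐᵒᵖ] V) :
    B.adj hσ (u ∘ₗ HermForm.adjoint hσ B B' v) = -(v ∘ₗ HermForm.adjoint hσ B B' u) := by
  have := HermForm.adjoint_comp hσ B B' B u (HermForm.adjoint hσ B B' v)
  rw [HermForm.adjoint_adjoint_of_neg] at this
  rw [HermForm.adj, this, LinearMap.neg_comp]

/-- The weight blocks for pairs of type I. -/
theorem torusBlocks_typeI (h : IsCartan (B'.lieAlgebra hσ) 𝔥)
    (he : PrimitiveIdempotents (Algebra.adjoin F (𝔥 : Set (End Dᵐᵒᵖ V'))) n e)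
    {σ : Fin n → Fin n} (hσσ : ∀ i, σ (σ i) = i) (hσe : ∀ i, B'.adj hσ (e i) = e (σ i)) :
    TorusBlocks (symplecticI hσ B B') ((B'.splitPart 𝔥).map (groupActI F D V V'))
      σ (fun k => blockI V (e k)) where
  nondeg := by
    intro w hw
    have h0 : HermForm.adjoint hσ B B' w = 0 := eq_zero_of_trF_comp_eq_zero (F := F) fun g => hw g
    rw [← neg_eq_zero, ← HermForm.adjoint_adjoint_of_neg hσ B B', h0, map_zero]
  skew := fun u v => by
    rw [symplecticI_apply, symplecticI_apply, ← B.trF_adj hσ, HermForm.adj_comp_adjoint, trF_neg]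
  bar_bar := hσσ
  idem := fun k => LinearMap.ext fun w => by
    rw [Module.End.mul_apply, blockI_apply, blockI_apply, LinearMap.comp_assoc,
      ← Module.End.mul_eq_comp, he.idem]
  orth := fun k l hkl => LinearMap.ext fun w => by
    rw [Module.End.mul_apply, blockI_apply, blockI_apply, LinearMap.comp_assoc,
      ← Module.End.mul_eq_comp, he.orth l k (Ne.symm hkl), LinearMap.comp_zero]
    rfl
  sum := LinearMap.ext fun w => by
    have h1 := comp_sum_smul (F := F) 1 e w
    simp only [Pi.one_apply, one_smul, he.sum] at h1
    rw [LinearMap.sum_apply]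
    exact h1.symm
  adj := fun k u v => by
    rw [symplecticI_apply, symplecticI_apply, blockI_apply, blockI_apply,
      HermForm.adjoint_mul_right, hσe, hσσ, LinearMap.comp_assoc]
  mem_iff := by
    intro a
    have hact : ∀ (c : Fin n → Fˣ) (w : V' →ₗ[Dᵐᵒᵖ] V), groupActI F D V V' (he.diag c) w =
        ∑ k, (((c k)⁻¹ : Fˣ) : F) • blockI (F := F) V (e k) w := fun c w =>
      comp_sum_smul (F := F) (fun i => ((c i)⁻¹ : Fˣ).val) e w
    rw [Subgroup.mem_map]
    constructor
    · rintro ⟨b, hb, rfl⟩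
      obtain ⟨c, hc1, hc2, rfl⟩ := (mem_splitPart_iff h he hσσ hσe b).1 hb
      refine ⟨fun k => (c k)⁻¹, fun k => ?_, fun k hk => ?_, hact c⟩
      · rw [← mul_inv, hc1, inv_one]
      · change (c k)⁻¹ = 1
        rw [hc2 k hk, inv_one]
    · rintro ⟨c, hc1, hc2, hac⟩
      refine ⟨he.diag fun i => (c i)⁻¹, (mem_splitPart_iff h he hσσ hσe _).2
        ⟨_, fun k => ?_, fun k hk => ?_, rfl⟩, ?_⟩
      · rw [← mul_inv, hc1, inv_one]
      · rw [hc2 k hk, inv_one]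
      · ext1 w
        rw [hact, hac]
        exact Finset.sum_congr rfl fun i _ => by rw [inv_inv]

/-- The condition on conormal directions for pairs of type I. From `w w^* = 0` and `x' w^* = w^* z`
the image of `w^*` is an `x'`-stable isotropic subspace; the skew-adjoint element attached to a
projection to it that commutes with `x'` belongs to the Cartan subalgebra, and it gives the
exponents. -/
theorem conormalCondition_typeI (h : IsCartan (B'.lieAlgebra hσ) 𝔥)
    (he : PrimitiveIdempotents (Algebra.adjoin F (𝔥 : Set (End Dᵐᵒᵖ V'))) n e)
    {σ : Fin n → Fin n} (hσσ : ∀ i, σ (σ i) = i) (hσe : ∀ i, B'.adj hσ (e i) = e (σ i))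
    (x' : B'.lieAlgebra hσ) (hx' : (x' : End Dᵐᵒᵖ V') ∈ 𝔥) (hreg : LieAlgebra.IsRegular F x') :
    ConormalCondition (symplecticI hσ B B') ((B'.splitPart 𝔥).map (groupActI F D V V'))
      σ (fun k => blockI V (e k)) ((B.lieAlgebra hσ).toSubmodule.map (leftActI F D V V'))
      (rightActI F D V V' (x' : End Dᵐᵒᵖ V')) := by
  set R := Algebra.adjoin F (𝔥 : Set (End Dᵐᵒᵖ V')) with hR
  have hcomm : ∀ a ∈ R, ∀ b ∈ R, a * b = b * a := fun a ha b hb => h.commute_of_mem_adjoin ha hb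
  have hsub : ∀ s ∈ 𝔥, s ∈ R := fun s hs => Algebra.subset_adjoin hs
  have hcx : ∀ i, (x' : End Dᵐᵒᵖ V') * e i = e i * x' := fun i =>
    hcomm _ (hsub _ hx') _ (he.mem i)
  have hxa : B'.adj hσ (x' : End Dᵐᵒᵖ V') = -x' := (B'.mem_lieAlgebra_iff hσ _).1 x'.2
  have hT : ∀ (z : End Dᵐᵒᵖ V) (w : V' →ₗ[Dᵐᵒᵖ] V),
      (rightActI F D V V' (x' : End Dᵐᵒᵖ V') + leftActI F D V V' z) w =
        -(w ∘ₗ (x' : End Dᵐᵒᵖ V')) + z ∘ₗ w := fun z w => rfl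
  refine ⟨?_, ?_, ?_, ?_⟩
  · rintro _ ⟨z, hz, rfl⟩ u v
    have hza := (B.mem_lieAlgebra_iff hσ z).1 hz
    have c1 := trF_comp_comm (F := F) (u ∘ₗ HermForm.adjoint hσ B B' v) z
    simp only [LinearMap.comp_assoc] at c1
    rw [hT, hT, symplecticI_apply, symplecticI_apply]
    simp only [map_add, map_neg, HermForm.adjoint_mul_right,
      HermForm.adjoint_mul_left, hza, hxa, LinearMap.add_comp, LinearMap.comp_add,
      LinearMap.neg_comp, LinearMap.comp_neg, trF_add, trF_neg, LinearMap.comp_assoc, c1]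
    ring
  · rintro _ ⟨z, hz, rfl⟩ _ ⟨a, ha, rfl⟩ w
    obtain ⟨c, -, -, rfl⟩ := (mem_splitPart_iff h he hσσ hσe a).1 ha
    have h2 := commute_sum_smul hcx (fun i => ((c i)⁻¹ : Fˣ).val)
    rw [← he.diag_symm_toLinearMap, Module.End.mul_eq_comp, Module.End.mul_eq_comp] at h2
    have hg : ∀ w : V' →ₗ[Dᵐᵒᵖ] V, groupActI F D V V' (he.diag c) w =
      w ∘ₗ (he.diag c).symm.toLinearMap := fun w => rfl
    rw [hT, hg, hT, hg, LinearMap.add_comp, LinearMap.neg_comp, LinearMap.comp_assoc,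
      LinearMap.comp_assoc, LinearMap.comp_assoc, h2]
  · rintro _ ⟨z, hz, rfl⟩ i
    have h1 := hcx i
    rw [Module.End.mul_eq_comp, Module.End.mul_eq_comp] at h1
    apply LinearMap.ext
    intro w
    rw [Module.End.mul_apply, Module.End.mul_apply, hT, hT, blockI_apply, blockI_apply,
      LinearMap.add_comp, LinearMap.neg_comp, LinearMap.comp_assoc, LinearMap.comp_assoc,
      LinearMap.comp_assoc, h1]
  · rintro _ ⟨z, hz, rfl⟩ w h0 hY
    have hza := (B.mem_lieAlgebra_iff hσ z).1 hz
    rw [hT] at h0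
    set w' := HermForm.adjoint hσ B B' w with hw'
    have h2 : (x' : End Dᵐᵒᵖ V') ∘ₗ w' = w' ∘ₗ z := by
      have := congrArg (HermForm.adjoint hσ B B') h0
      rw [map_add, map_neg, HermForm.adjoint_mul_right, HermForm.adjoint_mul_left, hza, hxa,
        map_zero, LinearMap.neg_comp, LinearMap.comp_neg, neg_neg, ← sub_eq_add_neg,
        sub_eq_zero] at this
      exact this
    have hww : w ∘ₗ w' = 0 := by
      refine HermForm.traceNondeg_lieAlgebra hσ B (w ∘ₗ w') ((B.mem_lieAlgebra_iff hσ _).2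
        (HermForm.adj_comp_adjoint w w)) fun s hs => ?_
      have h3 := hY (leftActI F D V V' s) ⟨s, hs, rfl⟩
      exact (trF_mul_comm _ _).trans h3
    have hiso : ∀ u ∈ LinearMap.range w', ∀ v ∈ LinearMap.range w', B'.form u v = 0 := by
      rintro _ ⟨u, rfl⟩ _ ⟨v, rfl⟩
      rw [hw', ← HermForm.form_adjoint hσ B B', ← hw', ← LinearMap.comp_apply, hww,
        LinearMap.zero_apply, B.form_zero_left]
    have hadj : ∀ s ∈ Algebra.adjoin F {(x' : End Dᵐᵒᵖ V')}, s ∈ R := fun s hs =>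
      (Algebra.adjoin_le (by
        rintro _ rfl
        exact hsub _ hx') : Algebra.adjoin F {(x' : End Dᵐᵒᵖ V')} ≤ R) hs
    -- a projection to the image of `w^*` that commutes with `x'`
    obtain ⟨p, hp1, hp2, hp3⟩ := exists_commuting_projection
      (Algebra.adjoin F {(x' : End Dᵐᵒᵖ V')})
      (fun a ha b hb => hcomm a (hadj a ha) b (hadj b hb))
      (fun a ha hn => h.adjoin_reduced (hadj a ha) hn)
      (LinearMap.range w') (fun s hs => adjoin_stable (by
        rintro _ rfl _ ⟨v, rfl⟩
        exact ⟨z v, (LinearMap.congr_fun h2 v).symm⟩) hs)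
    have hpp : p * p = p := LinearMap.ext fun v => hp3 _ (hp2 v)
    obtain ⟨y, hy1, hy2, hy3, hy4⟩ :=
      B'.exists_skew_of_isotropic hσ hpp (B'.adj_mul_self_eq_zero hσ hiso hp2)
    have hxp := hp1 _ (Algebra.subset_adjoin rfl)
    have hy𝔥 : y ∈ 𝔥 := h.mem_of_commute (HermForm.traceNondeg_lieAlgebra hσ B') hx' hreg
      ((B'.mem_lieAlgebra_iff hσ _).2 hy1) (hy4 _ hxp (B'.adj_commute hσ hxa hxp))
    have hyw' : y ∘ₗ w' = w' := LinearMap.ext fun v => by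
      have h5 := hp3 (w' v) ⟨v, rfl⟩
      rw [LinearMap.comp_apply]
      nth_rewrite 1 [← h5]
      rw [← Module.End.mul_apply, hy3, h5]
    have hwy : w ∘ₗ y = -w := by
      have h6 := HermForm.adjoint_comp hσ B' B' B y w'
      rw [hyw', hw', HermForm.adjoint_adjoint_of_neg] at h6
      change -w = (-w) ∘ₗ (B'.adj hσ y) at h6
      rw [hy1, LinearMap.neg_comp, LinearMap.comp_neg, neg_neg] at h6
      exact h6.symm
    have hcy : ∀ i, y * e i = e i * y := fun i => hcomm y (hsub y hy𝔥) _ (he.mem i)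
    have hadjy : ∀ i, y * e (σ i) = -B'.adj hσ (y * e i) := fun i => by
      rw [B'.adj_mul, hσe, hy1, mul_neg, neg_neg, hcy]
    have hneg : ∀ i, e i ≠ -e i := fun i hi => he.ne_zero i (by
      have h7 : (2 : F) • e i = 0 := by
        rw [two_smul]
        nth_rewrite 1 [hi]
        exact neg_add_cancel _
      exact (smul_eq_zero.1 h7).resolve_left two_ne_zero)
    -- the exponents are the negatives of the eigenvalues of `y`, as the torus acts on `w` by `a⁻¹`
    classical
    refine ⟨fun i => if y * e i = e i then -1 else if y * e i = -e i then 1 else 0, fun i => ?_,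
      fun i hi => ?_⟩
    · rcases he.exists_sign (hsub y hy𝔥) hy2 i (hcy i) with h8 | h8 | h8
      · have h9 : y * e (σ i) = 0 := by rw [hadjy, h8, map_zero, neg_zero]
        simp [h8, h9, (he.ne_zero i).symm, (he.ne_zero (σ i)).symm,
          eq_comm (a := (0 : End Dᵐᵒᵖ V')), he.ne_zero]
      · have h9 : y * e (σ i) = -e (σ i) := by rw [hadjy, h8, hσe]
        simp [h8, h9, (hneg (σ i)).symm]
      · have h9 : y * e (σ i) = e (σ i) := by rw [hadjy, h8, map_neg, hσe, neg_neg]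
        simp [h8, h9, (hneg i).symm]
    · have h10 : w ∘ₗ (y * e i) = -(w ∘ₗ e i) := by
        rw [Module.End.mul_eq_comp, ← LinearMap.comp_assoc, hwy, LinearMap.neg_comp]
      rw [blockI_apply] at hi
      rcases he.exists_sign (hsub y hy𝔥) hy2 i (hcy i) with h8 | h8 | h8
      · rw [h8, LinearMap.comp_zero, eq_comm, neg_eq_zero] at h10
        exact absurd h10 hi
      · rw [h8] at h10
        exfalso
        have h7 : (2 : F) • (w ∘ₗ e i) = 0 := by
          rw [two_smul]
          nth_rewrite 1 [h10]
          exact neg_add_cancel _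
        exact hi ((smul_eq_zero.1 h7).resolve_left two_ne_zero)
      · simp [h8, (hneg i).symm]

end TypeI

/-! ### Norms on finite dimensional spaces -/

section VNorm

open Topology

variable {F : Type*} [NontriviallyNormedField F]
variable {E : Type*} [AddCommGroup E] [Module F E] [FiniteDimensional F E]
variable {E' : Type*} [AddCommGroup E'] [Module F E'] [FiniteDimensional F E']

variable (F) in
/-- The maximum norm with respect to a chosen basis of a finite dimensional space. -/
def vnorm (v : E) : ℝ := ‖(finBasis F E).equivFun v‖

theorem vnorm_nonneg (v : E) : 0 ≤ vnorm F v := norm_nonneg _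

theorem vnorm_zero : vnorm F (0 : E) = 0 := by rw [vnorm, map_zero, norm_zero]

theorem vnorm_eq_zero {v : E} : vnorm F v = 0 ↔ v = 0 := by
  rw [vnorm, norm_eq_zero, LinearEquiv.map_eq_zero_iff]

theorem vnorm_pos {v : E} (hv : v ≠ 0) : 0 < vnorm F v :=
  (vnorm_nonneg v).lt_of_ne fun h => hv (vnorm_eq_zero.1 h.symm)

theorem vnorm_smul (c : F) (v : E) : vnorm F (c • v) = ‖c‖ * vnorm F v := by
  rw [vnorm, map_smul, norm_smul, vnorm]

theorem vnorm_neg (v : E) : vnorm F (-v) = vnorm F v := by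
  rw [vnorm, map_neg, norm_neg, vnorm]

theorem vnorm_add_le (v w : E) : vnorm F (v + w) ≤ vnorm F v + vnorm F w := by
  rw [vnorm, map_add]
  exact norm_add_le _ _

theorem vnorm_add_le_of_le [IsUltrametricDist F] {v w : E} {r : ℝ} (hv : vnorm F v ≤ r)
    (hw : vnorm F w ≤ r) : vnorm F (v + w) ≤ r := by
  have h0 : 0 ≤ r := (vnorm_nonneg v).trans hv
  rw [vnorm, pi_norm_le_iff_of_nonneg h0] at *
  intro i
  rw [map_add, Pi.add_apply]
  exact (IsUltrametricDist.norm_add_le_max _ _).trans (max_le (hv i) (hw i))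

theorem vnorm_sub_le_of_le [IsUltrametricDist F] {v w : E} {r : ℝ} (hv : vnorm F v ≤ r)
    (hw : vnorm F w ≤ r) : vnorm F (v - w) ≤ r := by
  rw [sub_eq_add_neg]
  exact vnorm_add_le_of_le hv (by rwa [vnorm_neg])

theorem vnorm_sum_le {ι : Type*} (s : Finset ι) (f : ι → E) :
    vnorm F (∑ i ∈ s, f i) ≤ ∑ i ∈ s, vnorm F (f i) := by
  rw [vnorm, map_sum]
  exact norm_sum_le _ _

theorem norm_repr_le (v : E) (i : Fin (finrank F E)) :
    ‖(finBasis F E).equivFun v i‖ ≤ vnorm F v := norm_le_pi_norm _ i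

/-- Linear maps are bounded. -/
theorem exists_vnorm_apply_le (f : E →ₗ[F] E') :
    ∃ C : ℝ, 0 < C ∧ ∀ v, vnorm F (f v) ≤ C * vnorm F v := by
  refine ⟨∑ i, vnorm F (f (finBasis F E i)) + 1, by
    have : 0 ≤ ∑ i, vnorm F (f (finBasis F E i)) := Finset.sum_nonneg fun i _ => vnorm_nonneg _
    linarith, fun v => ?_⟩
  conv_lhs => rw [← (finBasis F E).sum_equivFun v, map_sum]
  refine (vnorm_sum_le _ _).trans ?_
  rw [add_mul, Finset.sum_mul, one_mul]
  refine (Finset.sum_le_sum fun i _ => ?_).trans (le_add_of_nonneg_right (vnorm_nonneg v))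
  rw [map_smul, vnorm_smul, mul_comm]
  exact mul_le_mul_of_nonneg_left (norm_repr_le v i) (vnorm_nonneg _)

theorem exists_norm_apply_le (l : E →ₗ[F] F) :
    ∃ C : ℝ, 0 < C ∧ ∀ v, ‖l v‖ ≤ C * vnorm F v := by
  refine ⟨∑ i, ‖l (finBasis F E i)‖ + 1, by
    have : 0 ≤ ∑ i, ‖l (finBasis F E i)‖ := Finset.sum_nonneg fun i _ => norm_nonneg _
    linarith, fun v => ?_⟩
  conv_lhs => rw [← (finBasis F E).sum_equivFun v, map_sum]
  refine (norm_sum_le _ _).trans ?_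
  rw [add_mul, Finset.sum_mul, one_mul]
  refine (Finset.sum_le_sum fun i _ => ?_).trans (le_add_of_nonneg_right (vnorm_nonneg v))
  rw [map_smul, smul_eq_mul, norm_mul, mul_comm]
  exact mul_le_mul_of_nonneg_left (norm_repr_le v i) (norm_nonneg _)

/-- The evaluation pairing between a space and its dual is bounded. -/
theorem exists_norm_dual_apply_le (F E : Type*) [NontriviallyNormedField F] [AddCommGroup E]
    [Module F E] [FiniteDimensional F E] :
    ∃ C : ℝ, 0 < C ∧ ∀ (ξ : Dual F E) (v : E), ‖ξ v‖ ≤ C * vnorm F ξ * vnorm F v := by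
  choose C hC hC' using fun i => exists_norm_apply_le (Dual.eval F E (finBasis F E i))
  refine ⟨∑ i, C i + 1, by
    have : 0 ≤ ∑ i, C i := Finset.sum_nonneg fun i _ => (hC i).le
    linarith, fun ξ v => ?_⟩
  conv_lhs => rw [← (finBasis F E).sum_equivFun v, map_sum]
  refine (norm_sum_le _ _).trans ?_
  rw [add_mul, add_mul, Finset.sum_mul, Finset.sum_mul]
  refine (Finset.sum_le_sum fun i _ => ?_).trans (le_add_of_nonneg_right (by
    have := vnorm_nonneg (F := F) v
    have := vnorm_nonneg (F := F) ξ
    positivity))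
  rw [map_smul, smul_eq_mul, norm_mul, mul_comm]
  exact mul_le_mul (hC' i ξ) (norm_repr_le v i) (norm_nonneg _)
    (mul_nonneg (hC i).le (vnorm_nonneg _))

/-- The norm on the dual space is controlled by the values on a unit lattice. -/
theorem exists_vnorm_dual_le (F E : Type*) [NontriviallyNormedField F] [AddCommGroup E]
    [Module F E] [FiniteDimensional F E] (r : ℝ) (hr : 0 < r) :
    ∃ C : ℝ, 0 < C ∧ ∀ (ξ : Dual F E) (M : ℝ), 0 ≤ M → (∀ v, vnorm F v ≤ r → ‖ξ v‖ ≤ M) →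
      vnorm F ξ ≤ C * M := by
  obtain ⟨c, hc0, hc⟩ : ∃ c : F, c ≠ 0 ∧ ∀ i, vnorm F (c • finBasis F E i) ≤ r := by
    have h1 : ∀ i, 0 < r / (vnorm F (finBasis F E i) + 1) := fun i =>
      div_pos hr (by have := vnorm_nonneg (F := F) (finBasis F E i); linarith)
    obtain ⟨δ, hδ, hδ'⟩ : ∃ δ : ℝ, 0 < δ ∧ ∀ i, δ ≤ r / (vnorm F (finBasis F E i) + 1) := by
      rcases isEmpty_or_nonempty (Fin (finrank F E)) with h | h
      · exact ⟨1, one_pos, fun i => h.elim i⟩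
      · obtain ⟨i, hi⟩ := Finite.exists_min fun i => r / (vnorm F (finBasis F E i) + 1)
        exact ⟨_, h1 i, hi⟩
    obtain ⟨c, hc0, hc⟩ := NormedField.exists_norm_lt F hδ
    refine ⟨c, norm_pos_iff.1 hc0, fun i => ?_⟩
    rw [vnorm_smul]
    have h2 := hc.le.trans (hδ' i)
    rw [le_div_iff₀ (by have := vnorm_nonneg (F := F) (finBasis F E i); linarith)] at h2
    nlinarith [norm_nonneg c]
  refine ⟨∑ i, ‖c‖⁻¹ * vnorm F ((finBasis F E).coord i) + 1, by
    have : 0 ≤ ∑ i, ‖c‖⁻¹ * vnorm F ((finBasis F E).coord i) :=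
      Finset.sum_nonneg fun i _ => mul_nonneg (inv_nonneg.2 (norm_nonneg _)) (vnorm_nonneg _)
    linarith, fun ξ M hM hξ => ?_⟩
  conv_lhs => rw [← (finBasis F E).sum_dual_apply_smul_coord ξ]
  refine (vnorm_sum_le _ _).trans ?_
  rw [add_mul, Finset.sum_mul]
  refine (Finset.sum_le_sum fun i _ => ?_).trans (le_add_of_nonneg_right (by linarith))
  have h4 := hξ _ (hc i)
  rw [map_smul, smul_eq_mul, norm_mul, ← le_div_iff₀' (norm_pos_iff.2 hc0)] at h4
  rw [vnorm_smul]
  calc _ ≤ M / ‖c‖ * vnorm F ((finBasis F E).coord i) :=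
        mul_le_mul_of_nonneg_right h4 (vnorm_nonneg _)
    _ = _ := by ring

section Topological

variable [TopologicalSpace E] [IsModuleTopology F E]

variable (F E) in
/-- The coordinates as a homeomorphism. -/
def coordHomeomorph : E ≃ₜ (Fin (finrank F E) → F) :=
  have : ContinuousAdd E := IsModuleTopology.toContinuousAdd F E
  { (finBasis F E).equivFun.toEquiv with
    continuous_toFun := IsModuleTopology.continuous_of_linearMap
      (finBasis F E).equivFun.toLinearMap
    continuous_invFun := IsModuleTopology.continuous_of_linearMap
      (finBasis F E).equivFun.symm.toLinearMap }

theorem norm_coordHomeomorph (v : E) : ‖coordHomeomorph F E v‖ = vnorm F v := rfl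

theorem continuous_vnorm : Continuous (vnorm F : E → ℝ) :=
  (coordHomeomorph F E).continuous.norm

theorem t2Space_of_isModuleTopology (F E : Type*) [NontriviallyNormedField F] [AddCommGroup E]
    [Module F E] [FiniteDimensional F E] [TopologicalSpace E] [IsModuleTopology F E] : T2Space E :=
  (coordHomeomorph F E).symm.t2Space

variable (F E) in
theorem secondCountable_of_isModuleTopology [LocallyCompactSpace F] :
    SecondCountableTopology E :=
  have : ProperSpace F := ProperSpace.of_locallyCompactSpace F
  (coordHomeomorph F E).isInducing.secondCountableTopology

theorem isCompact_vnorm_le [LocallyCompactSpace F] (R : ℝ) : IsCompact {v : E | vnorm F v ≤ R} := by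
  have : ProperSpace F := ProperSpace.of_locallyCompactSpace F
  have h := (isCompact_closedBall (0 : Fin (finrank F E) → F) R)
  rw [← (coordHomeomorph F E).isCompact_preimage] at h
  convert h using 1
  ext v
  simp [norm_coordHomeomorph]

variable (F E) in
theorem locallyCompactSpace_of_isModuleTopology [LocallyCompactSpace F] : LocallyCompactSpace E :=
  have : ProperSpace F := ProperSpace.of_locallyCompactSpace F
  (coordHomeomorph F E).isClosedEmbedding.locallyCompactSpace

theorem nhds_basis_vnorm (v : E) :
    (𝓝 v).HasBasis (fun ε : ℝ => 0 < ε) fun ε => {w | vnorm F (w - v) < ε} := by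
  rw [(coordHomeomorph F E).nhds_eq_comap]
  convert (Metric.nhds_basis_ball (x := coordHomeomorph F E v)).comap (coordHomeomorph F E) using 2
  with ε
  ext w
  rw [Set.mem_preimage, Metric.mem_ball, dist_eq_norm]
  change _ ↔ ‖(finBasis F E).equivFun w - (finBasis F E).equivFun v‖ < ε
  rw [← map_sub]
  rfl

theorem isOpen_vnorm_le [IsUltrametricDist F] (v : E) {r : ℝ} (hr : 0 < r) :
    IsOpen {w : E | vnorm F (w - v) ≤ r} := by
  rw [isOpen_iff_mem_nhds]
  intro w hw
  refine (nhds_basis_vnorm (F := F) w).mem_iff.2 ⟨r, hr, fun u hu => ?_⟩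
  rw [Set.mem_ofPred_eq, ← sub_add_sub_cancel u w v]
  exact vnorm_add_le_of_le (le_of_lt hu) hw

end Topological

theorem isBddSet_of_vnorm_le {S : Set E} {R : ℝ} (h : ∀ v ∈ S, vnorm F v ≤ R) :
    IsBddSet (F := F) S := by
  intro l
  obtain ⟨C, hC, hC'⟩ := exists_norm_apply_le l
  exact ⟨C * R, fun v hv => (hC' v).trans (mul_le_mul_of_nonneg_left (h v hv) hC.le)⟩

end VNorm

/-! ### Measures on orbit spaces -/

section OrbitMeasure

open ENNReal

variable {G X : Type*} [Group G] [MulAction G X] [MeasurableSpace G] [MeasurableSpace X]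
variable [MeasurableSMul₂ G X]
variable {dw : Measure X} {da : Measure G}

local notation "Orb" => MulAction.orbitRel.Quotient G X

/-- The orbit of a point. -/
def orbitMk (G : Type*) {X : Type*} [Group G] [MulAction G X] (w : X) :
    MulAction.orbitRel.Quotient G X :=
  Quotient.mk'' w

theorem measurable_orbitMk : Measurable (orbitMk G : X → Orb) := measurable_quotient_mk''

theorem apply_out_orbitMk {Y : Type*} {H : X → Y} (hH : ∀ (a : G) w, H (a • w) = H w) (w : X) :
    H (Quotient.out (orbitMk G w)) = H w := by
  obtain ⟨a, ha⟩ := MulAction.orbitRel_apply.1 (Quotient.mk_out (s := MulAction.orbitRel G X) w)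
  rw [orbitMk]
  exact (congrArg H ha).symm.trans (hH a w)

theorem orbitMk_out (q : Orb) : orbitMk G (Quotient.out q) = q := Quotient.out_eq' q

/-- A measurable invariant function is measurable on the orbit space. -/
theorem measurable_comp_out {Y : Type*} [MeasurableSpace Y] {H : X → Y} (hm : Measurable H)
    (hH : ∀ (a : G) w, H (a • w) = H w) : Measurable fun q : Orb => H (Quotient.out q) := by
  refine measurable_from_quotient.2 ?_
  convert hm using 1
  ext w
  exact apply_out_orbitMk hH w

theorem measurable_comp_smul {Y : Type*} [MeasurableSpace Y] {f : X → Y} (hf : Measurable f)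
    (w : X) : Measurable fun a : G => f (a • w) :=
  hf.comp (measurable_id.smul_const w)

theorem measurable_lintegral_smul [SFinite da] {f : X → ℝ≥0∞} (hf : Measurable f) :
    Measurable fun w => ∫⁻ a : G, f (a • w) ∂da :=
  Measurable.lintegral_prod_right' (f := fun p : X × G => f (p.2 • p.1))
    (hf.comp (measurable_snd.smul measurable_fst))

section Invariant

variable [MeasurableMul G] [da.IsMulRightInvariant]

theorem lintegral_smul_smul (f : X → ℝ≥0∞) (b : G) (w : X) :
    ∫⁻ a : G, f (a • b • w) ∂da = ∫⁻ a : G, f (a • w) ∂da := by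
  simp only [smul_smul]
  exact lintegral_mul_right_eq_self (fun a => f (a • w)) b

theorem measure_smul_mem (B : Set X) (hB : MeasurableSet B) (w : X) :
    da {a : G | a • w ∈ B} = ∫⁻ a : G, B.indicator 1 (a • w) ∂da := by
  have hB' : MeasurableSet {a : G | a • w ∈ B} := (measurable_id.smul_const w : Measurable
    fun a : G => a • w) hB
  rw [← lintegral_indicator_one hB']
  rfl

variable [SFinite da]

theorem measurable_measure_smul_mem {B : Set X} (hB : MeasurableSet B) :
    Measurable fun w => da {a : G | a • w ∈ B} := by
  simp only [measure_smul_mem B hB]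
  exact measurable_lintegral_smul (measurable_one.indicator hB)

theorem measure_smul_smul_mem {B : Set X} (hB : MeasurableSet B) (b : G) (w : X) :
    da {a : G | a • b • w ∈ B} = da {a : G | a • w ∈ B} := by
  rw [measure_smul_mem B hB, measure_smul_mem B hB, lintegral_smul_smul]

/-- A function whose integral over almost every orbit is `1`. It is a weighted sum of indicator
functions of the sets `B n`, divided by its integral over the orbit. -/
theorem exists_normalized {B : ℕ → Set X} (hB : ∀ n, MeasurableSet (B n))
    (hpos : ∀ w, ∃ n, da {a : G | a • w ∈ B n} ≠ 0) :
    ∃ g : X → ℝ≥0∞, Measurable g ∧ ∀ w, (∀ n, da {a : G | a • w ∈ B n} ≠ ∞) →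
      ∫⁻ a : G, g (a • w) ∂da = 1 := by
  set m : ℕ → X → ℝ≥0∞ := fun n w => da {a : G | a • w ∈ B n} with hm
  have hmm : ∀ n, Measurable (m n) := fun n => measurable_measure_smul_mem (hB n)
  have hmi : ∀ n (b : G) w, m n (b • w) = m n w := fun n b w => measure_smul_smul_mem (hB n) b w
  let g₀ : X → ℝ≥0∞ := fun w => ∑' n, (2⁻¹ ^ n * (1 + m n w)⁻¹) * (B n).indicator 1 w
  have hg₀ : Measurable g₀ := Measurable.tsum fun n =>
    (((hmm n).const_add 1).inv.const_mul _).mul (measurable_one.indicator (hB n))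
  let J : X → ℝ≥0∞ := fun w => ∫⁻ a : G, g₀ (a • w) ∂da
  have hJm : Measurable J := measurable_lintegral_smul hg₀
  have hJi : ∀ (b : G) w, J (b • w) = J w := fun b w => lintegral_smul_smul g₀ b w
  have hJ : ∀ w, J w = ∑' n, (2⁻¹ ^ n * (1 + m n w)⁻¹) * m n w := by
    intro w
    simp only [J, g₀, hmi]
    rw [lintegral_tsum fun n => by
      exact ((measurable_comp_smul (measurable_one.indicator (hB n)) w).const_mul _).aemeasurable]
    refine tsum_congr fun n => ?_
    rw [lintegral_const_mul _ (measurable_comp_smul (measurable_one.indicator (hB n)) w),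
      ← measure_smul_mem _ (hB n)]
  refine ⟨fun w => g₀ w * (J w)⁻¹, hg₀.mul hJm.inv, fun w hw => ?_⟩
  simp only [hJi]
  rw [lintegral_mul_const _ (measurable_comp_smul hg₀ w)]
  refine ENNReal.mul_inv_cancel ?_ ?_
  · change J w ≠ 0
    obtain ⟨n, hn⟩ := hpos w
    rw [hJ]
    refine fun h0 => ?_
    have := ENNReal.tsum_eq_zero.1 h0 n
    simp only [mul_eq_zero, ENNReal.inv_eq_zero, ENNReal.add_eq_top, pow_eq_zero_iff'] at this
    rcases this with (h | h) | h
    · simp at h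
    · rcases h with h | h
      · exact ENNReal.one_ne_top h
      · exact hw n h
    · exact hn h
  · change J w ≠ ∞
    rw [hJ]
    have : ∑' n : ℕ, (2⁻¹ : ℝ≥0∞) ^ n ≠ ∞ := by
      rw [ENNReal.tsum_geometric]
      simp
    refine ne_top_of_le_ne_top this (ENNReal.tsum_le_tsum fun n => ?_)
    rw [mul_assoc]
    refine mul_le_of_le_one_right' ?_
    rw [mul_comm, ← div_eq_mul_inv]
    exact ENNReal.div_le_of_le_mul (by rw [one_mul]; exact le_add_self)

/-- An orbit measure is determined by `ν E = ∫ g 1_E`, where `g` has integral `1` over almost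
every orbit. -/
theorem IsOrbitMeasure.unique {g : X → ℝ≥0∞} (hg : Measurable g) {X₀ : Set X}
    (hX₀ : MeasurableSet X₀) (hX₀i : ∀ (a : G) w, a • w ∈ X₀ ↔ w ∈ X₀) (hX₀c : dw X₀ᶜ = 0)
    (hg1 : ∀ w ∈ X₀, ∫⁻ a : G, g (a • w) ∂da = 1) (hda : da ≠ 0) {ν₁ ν₂ : Measure Orb}
    (h₁ : IsOrbitMeasure dw da ν₁) (h₂ : IsOrbitMeasure dw da ν₂) : ν₁ = ν₂ := by
  have key : ∀ ν : Measure Orb, IsOrbitMeasure dw da ν → ∀ E : Set Orb, MeasurableSet E →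
      ν E = ∫⁻ w, g w * (orbitMk G ⁻¹' E).indicator 1 w ∂dw := by
    intro ν hν E hE
    have hinv : ∀ (a : G) (q : Orb), orbitMk G (a • Quotient.out q) = q := fun a q => by
      conv_rhs => rw [← orbitMk_out q]
      exact Quotient.sound' (MulAction.orbitRel_apply.2 ⟨a, rfl⟩)
    have hnull : ν {q : Orb | Quotient.out q ∈ X₀ᶜ} = 0 := by
      have h := hν (X₀ᶜ.indicator 1) (measurable_one.indicator hX₀.compl)
      rw [lintegral_indicator_one hX₀.compl, hX₀c] at h
      have hm : Measurable fun q : Orb => ∫⁻ a : G, X₀ᶜ.indicator (1 : X → ℝ≥0∞)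
          (a • (Quotient.out q : X)) ∂da :=
        measurable_comp_out (measurable_lintegral_smul (measurable_one.indicator hX₀.compl))
          fun b w => lintegral_smul_smul _ b w
      have h2 := (lintegral_eq_zero_iff hm).1 h.symm
      refine measure_mono_null (fun q hq => ?_) (ae_iff.1 h2)
      intro h3
      have h4 : ∀ a : G, X₀ᶜ.indicator (1 : X → ℝ≥0∞) (a • (Quotient.out q : X)) = 1 := fun a =>
        Set.indicator_of_mem (s := X₀ᶜ) (fun h5 => hq ((hX₀i a _).1 h5)) _
      simp only [h4, lintegral_one, Pi.zero_apply] at h3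
      exact hda (Measure.measure_univ_eq_zero.1 h3)
    have hind : Measurable ((orbitMk G ⁻¹' E).indicator (1 : X → ℝ≥0∞)) :=
      measurable_one.indicator (measurable_orbitMk hE)
    have hν' := hν (fun w => g w * (orbitMk G ⁻¹' E).indicator 1 w) (hg.mul hind)
    rw [hν', ← lintegral_indicator_one hE]
    refine lintegral_congr_ae ?_
    filter_upwards [measure_eq_zero_iff_ae_notMem.1 hnull] with q hq
    have hq' : (Quotient.out q : X) ∈ X₀ := by
      by_contra h
      exact hq h
    have h6 : ∀ a : G, (orbitMk G ⁻¹' E).indicator (1 : X → ℝ≥0∞) (a • (Quotient.out q : X)) =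
        E.indicator 1 q := fun a => by
      change E.indicator 1 (orbitMk G (a • Quotient.out q)) = _
      rw [hinv]
    simp only [h6]
    rw [lintegral_mul_const _ (measurable_comp_smul hg _), hg1 _ hq', one_mul]
  ext E hE
  rw [key ν₁ h₁ E hE, key ν₂ h₂ E hE]

/-- The push-forward of `g dw` is an orbit measure. -/
theorem IsOrbitMeasure.exists [SFinite dw] [MeasurableInv G] [da.IsInvInvariant]
    (hdw : ∀ a : G, MeasurePreserving (fun w : X => a • w) dw dw)
    {g : X → ℝ≥0∞} (hg : Measurable g)
    (hg1 : ∀ᵐ w ∂dw, ∫⁻ a : G, g (a • w) ∂da = 1) :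
    ∃ ν : Measure Orb, IsOrbitMeasure dw da ν := by
  refine ⟨(dw.withDensity g).map (orbitMk G), fun f hf => ?_⟩
  have hH : Measurable fun w => ∫⁻ a : G, f (a • w) ∂da := measurable_lintegral_smul hf
  have hHi : ∀ (b : G) w, ∫⁻ a : G, f (a • b • w) ∂da = ∫⁻ a : G, f (a • w) ∂da :=
    fun b w => lintegral_smul_smul _ b w
  rw [lintegral_map (measurable_comp_out hH hHi) measurable_orbitMk]
  have h1 : ∀ w : X, ∫⁻ a : G, f (a • (Quotient.out (orbitMk G w) : X)) ∂da =
      ∫⁻ a : G, f (a • w) ∂da := fun w =>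
    apply_out_orbitMk (H := fun w => ∫⁻ a : G, f (a • w) ∂da) hHi w
  simp only [h1]
  rw [lintegral_withDensity_eq_lintegral_mul _ hg hH]
  have h2 : ∀ w, (g * fun w => ∫⁻ a : G, f (a • w) ∂da) w = ∫⁻ a : G, g w * f (a • w) ∂da :=
    fun w => (lintegral_const_mul _ (measurable_comp_smul hf w)).symm
  simp only [h2]
  have hgf : Measurable fun p : X × G => g p.1 * f (p.2 • p.1) :=
    (hg.comp measurable_fst).mul (hf.comp (measurable_snd.smul measurable_fst))
  rw [lintegral_lintegral_swap hgf.aemeasurable]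
  have h3 : ∀ a : G, ∫⁻ w, g w * f (a • w) ∂dw = ∫⁻ w, g (a⁻¹ • w) * f w ∂dw := by
    intro a
    have := (hdw a).lintegral_comp (f := fun w => g (a⁻¹ • w) * f w)
      ((hg.comp (measurable_const_smul a⁻¹)).mul hf)
    simpa only [inv_smul_smul] using this
  simp only [h3]
  have hgf' : Measurable fun p : G × X => g (p.1⁻¹ • p.2) * f p.2 :=
    (hg.comp (measurable_fst.inv.smul measurable_snd)).mul (hf.comp measurable_snd)
  rw [lintegral_lintegral_swap hgf'.aemeasurable]
  refine lintegral_congr_ae ?_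
  filter_upwards [hg1] with w hw
  have h4 : Measurable fun a : G => g (a⁻¹ • w) := hg.comp (measurable_inv.smul_const w)
  rw [lintegral_mul_const _ h4, lintegral_inv_eq_self (μ := da) (fun a => g (a • w)), hw, one_mul]

/-- An invariant set whose orbits spend at least time `c` in a set of finite measure has finite
measure in the orbit space. -/
theorem IsOrbitMeasure.measure_lt_top {ν : Measure Orb} (hν : IsOrbitMeasure dw da ν)
    {S B : Set X} (hB : MeasurableSet B) (hBf : dw B < ∞) {c : ℝ≥0∞} (hc : c ≠ 0)
    (hS : ∀ w ∈ S, c ≤ da {a : G | a • w ∈ B}) : ν {q : Orb | Quotient.out q ∈ S} < ∞ := by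
  have h := hν (B.indicator 1) (measurable_one.indicator hB)
  rw [lintegral_indicator_one hB] at h
  simp only [← measure_smul_mem B hB] at h
  have hm : Measurable fun q : Orb => da {a : G | a • (Quotient.out q : X) ∈ B} :=
    measurable_comp_out (measurable_measure_smul_mem hB) fun b w => measure_smul_smul_mem hB b w
  have h1 := mul_meas_ge_le_lintegral (μ := ν) hm c
  rw [← h] at h1
  have h2 : ν {q : Orb | c ≤ da {a : G | a • (Quotient.out q : X) ∈ B}} < ∞ := by
    by_contra h3
    rw [not_lt_top_iff] at h3
    rw [h3, ENNReal.mul_top hc] at h1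
    exact (h1.trans_lt hBf).ne rfl
  exact (measure_mono (t := {q : Orb | c ≤ da {a : G | a • (Quotient.out q : X) ∈ B}})
    fun q hq => hS _ hq).trans_lt h2

/-- A transformation that commutes with `G` and scales `dw` scales the orbit measure. -/
theorem IsOrbitMeasure.integral_comp {ν : Measure Orb} (hν : IsOrbitMeasure dw da ν)
    (huniq : ∀ ν₁ ν₂ : Measure Orb, ∀ c : ℝ≥0∞, c ≠ ∞ → IsOrbitMeasure (c • dw) da ν₁ →
      IsOrbitMeasure (c • dw) da ν₂ → ν₁ = ν₂)
    {k : X → X} (hk : Measurable k) (hkG : ∀ (a : G) w, k (a • w) = a • k w) {c : ℝ≥0∞}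
    (hc : c ≠ ∞) (hkw : dw.map k = c • dw) {H : X → ℂ} (hH : Measurable H)
    (hHi : ∀ (a : G) w, H (a • w) = H w) :
    ∫ q : Orb, H (k (Quotient.out q)) ∂ν = c.toReal • ∫ q : Orb, H (Quotient.out q) ∂ν := by
  let kq : Orb → Orb := fun q => orbitMk G (k (Quotient.out q))
  have hmk : ∀ (a : G) (w : X), orbitMk G (a • w) = orbitMk G w := fun a w =>
    Quotient.sound' (MulAction.orbitRel_apply.2 ⟨a, rfl⟩)
  have hkq : Measurable kq := measurable_comp_out (H := fun w => orbitMk G (k w))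
    (measurable_orbitMk.comp hk) fun a w => by rw [hkG, hmk]
  have h1 : IsOrbitMeasure (c • dw) da (ν.map kq) := by
    intro f hf
    have hfH : Measurable fun w => ∫⁻ a : G, f (a • w) ∂da := measurable_lintegral_smul hf
    have hfi : ∀ (b : G) w, ∫⁻ a : G, f (a • b • w) ∂da = ∫⁻ a : G, f (a • w) ∂da :=
      fun b w => lintegral_smul_smul _ b w
    have hν' := hν (fun w => f (k w)) (hf.comp hk)
    rw [← hkw, lintegral_map hf hk, hν',
      lintegral_map (measurable_comp_out hfH hfi) hkq]
    refine lintegral_congr fun q => ?_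
    have h2 : ∫⁻ a : G, f (a • (Quotient.out (kq q) : X)) ∂da =
      ∫⁻ a : G, f (a • k (Quotient.out q)) ∂da :=
      apply_out_orbitMk (H := fun w => ∫⁻ a : G, f (a • w) ∂da) hfi (k (Quotient.out q))
    rw [h2]
    simp only [hkG]
  have h2 : IsOrbitMeasure (c • dw) da (c • ν) := by
    intro f hf
    rw [lintegral_smul_measure, lintegral_smul_measure, hν f hf]
  have h3 := huniq _ _ c hc h1 h2
  have h4 := integral_map (μ := ν) (φ := kq) hkq.aemeasurable
    (f := fun q => H (Quotient.out q)) (measurable_comp_out hH hHi).aestronglyMeasurable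
  rw [h3, integral_smul_measure] at h4
  rw [h4]
  refine integral_congr_ae (Filter.Eventually.of_forall fun q => ?_)
  exact (apply_out_orbitMk hHi (k (Quotient.out q))).symm

end Invariant

end OrbitMeasure

/-! ### The weights of a torus -/

section TorusAlgebra

variable {F : Type*} [Field F] {W : Type*} [AddCommGroup W] [Module F W]

open Classical in
/-- A linear functional on `End(W)` that returns `c` on the transformations that act on the image of
`q ≠ 0` by the scalar `c`. -/
def blockWeight (q : End F W) : End F W →ₗ[F] F :=
  if h : ∃ (w : W) (l : Dual F W), l (q w) = 1 then
    h.choose_spec.choose ∘ₗ LinearMap.applyₗ (q h.choose)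
  else 0

theorem blockWeight_eq {q T : End F W} {c : F} (hq : q ≠ 0) (hT : ∀ v, T (q v) = c • q v) :
    blockWeight q T = c := by
  have h : ∃ (w : W) (l : Dual F W), l (q w) = 1 := by
    obtain ⟨w, hw⟩ : ∃ w, q w ≠ 0 := by
      by_contra! h
      exact hq (LinearMap.ext h)
    obtain ⟨l, hl⟩ : ∃ l : Dual F W, l (q w) ≠ 0 := by
      by_contra! h
      exact hw ((Module.forall_dual_apply_eq_zero_iff F _).1 h)
    exact ⟨w, (l (q w))⁻¹ • l, inv_mul_cancel₀ hl⟩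
  rw [blockWeight, dif_pos h]
  change h.choose_spec.choose (T (q h.choose)) = c
  rw [hT, map_smul, h.choose_spec.choose_spec, smul_eq_mul, mul_one]

theorem blockWeight_zero : blockWeight (0 : End F W) = 0 := by
  rw [blockWeight, dif_neg]
  rintro ⟨w, l, h⟩
  simp at h

variable {ω : W →ₗ[F] W →ₗ[F] F} {A : Subgroup (W ≃ₗ[F] W)} {K : Type*} [Fintype K]
variable {bar : K → K} {p : K → End F W}

/-- The scalars by which an element of the torus acts on the blocks (zero for zero blocks). -/
def weight (p : K → End F W) (a : A) (k : K) : F :=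
  blockWeight (p k) ((a : W ≃ₗ[F] W) : End F W)

namespace TorusBlocks

variable (h : TorusBlocks ω A bar p)
include h

theorem sum_apply (w : W) : ∑ k, p k w = w := by
  rw [← LinearMap.sum_apply, h.sum]
  rfl

theorem block_block (k : K) (w : W) : p k (p k w) = p k w := LinearMap.congr_fun (h.idem k) w

theorem block_block_of_ne {k l : K} (hkl : k ≠ l) (w : W) : p k (p l w) = 0 :=
  LinearMap.congr_fun (h.orth k l hkl) w

theorem block_sum_smul (c : K → F) (k : K) (w : W) :
    p k (∑ l, c l • p l w) = c k • p k w := by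
  rw [map_sum, Finset.sum_eq_single k]
  · rw [map_smul, h.block_block]
  · intro l _ hl
    rw [map_smul, h.block_block_of_ne hl.symm, smul_zero]
  · simp

theorem sum_smul_block (c : K → F) (k : K) (w : W) :
    ∑ l, c l • p l (p k w) = c k • p k w := by
  rw [Finset.sum_eq_single k]
  · rw [h.block_block]
  · intro l _ hl
    rw [h.block_block_of_ne hl, smul_zero]
  · simp

theorem block_bar_ne_zero {k : K} (hk : p k ≠ 0) : p (bar k) ≠ 0 := by
  intro h0
  apply hk
  ext w
  refine h.nondeg _ fun u => ?_
  have := h.adj (bar k) u w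
  rw [h.bar_bar] at this
  rw [← this, h0]
  simp

theorem eq_zero_of_pairing {v : W} {k : K} (hv : ∀ u, ω (p k u) v = 0) : p (bar k) v = 0 :=
  h.nondeg _ fun u => by rw [← h.adj, hv]

theorem apply_block (a : A) (k : K) (w : W) :
    (a : W ≃ₗ[F] W) (p k w) = weight p a k • p k w := by
  obtain ⟨c, -, -, hc⟩ := (h.mem_iff a).1 a.2
  have h1 : ∀ v, (a : W ≃ₗ[F] W) (p k v) = (c k : F) • p k v := fun v => by
    rw [hc, h.sum_smul_block fun l => (c l : F)]
  by_cases hk : p k = 0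
  · rw [hk]; simp
  · rw [weight, blockWeight_eq hk h1, h1]

theorem apply_eq (a : A) (w : W) : (a : W ≃ₗ[F] W) w = ∑ k, weight p a k • p k w := by
  conv_lhs => rw [← h.sum_apply w, map_sum]
  exact Finset.sum_congr rfl fun k _ => h.apply_block a k w

theorem block_apply (a : A) (k : K) (w : W) :
    p k ((a : W ≃ₗ[F] W) w) = weight p a k • p k w := by
  rw [h.apply_eq, h.block_sum_smul fun l => weight p a l]

theorem weight_eq {a : A} {k : K} {c : F} (hk : p k ≠ 0)
    (hc : ∀ v, (a : W ≃ₗ[F] W) (p k v) = c • p k v) : weight p a k = c :=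
  blockWeight_eq hk hc

theorem weight_of_eq_zero (a : A) {k : K} (hk : p k = 0) : weight p a k = 0 := by
  rw [weight, hk, blockWeight_zero]
  rfl

theorem weight_mul_bar (a : A) {k : K} (hk : p k ≠ 0) :
    weight p a k * weight p a (bar k) = 1 := by
  obtain ⟨c, hc1, -, hc⟩ := (h.mem_iff a).1 a.2
  have h1 : ∀ k v, (a : W ≃ₗ[F] W) (p k v) = (c k : F) • p k v := fun k v => by
    rw [hc, h.sum_smul_block fun l => (c l : F)]
  rw [h.weight_eq hk (h1 k), h.weight_eq (h.block_bar_ne_zero hk) (h1 _), ← Units.val_mul, hc1,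
    Units.val_one]

theorem weight_of_bar_eq (a : A) {k : K} (hk : p k ≠ 0) (hb : bar k = k) : weight p a k = 1 := by
  obtain ⟨c, -, hc2, hc⟩ := (h.mem_iff a).1 a.2
  refine h.weight_eq hk fun v => ?_
  rw [hc, h.sum_smul_block (fun l => (c l : F)), hc2 k hb, Units.val_one]

theorem weight_one {k : K} (hk : p k ≠ 0) : weight p (1 : A) k = 1 :=
  h.weight_eq hk fun v => by simp

theorem weight_mul (a b : A) (k : K) : weight p (a * b) k = weight p a k * weight p b k := by
  by_cases hk : p k = 0
  · rw [h.weight_of_eq_zero _ hk, h.weight_of_eq_zero _ hk, zero_mul]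
  · refine h.weight_eq hk fun v => ?_
    rw [Subgroup.coe_mul, LinearEquiv.mul_apply, h.apply_block, map_smul, h.apply_block, smul_smul,
      mul_comm]

theorem weight_inv (a : A) (k : K) : weight p a⁻¹ k = weight p a (bar k) := by
  by_cases hk : p k = 0
  · have hk' : p (bar k) = 0 := by
      by_contra h0
      have := h.block_bar_ne_zero h0
      rw [h.bar_bar] at this
      exact this hk
    rw [h.weight_of_eq_zero _ hk, h.weight_of_eq_zero _ hk']
  · have h1 := h.weight_mul a a⁻¹ k
    rw [mul_inv_cancel, h.weight_one hk] at h1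
    have h2 := h.weight_mul_bar a hk
    have h3 : weight p a k ≠ 0 := left_ne_zero_of_mul_eq_one h2
    exact mul_left_cancel₀ h3 (h1.symm.trans h2.symm)

theorem ext_weight {a b : A} (hab : weight p a = weight p b) : a = b := by
  refine Subtype.ext (LinearEquiv.ext fun w => ?_)
  rw [h.apply_eq, h.apply_eq, hab]

theorem mul_comm' (a b : A) : a * b = b * a :=
  h.ext_weight (funext fun k => by rw [h.weight_mul, h.weight_mul, mul_comm])

/-- Every admissible system of scalars comes from the torus. -/
theorem exists_of_scalars (c : K → Fˣ) (hc : ∀ k, c k * c (bar k) = 1)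
    (hc' : ∀ k, bar k = k → c k = 1) :
    ∃ a : A, (∀ w, (a : W ≃ₗ[F] W) w = ∑ k, (c k : F) • p k w) ∧
      ∀ k w, p k ((a : W ≃ₗ[F] W) w) = (c k : F) • p k w := by
  have key : ∀ c : K → Fˣ, (∑ k, (c k : F) • p k) ∘ₗ (∑ k, ((c k)⁻¹ : Fˣ).val • p k) =
      LinearMap.id := by
    intro c
    ext w
    simp only [LinearMap.comp_apply, LinearMap.sum_apply, LinearMap.smul_apply, LinearMap.id_apply]
    rw [← h.sum_apply w]
    refine Finset.sum_congr rfl fun k _ => ?_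
    rw [h.sum_apply, h.block_sum_smul (fun l => ((c l)⁻¹ : Fˣ).val), smul_smul, Units.mul_inv,
      one_smul]
  let a : W ≃ₗ[F] W := LinearEquiv.ofLinearMap (∑ k, (c k : F) • p k)
    (∑ k, ((c k)⁻¹ : Fˣ).val • p k) (key c) (by simpa using key fun k => (c k)⁻¹)
  have ha : ∀ w, a w = ∑ k, (c k : F) • p k w := fun w => by
    change (∑ k, (c k : F) • p k) w = _
    simp [LinearMap.sum_apply]
  refine ⟨⟨a, (h.mem_iff a).2 ⟨c, hc, hc', ha⟩⟩, ha, fun k w => ?_⟩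
  change p k (a w) = _
  rw [ha, h.block_sum_smul fun l => (c l : F)]

theorem form_apply_apply (a : A) (u v : W) :
    ω ((a : W ≃ₗ[F] W) u) ((a : W ≃ₗ[F] W) v) = ω u v := by
  have h1 : ∀ k u, ω (p k u) ((a : W ≃ₗ[F] W) v) = ω ((a⁻¹ : A) • p k u) v := by
    intro k u
    have h2 : (a⁻¹ : A) • p k u = weight p a (bar k) • p k u := by
      rw [← h.weight_inv]; exact h.apply_block a⁻¹ k u
    rw [h2, h.apply_eq, map_smul, LinearMap.smul_apply]
    conv_lhs => rw [← h.block_block, h.adj, h.block_sum_smul fun l => weight p a l, map_smul]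
    rw [← h.adj, h.block_block]
  have h3 : ∀ u, ω u ((a : W ≃ₗ[F] W) v) = ω ((a⁻¹ : A) • u) v := by
    intro u
    conv_lhs => rw [← h.sum_apply u, map_sum, LinearMap.sum_apply]
    conv_rhs => rw [← h.sum_apply u, Finset.smul_sum, map_sum, LinearMap.sum_apply]
    exact Finset.sum_congr rfl fun k _ => h1 k u
  rw [h3]
  congr 2
  exact inv_smul_smul a u

/-- The torus is conjugated to its inverse by an automorphism of `W`: one may take
`w ↦ ∑ ω(b i, w) b i` for a basis `b` adapted to the decomposition into blocks. -/
theorem exists_conj_inv [FiniteDimensional F W] :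
    ∃ S : W ≃ₗ[F] W, ∀ (a : A) w, S (a • w) = (a⁻¹ : A) • S w := by
  let b : ∀ k, Basis (Fin (finrank F (LinearMap.range (p k)))) F (LinearMap.range (p k)) := fun k =>
    finBasis F _
  let S : W →ₗ[F] W := ∑ k, ∑ i, (ω (b k i : W)).smulRight (b k i : W)
  have hpb : ∀ k i, p k (b k i : W) = (b k i : W) := fun k i => by
    obtain ⟨v, hv⟩ := (b k i).2
    rw [← hv, h.block_block]
  have hS : ∀ w, S w = ∑ k, ∑ i, ω (b k i : W) w • (b k i : W) := fun w => by
    simp [S, LinearMap.sum_apply]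
  have hSk : ∀ k w, p k (S w) = ∑ i, ω (b k i : W) w • (b k i : W) := by
    intro k w
    rw [hS, map_sum, Finset.sum_eq_single k]
    · rw [map_sum]
      exact Finset.sum_congr rfl fun i _ => by rw [map_smul, hpb]
    · intro l _ hl
      rw [map_sum]
      refine Finset.sum_eq_zero fun i _ => ?_
      rw [map_smul, ← hpb, h.block_block_of_ne hl.symm, smul_zero]
    · simp
  have hinj : Function.Injective S := by
    rw [← LinearMap.ker_eq_bot, LinearMap.ker_eq_bot']
    intro w hw
    refine h.nondeg w fun u => ?_
    rw [← h.sum_apply u, map_sum, LinearMap.sum_apply]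
    refine Finset.sum_eq_zero fun k _ => ?_
    have h1 := hSk k w
    rw [hw, map_zero] at h1
    have h2 : ∑ i, ω (b k i : W) w • b k i = 0 := Subtype.ext (by
      rw [Submodule.coe_sum]
      exact h1.symm)
    have h3 : ∀ i, ω (b k i : W) w = 0 :=
      fun i => Fintype.linearIndependent_iff.1 (b k).linearIndependent _ h2 i
    have h4 : p k u = ∑ i, (b k).repr ⟨p k u, ⟨u, rfl⟩⟩ i • (b k i : W) := by
      have := congrArg Subtype.val ((b k).sum_repr ⟨p k u, ⟨u, rfl⟩⟩)
      rw [Submodule.coe_sum] at this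
      exact this.symm
    rw [h4, map_sum, LinearMap.sum_apply]
    refine Finset.sum_eq_zero fun i _ => ?_
    rw [map_smul, LinearMap.smul_apply, h3, smul_zero]
  refine ⟨LinearEquiv.ofInjectiveEndo S hinj, fun a w => ?_⟩
  change S ((a : W ≃ₗ[F] W) w) = ((a⁻¹ : A) : W ≃ₗ[F] W) (S w)
  rw [h.apply_eq a⁻¹, ← h.sum_apply (S _)]
  refine Finset.sum_congr rfl fun k _ => ?_
  rw [hSk, hSk, Finset.smul_sum]
  refine Finset.sum_congr rfl fun i _ => ?_
  rw [smul_smul]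
  congr 1
  conv_lhs => rw [← hpb, h.adj, h.block_apply, map_smul, ← h.adj, hpb]
  rw [h.weight_inv, smul_eq_mul]

end TorusBlocks

end TorusAlgebra

/-! ### The topology of a torus -/

section TorusTopology

open Topology

variable {F : Type*} [NontriviallyNormedField F]
variable {W : Type*} [AddCommGroup W] [Module F W] [FiniteDimensional F W]
variable {ω : W →ₗ[F] W →ₗ[F] F} {A : Subgroup (W ≃ₗ[F] W)} {K : Type*} [Fintype K]
variable {bar : K → K} {p : K → End F W}

/-- By its weights the torus becomes a closed subset of a coordinate space. In particular it is
closed in `End(W)`, and hence locally compact. -/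
theorem TorusBlocks.isClosedEmbedding_weight (h : TorusBlocks ω A bar p) :
    @IsClosedEmbedding A (K → F) (TopologicalSpace.induced
      (fun a : A => ((a : W ≃ₗ[F] W) : End F W)) (moduleTopology F (End F W))) _ (weight p) := by
  let tE : TopologicalSpace (End F W) := moduleTopology F (End F W)
  let tA : TopologicalSpace A := TopologicalSpace.induced
    (fun a : A => ((a : W ≃ₗ[F] W) : End F W)) (moduleTopology F (End F W))
  have : IsModuleTopology F (End F W) := ⟨rfl⟩
  have : ContinuousAdd (End F W) := IsModuleTopology.toContinuousAdd F (End F W)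
  have hc : Continuous fun a : A => ((a : W ≃ₗ[F] W) : End F W) := continuous_induced_dom
  have hw : Continuous (weight p : A → K → F) := continuous_pi fun k =>
    (IsModuleTopology.continuous_of_linearMap (blockWeight (p k))).comp hc
  -- the element of the torus depends linearly on its weights
  let Φ : (K → F) →ₗ[F] End F W := Fintype.linearCombination F p
  have hΦ : ∀ a : A, Φ (weight p a) = ((a : W ≃ₗ[F] W) : End F W) := fun a => by
    ext w
    change _ = (a : W ≃ₗ[F] W) w
    rw [h.apply_eq, Fintype.linearCombination_apply, LinearMap.sum_apply]
    rfl
  have hΦc : Continuous Φ := IsModuleTopology.continuous_of_linearMap Φ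
  refine ⟨⟨⟨le_antisymm (continuous_iff_le_induced.1 hw) ?_⟩, fun a b hab => h.ext_weight hab⟩, ?_⟩
  · have h1 : (fun a : A => ((a : W ≃ₗ[F] W) : End F W)) = Φ ∘ weight p := funext fun a => (hΦ a).symm
    change _ ≤ TopologicalSpace.induced (fun a : A => ((a : W ≃ₗ[F] W) : End F W)) tE
    rw [h1, ← induced_compose]
    exact induced_mono (continuous_iff_le_induced.1 hΦc)
  · have h2 : Set.range (weight p : A → K → F) = ⋂ k, {c : K → F | (p k = 0 → c k = 0) ∧
        (p k ≠ 0 → c k * c (bar k) = 1) ∧ (p k ≠ 0 → bar k = k → c k = 1)} := by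
      ext c
      rw [Set.mem_iInter]
      constructor
      · rintro ⟨a, rfl⟩ k
        exact ⟨fun hk => h.weight_of_eq_zero a hk, fun hk => h.weight_mul_bar a hk,
          fun hk hb => h.weight_of_bar_eq a hk hb⟩
      · intro hc
        classical
        have hbar : ∀ k, p (bar k) = 0 ↔ p k = 0 := fun k => by
          refine ⟨fun h0 => ?_, fun h0 => ?_⟩
          · by_contra h1
            exact h.block_bar_ne_zero h1 h0
          · by_contra h1
            have := h.block_bar_ne_zero h1
            rw [h.bar_bar] at this
            exact this h0
        let c' : K → Fˣ := fun k => if hk : p k = 0 then 1 else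
          Units.mkOfMulEqOne (c k) (c (bar k)) ((hc k).2.1 hk)
        have hc' : ∀ k, p k ≠ 0 → (c' k : F) = c k := fun k hk => by simp [c', hk]
        obtain ⟨a, ha, -⟩ := h.exists_of_scalars c' (fun k => by
          by_cases hk : p k = 0
          · simp [c', hk, (hbar k).2 hk]
          · ext
            rw [Units.val_mul, hc' k hk, hc' _ (h.block_bar_ne_zero hk), (hc k).2.1 hk,
              Units.val_one]) (fun k hb => by
          by_cases hk : p k = 0
          · simp [c', hk]
          · ext
            rw [hc' k hk, (hc k).2.2 hk hb, Units.val_one])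
        refine ⟨a, funext fun k => ?_⟩
        by_cases hk : p k = 0
        · rw [h.weight_of_eq_zero a hk, (hc k).1 hk]
        · refine h.weight_eq hk fun v => ?_
          rw [ha, h.sum_smul_block (fun l => (c' l : F)), hc' k hk]
    rw [h2]
    refine isClosed_iInter fun k => ?_
    have hk : ∀ k : K, Continuous fun c : K → F => c k := fun k => continuous_apply k
    by_cases h0 : p k = 0
    · simp only [h0, forall_const, ne_eq, not_true_eq_false, IsEmpty.forall_iff, and_true]
      exact isClosed_eq (hk k) continuous_const
    · simp only [h0, IsEmpty.forall_iff, ne_eq, not_false_eq_true, forall_const, true_and]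
      refine (isClosed_eq ((hk k).mul (hk _)) continuous_const).inter ?_
      by_cases hb : bar k = k
      · simp only [hb, forall_const]
        exact isClosed_eq (hk k) continuous_const
      · simp only [hb, IsEmpty.forall_iff]
        exact isClosed_const

variable [TopologicalSpace A] (h : TorusBlocks ω A bar p)
  (hcl : IsClosedEmbedding (weight p : A → K → F))

include hcl

theorem TorusBlocks.continuous_weight (k : K) : Continuous fun a : A => weight p a k :=
  (continuous_apply k).comp hcl.continuous

include h

theorem TorusBlocks.isTopologicalGroup : IsTopologicalGroup A where
  continuous_mul := by
    rw [hcl.isInducing.continuous_iff]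
    refine continuous_pi fun k => ?_
    simp only [Function.comp, h.weight_mul]
    exact ((continuous_weight hcl k).comp continuous_fst).mul
      ((continuous_weight hcl k).comp continuous_snd)
  continuous_inv := by
    rw [hcl.isInducing.continuous_iff]
    refine continuous_pi fun k => ?_
    simp only [Function.comp, h.weight_inv]
    exact continuous_weight hcl _

theorem TorusBlocks.continuousSMul [TopologicalSpace W] [IsModuleTopology F W] :
    ContinuousSMul A W where
  continuous_smul := by
    have : ContinuousAdd W := IsModuleTopology.toContinuousAdd F W
    have : ContinuousSMul F W := IsModuleTopology.toContinuousSMul F W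
    have h1 : (fun x : A × W => x.1 • x.2) = fun x => ∑ k, weight p x.1 k • p k x.2 :=
      funext fun x => h.apply_eq x.1 x.2
    rw [h1]
    exact continuous_finsetSum _ fun k _ => ((continuous_weight hcl k).comp continuous_fst).smul
      ((IsModuleTopology.continuous_of_linearMap (p k)).comp continuous_snd)

omit h in
theorem TorusBlocks.isCompact_weight_le [LocallyCompactSpace F] (R : ℝ) :
    IsCompact {a : A | ∀ k, ‖weight p a k‖ ≤ R} := by
  have : ProperSpace F := ProperSpace.of_locallyCompactSpace F
  have h1 := hcl.isCompact_preimage (isCompact_univ_pi fun _ : K =>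
    isCompact_closedBall (0 : F) R)
  convert h1 using 1
  ext a
  simp

omit h in
theorem TorusBlocks.isOpen_weight_le [IsUltrametricDist F] :
    IsOpen {a : A | ∀ k, ‖weight p a k‖ ≤ 1} := by
  have h1 : {a : A | ∀ k, ‖weight p a k‖ ≤ 1} =
      ⋂ k, (fun a : A => weight p a k) ⁻¹' Metric.closedBall (0 : F) 1 := by
    ext a; simp
  rw [h1]
  exact isOpen_iInter_of_finite fun k =>
    (IsUltrametricDist.isOpen_closedBall 0 one_ne_zero).preimage (continuous_weight hcl k)

end TorusTopology

/-! ### Linear maps scale Haar measures -/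

section HaarScaling

open Topology ENNReal

variable {F : Type*} [NontriviallyNormedField F] [LocallyCompactSpace F]
variable {E : Type*} [AddCommGroup E] [Module F E] [FiniteDimensional F E]
variable [TopologicalSpace E] [IsModuleTopology F E] [MeasurableSpace E] [BorelSpace E]
variable (μ : Measure E) [μ.IsAddHaarMeasure]

theorem exists_map_eq_smul (T : E ≃ₗ[F] E) :
    ∃ c : ℝ≥0∞, c ≠ 0 ∧ c ≠ ∞ ∧ μ.map T = c • μ := by
  have : IsTopologicalAddGroup E := IsModuleTopology.topologicalAddGroup F E
  have : LocallyCompactSpace E := locallyCompactSpace_of_isModuleTopology F E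
  have : SecondCountableTopology E := secondCountable_of_isModuleTopology F E
  have hT : Continuous T := IsModuleTopology.continuous_of_linearMap T.toLinearMap
  have hT' : Continuous T.symm := IsModuleTopology.continuous_of_linearMap T.symm.toLinearMap
  have h1 : (μ.map T).IsAddHaarMeasure := T.toAddEquiv.isAddHaarMeasure_map μ hT hT'
  refine ⟨(Measure.addHaarScalarFactor (μ.map T) μ : ℝ≥0∞), ?_, ENNReal.coe_ne_top,
    Measure.isAddLeftInvariant_eq_smul (μ.map T) μ⟩
  exact ENNReal.coe_ne_zero.2 (Measure.addHaarScalarFactor_pos_of_isAddHaarMeasure _ _).ne'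

theorem measure_vnorm_le_lt_top (R : ℝ) : μ {v : E | vnorm F v ≤ R} < ∞ :=
  (isCompact_vnorm_le R).measure_lt_top

theorem measurableSet_vnorm_le (R : ℝ) : MeasurableSet {v : E | vnorm F v ≤ R} :=
  (isClosed_le continuous_vnorm continuous_const).measurableSet

include F in
theorem smul_injective_of_isAddHaarMeasure {c d : ℝ≥0∞} (h : c • μ = d • μ) : c = d := by
  have h1 := congrArg (fun ν : Measure E => ν {v : E | vnorm F v ≤ 1}) h
  simp only [Measure.smul_apply, smul_eq_mul] at h1
  refine (ENNReal.mul_left_inj ?_ (measure_vnorm_le_lt_top (F := F) μ 1).ne).1 h1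
  have h2 : IsOpen {v : E | vnorm F v < 1} := isOpen_lt continuous_vnorm continuous_const
  exact ((h2.measure_pos μ ⟨0, by rw [Set.mem_ofPred_eq, vnorm_zero]; exact one_pos⟩).trans_le
    (measure_mono fun v (hv : vnorm F v < 1) => hv.le)).ne'

/-- A linear automorphism that is conjugate to its inverse preserves the Haar measure. -/
theorem measurePreserving_of_conj_inv {T S : E ≃ₗ[F] E} (hTS : ∀ v, S (T v) = T.symm (S v)) :
    MeasurePreserving T μ μ := by
  have hm : ∀ T : E ≃ₗ[F] E, Measurable T := fun T => by
    have : ContinuousAdd E := IsModuleTopology.toContinuousAdd F E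
    have : Continuous T := IsModuleTopology.continuous_of_linearMap T.toLinearMap
    exact this.measurable
  obtain ⟨c, -, hc, h1⟩ := exists_map_eq_smul μ T
  obtain ⟨d, -, -, h2⟩ := exists_map_eq_smul μ T.symm
  obtain ⟨s, hs, hs', h3⟩ := exists_map_eq_smul μ S
  have h4 : (μ.map T).map S = (μ.map S).map T.symm := by
    rw [Measure.map_map (hm _) (hm _), Measure.map_map (hm _) (hm _)]
    exact congrArg (fun f => μ.map f) (funext hTS)
  rw [h1, h3, Measure.map_smul, Measure.map_smul, h2, h3, smul_smul, smul_smul] at h4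
  have h5 := smul_injective_of_isAddHaarMeasure (F := F) μ h4
  rw [mul_comm s, ENNReal.mul_left_inj hs hs'] at h5
  have h6 : (μ.map T).map T.symm = μ := by
    rw [Measure.map_map (hm _) (hm _)]
    convert Measure.map_id
    ext v
    simp
  rw [h1, Measure.map_smul, h2, ← h5, smul_smul] at h6
  have h7 := smul_injective_of_isAddHaarMeasure (F := F) μ (h6.trans (one_smul ℝ≥0∞ μ).symm)
  have h8 : c = 1 := by
    refine (ENNReal.pow_right_strictMono two_ne_zero).injective ?_
    rw [one_pow, sq, h7]
  exact ⟨hm T, by rw [h1, h8, one_smul]⟩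

/-- Proper subspaces are null sets, as they have infinitely many disjoint translates in a bounded
set. -/
theorem measure_ker_eq_zero {E' : Type*} [AddCommGroup E'] [Module F E'] {q : E →ₗ[F] E'}
    (hq : q ≠ 0) : μ {v : E | q v = 0} = 0 := by
  have : IsTopologicalAddGroup E := IsModuleTopology.topologicalAddGroup F E
  have : T2Space E := t2Space_of_isModuleTopology F E
  obtain ⟨v, hv⟩ : ∃ v, q v ≠ 0 := by
    by_contra! h
    exact hq (LinearMap.ext h)
  have hcl : MeasurableSet {v : E | q v = 0} := by
    have h0 : FiniteDimensional F (LinearMap.range q) := inferInstance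
    have h1 : {v : E | q v = 0} = (fun v => vnorm F (q.rangeRestrict v)) ⁻¹' {0} := by
      ext w
      rw [Set.mem_preimage, Set.mem_singleton_iff, vnorm_eq_zero, ← Subtype.coe_inj]
      rfl
    rw [h1]
    let : TopologicalSpace (LinearMap.range q) := moduleTopology F _
    have : IsModuleTopology F (LinearMap.range q) := ⟨rfl⟩
    have : ContinuousAdd (LinearMap.range q) := IsModuleTopology.toContinuousAdd F _
    exact (continuous_vnorm.comp (IsModuleTopology.continuous_of_linearMap
      q.rangeRestrict)).measurable (measurableSet_singleton 0)
  obtain ⟨c, hc0, hc1⟩ := NormedField.exists_norm_lt_one F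
  have hunion : {v : E | q v = 0} ⊆ ⋃ n : ℕ, {v : E | q v = 0} ∩ {v : E | vnorm F v ≤ n} := by
    intro w hw
    obtain ⟨n, hn⟩ := exists_nat_ge (vnorm F w)
    exact Set.mem_iUnion.2 ⟨n, hw, hn⟩
  refine measure_mono_null hunion (measure_iUnion_null fun n => ?_)
  by_contra hne
  -- the translates by `c ^ m • v`
  let S : ℕ → Set E := fun m => (fun w => -(c ^ m • v) + w) ⁻¹'
    ({v : E | q v = 0} ∩ {v : E | vnorm F v ≤ n})
  have hSm : ∀ m, MeasurableSet (S m) := fun m =>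
    (continuous_const.add continuous_id).measurable (hcl.inter (measurableSet_vnorm_le _))
  have hSμ : ∀ m, μ (S m) = μ ({v : E | q v = 0} ∩ {v : E | vnorm F v ≤ n}) := fun m =>
    measure_preimage_add μ _ _
  have hdisj : Pairwise (Function.onFun Disjoint S) := by
    intro i j hij
    rw [Function.onFun, Set.disjoint_left]
    intro w hi hj
    have h1 : q (-(c ^ i • v) + w) = 0 := hi.1
    have h2 : q (-(c ^ j • v) + w) = 0 := hj.1
    rw [map_add, map_neg, map_smul, neg_add_eq_zero] at h1 h2
    rw [← h2] at h1
    have h3 := smul_left_injective F hv h1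
    have h4 := congrArg norm h3
    rw [norm_pow, norm_pow] at h4
    exact hij (pow_right_injective₀ hc0 hc1.ne h4)
  have hsub : (⋃ m, S m) ⊆ {w : E | vnorm F w ≤ vnorm F v + n} := by
    refine Set.iUnion_subset fun m w hw => ?_
    have h1 : vnorm F (-(c ^ m • v) + w) ≤ n := hw.2
    have h2 : w = c ^ m • v + (-(c ^ m • v) + w) := by abel
    rw [Set.mem_ofPred_eq, h2]
    refine (vnorm_add_le _ _).trans (add_le_add ?_ h1)
    rw [vnorm_smul, norm_pow]
    exact mul_le_of_le_one_left (vnorm_nonneg _) (pow_le_one₀ (norm_nonneg _) hc1.le)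
  have h5 := (measure_mono hsub).trans_lt (measure_vnorm_le_lt_top (F := F) μ _)
  rw [measure_iUnion hdisj hSm] at h5
  simp only [hSμ] at h5
  rw [ENNReal.tsum_const_eq_top_of_ne_zero hne] at h5
  exact h5.ne rfl

end HaarScaling

/-! ### The orbit measure of a torus -/

section TorusMeasure

open Topology ENNReal

variable {F : Type*} [NontriviallyNormedField F] [LocallyCompactSpace F]
variable {W : Type*} [AddCommGroup W] [Module F W] [FiniteDimensional F W]
variable [TopologicalSpace W] [IsModuleTopology F W] [MeasurableSpace W] [BorelSpace W]
variable {ω : W →ₗ[F] W →ₗ[F] F} {A : Subgroup (W ≃ₗ[F] W)} {K : Type*} [Fintype K]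
variable {bar : K → K} {p : K → End F W}
variable [TopologicalSpace A] [MeasurableSpace A] [BorelSpace A]
variable (h : TorusBlocks ω A bar p) (hcl : IsClosedEmbedding (weight p : A → K → F))

include h in
theorem TorusBlocks.measurePreserving (dw : Measure W) [dw.IsAddHaarMeasure] (a : A) :
    MeasurePreserving (fun w : W => a • w) dw dw := by
  obtain ⟨S, hS⟩ := h.exists_conj_inv
  exact measurePreserving_of_conj_inv dw (T := (a : W ≃ₗ[F] W)) (S := S) fun w => hS a w

include hcl in
theorem TorusBlocks.secondCountableTopology : SecondCountableTopology A :=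
  have : ProperSpace F := ProperSpace.of_locallyCompactSpace F
  hcl.isInducing.secondCountableTopology

include hcl in
theorem TorusBlocks.locallyCompactSpace : LocallyCompactSpace A :=
  have : ProperSpace F := ProperSpace.of_locallyCompactSpace F
  hcl.locallyCompactSpace

include h hcl in
theorem TorusBlocks.measurableSMul₂ : MeasurableSMul₂ A W := by
  have : ContinuousSMul A W := h.continuousSMul hcl
  have := secondCountable_of_isModuleTopology F W
  have := secondCountableTopology hcl
  infer_instance

include h hcl in
/-- The torus is abelian, hence its Haar measures are bi-invariant and invariant under inversion. -/
theorem TorusBlocks.invariance (da : Measure A) [da.IsHaarMeasure] :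
    da.IsMulRightInvariant ∧ da.IsInvInvariant := by
  have := h.isTopologicalGroup hcl
  have := secondCountableTopology hcl
  have := TorusBlocks.locallyCompactSpace hcl
  let : CommGroup A := { (inferInstance : Group A) with mul_comm := h.mul_comm' }
  exact ⟨inferInstance, inferInstance⟩

include h hcl in
/-- The bounded parts of a generic orbit come from bounded parts of the torus. -/
theorem TorusBlocks.measure_orbit_lt_top (da : Measure A) [da.IsHaarMeasure] {w : W}
    (hw : ∀ k, p k ≠ 0 → p k w ≠ 0) (R : ℝ) : da {a : A | vnorm F (a • w) ≤ R} < ∞ := by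
  choose C hC hC' using fun k => exists_vnorm_apply_le (p k)
  obtain ⟨M, hM⟩ := (Set.finite_range fun k => C k * R / vnorm F (p k w)).bddAbove
  refine (measure_mono fun a ha k => ?_).trans_lt
    (isCompact_weight_le hcl (max M 0)).measure_lt_top
  by_cases hk : p k = 0
  · rw [h.weight_of_eq_zero a hk, norm_zero]
    exact le_max_right _ _
  · refine le_max_of_le_left (le_trans ?_ (hM ⟨k, rfl⟩))
    change _ ≤ C k * R / vnorm F (p k w)
    rw [le_div_iff₀ (vnorm_pos (hw k hk)), ← vnorm_smul, ← h.block_apply]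
    exact (hC' k _).trans (mul_le_mul_of_nonneg_left ha (hC k).le)

include h hcl

/-- There is a function on `W` that has integral `1` over almost every orbit of the torus. The orbits
of elements without vanishing components are closed, and so they spend a finite time in each ball. -/
theorem TorusBlocks.exists_normalized (dw : Measure W) [dw.IsAddHaarMeasure] (da : Measure A)
    [da.IsHaarMeasure] : ∃ (g : W → ℝ≥0∞) (X₀ : Set W), Measurable g ∧ MeasurableSet X₀ ∧
      (∀ (a : A) w, a • w ∈ X₀ ↔ w ∈ X₀) ∧ dw X₀ᶜ = 0 ∧
      ∀ w ∈ X₀, ∫⁻ a : A, g (a • w) ∂da = 1 := by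
  have := h.isTopologicalGroup hcl
  have := secondCountableTopology hcl
  have := TorusBlocks.locallyCompactSpace hcl
  have := h.measurableSMul₂ hcl
  have := (h.invariance hcl da).1
  have hB : ∀ n : ℕ, MeasurableSet {w : W | vnorm F w ≤ n} := fun n => measurableSet_vnorm_le _
  have hpos : ∀ w : W, ∃ n : ℕ, da {a : A | a • w ∈ {w : W | vnorm F w ≤ n}} ≠ 0 := by
    intro w
    have : ContinuousSMul A W := h.continuousSMul hcl
    obtain ⟨n, hn⟩ := exists_nat_gt (vnorm F w)
    have h1 : IsOpen {a : A | vnorm F (a • w) < n} :=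
      isOpen_lt (continuous_vnorm.comp (continuous_id.smul continuous_const)) continuous_const
    refine ⟨n, ((h1.measure_pos da ⟨1, ?_⟩).trans_le (measure_mono
      fun a (ha : vnorm F (a • w) < n) => ha.le)).ne'⟩
    rw [Set.mem_ofPred_eq, one_smul]
    exact hn
  obtain ⟨g, hg, hg1⟩ := PadicPair.exists_normalized hB hpos
  refine ⟨g, {w | ∀ n : ℕ, da {a : A | a • w ∈ {w : W | vnorm F w ≤ n}} ≠ ∞}, hg, ?_, ?_, ?_,
    fun w hw => hg1 w hw⟩
  · have h1 : {w | ∀ n : ℕ, da {a : A | a • w ∈ {w : W | vnorm F w ≤ n}} ≠ ∞} =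
        ⋂ n : ℕ, (fun w => da {a : A | a • w ∈ {w : W | vnorm F w ≤ n}}) ⁻¹' {∞}ᶜ := by
      ext w; simp
    rw [h1]
    exact MeasurableSet.iInter fun n => measurable_measure_smul_mem (hB n)
      (measurableSet_singleton _).compl
  · intro a w
    simp only [Set.mem_ofPred_eq]
    have h1 := fun n : ℕ => measure_smul_smul_mem (da := da) (hB n) a w
    simp only [Set.mem_ofPred_eq] at h1
    simp only [h1]
  · have h1 : {w | ∀ n : ℕ, da {a : A | a • w ∈ {w : W | vnorm F w ≤ n}} ≠ ∞}ᶜ ⊆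
        ⋃ k : K, {w : W | p k ≠ 0 ∧ p k w = 0} := by
      intro w hw
      by_contra hne
      apply hw
      intro n
      refine (h.measure_orbit_lt_top hcl da (fun k hk h0 => hne ?_) n).ne
      exact Set.mem_iUnion.2 ⟨k, hk, h0⟩
    refine measure_mono_null h1 (measure_iUnion_null fun k => ?_)
    by_cases hk : p k = 0
    · simp [hk]
    · refine measure_mono_null (fun w hw => hw.2) (measure_ker_eq_zero dw hk)

theorem TorusBlocks.orbitMeasure_unique (dw : Measure W) [dw.IsAddHaarMeasure] (da : Measure A)
    [da.IsHaarMeasure] (c : ℝ≥0∞) {ν₁ ν₂ : Measure (MulAction.orbitRel.Quotient A W)}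
    (h₁ : IsOrbitMeasure (c • dw) da ν₁) (h₂ : IsOrbitMeasure (c • dw) da ν₂) : ν₁ = ν₂ := by
  have := h.isTopologicalGroup hcl
  have := secondCountableTopology hcl
  have := TorusBlocks.locallyCompactSpace hcl
  have := h.measurableSMul₂ hcl
  have := (h.invariance hcl da).1
  obtain ⟨g, X₀, hg, hX, hXi, hX0, hg1⟩ := h.exists_normalized hcl dw da
  exact IsOrbitMeasure.unique hg hX hXi (by rw [Measure.smul_apply, hX0, smul_zero]) hg1
    (NeZero.ne da) h₁ h₂

theorem TorusBlocks.existsUnique_orbitMeasure (dw : Measure W) [dw.IsAddHaarMeasure]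
    (da : Measure A) [da.IsHaarMeasure] :
    ∃! ν : Measure (MulAction.orbitRel.Quotient A W), IsOrbitMeasure dw da ν := by
  have := h.isTopologicalGroup hcl
  have := secondCountableTopology hcl
  have := TorusBlocks.locallyCompactSpace hcl
  have := h.measurableSMul₂ hcl
  have := (h.invariance hcl da).1
  have := (h.invariance hcl da).2
  have := secondCountable_of_isModuleTopology F W
  have := locallyCompactSpace_of_isModuleTopology F W
  obtain ⟨g, X₀, hg, hX, hXi, hX0, hg1⟩ := h.exists_normalized hcl dw da
  obtain ⟨ν, hν⟩ := IsOrbitMeasure.exists (h.measurePreserving dw) hg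
    (measure_mono_null (fun w hw hX => hw (hg1 w hX)) hX0)
  refine ⟨ν, hν, fun ν' hν' => ?_⟩
  rw [← one_smul ℝ≥0∞ dw] at hν hν'
  exact h.orbitMeasure_unique hcl dw da 1 hν' hν

end TorusMeasure

/-! ### Bounds for bilinear maps -/

section Bounds

variable {F : Type*} [NontriviallyNormedField F]
variable {E : Type*} [AddCommGroup E] [Module F E] [FiniteDimensional F E]
variable {E' : Type*} [AddCommGroup E'] [Module F E'] [FiniteDimensional F E']
variable {E'' : Type*} [AddCommGroup E''] [Module F E''] [FiniteDimensional F E'']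

/-- Bilinear maps are bounded. -/
theorem exists_vnorm_apply₂_le (f : E →ₗ[F] E' →ₗ[F] E'') :
    ∃ C : ℝ, 0 < C ∧ ∀ u v, vnorm F (f u v) ≤ C * vnorm F u * vnorm F v := by
  choose C hC hC' using fun i => exists_vnorm_apply_le (f (finBasis F E i))
  refine ⟨∑ i, C i + 1, by
    have : 0 ≤ ∑ i, C i := Finset.sum_nonneg fun i _ => (hC i).le
    linarith, fun u v => ?_⟩
  have h0 := vnorm_nonneg (F := F) v
  conv_lhs => rw [← (finBasis F E).sum_equivFun u, map_sum, LinearMap.sum_apply]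
  refine (vnorm_sum_le _ _).trans ?_
  rw [add_mul, add_mul, Finset.sum_mul, Finset.sum_mul, one_mul]
  refine (Finset.sum_le_sum fun i _ => ?_).trans
    (le_add_of_nonneg_right (mul_nonneg (vnorm_nonneg u) h0))
  rw [map_smul, LinearMap.smul_apply, vnorm_smul]
  calc _ ≤ vnorm F u * (C i * vnorm F v) :=
        mul_le_mul (norm_repr_le u i) (hC' i v) (vnorm_nonneg _) (vnorm_nonneg _)
    _ = _ := by ring

/-- Injective linear maps are bounded below. -/
theorem exists_vnorm_le_of_injective {f : E →ₗ[F] E'} (hf : Function.Injective f) :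
    ∃ C : ℝ, 0 < C ∧ ∀ v, vnorm F v ≤ C * vnorm F (f v) := by
  obtain ⟨g, hg⟩ := f.exists_leftInverse_of_injective (LinearMap.ker_eq_bot.2 hf)
  obtain ⟨C, hC, hC'⟩ := exists_vnorm_apply_le g
  refine ⟨C, hC, fun v => ?_⟩
  conv_lhs => rw [← LinearMap.id_apply (R := F) v, ← hg]
  exact hC' (f v)

/-- Two quantities with a bounded product become bounded when they are scaled by the norms of
suitable inverse scalars. -/
theorem exists_balance (F : Type*) [NontriviallyNormedField F] (M : ℝ) (hM : 0 ≤ M) :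
    ∃ R : ℝ, 1 ≤ R ∧ M ≤ R ∧ ∀ P Q : ℝ, 0 ≤ P → 0 ≤ Q → P * Q ≤ M →
      ∃ t : Fˣ, ‖(t : F)‖ * P ≤ R ∧ ‖((t⁻¹ : Fˣ) : F)‖ * Q ≤ R := by
  obtain ⟨c, hc⟩ := NormedField.exists_one_lt_norm F
  refine ⟨‖c‖ + M, by linarith, by linarith, fun P Q hP hQ hPQ => ?_⟩
  have hc0 : c ≠ 0 := norm_pos_iff.1 (by linarith)
  rcases hP.eq_or_lt with rfl | hP
  · obtain ⟨t, ht⟩ := NormedField.exists_lt_norm F Q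
    have ht0 : t ≠ 0 := norm_pos_iff.1 (by linarith)
    refine ⟨Units.mk0 t ht0, by rw [mul_zero]; linarith, ?_⟩
    rw [Units.val_inv_eq_inv_val, Units.val_mk0, norm_inv, inv_mul_eq_div]
    have : Q / ‖t‖ ≤ 1 := (div_le_one (by linarith)).2 ht.le
    linarith
  · obtain ⟨n, hn1, hn2⟩ := exists_mem_Ico_zpow hP hc
    refine ⟨(Units.mk0 c hc0 ^ n)⁻¹, ?_, ?_⟩
    · rw [Units.val_inv_eq_inv_val, Units.val_zpow_eq_zpow_val, Units.val_mk0, norm_inv, norm_zpow,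
        inv_mul_eq_div]
      rw [zpow_add_one₀ (by linarith)] at hn2
      have : P / ‖c‖ ^ n ≤ ‖c‖ := (div_le_iff₀' (zpow_pos (by linarith) n)).2 hn2.le
      linarith
    · rw [inv_inv, Units.val_zpow_eq_zpow_val, Units.val_mk0, norm_zpow]
      have := mul_le_mul_of_nonneg_right hn1 hQ
      linarith

end Bounds

/-! ### The moment map and reduction theory -/

section MomentMap

variable {F : Type*} [NontriviallyNormedField F]
variable {W : Type*} [AddCommGroup W] [Module F W]

/-- The moment map `w ↦ (x ↦ ⟨x w, w⟩ / 4)`. -/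
def moment (ω : W →ₗ[F] W →ₗ[F] F) (𝔞 : Submodule F (End F W)) (w : W) : Dual F 𝔞 where
  toFun x := 4⁻¹ * ω ((x : End F W) w) w
  map_add' x y := by simp [mul_add]
  map_smul' c x := by simp; ring

theorem moment_apply (ω : W →ₗ[F] W →ₗ[F] F) (𝔞 : Submodule F (End F W)) (w : W) (x : 𝔞) :
    moment ω 𝔞 w x = 4⁻¹ * ω ((x : End F W) w) w := rfl

theorem moment_smul (ω : W →ₗ[F] W →ₗ[F] F) (𝔞 : Submodule F (End F W)) (c : F) (w : W) :
    moment ω 𝔞 (c • w) = (c * c) • moment ω 𝔞 w := by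
  ext x
  simp [moment_apply]
  ring

variable {ω : W →ₗ[F] W →ₗ[F] F} {A : Subgroup (W ≃ₗ[F] W)} {K : Type*} [Fintype K]
variable {bar : K → K} {p : K → End F W} (h : TorusBlocks ω A bar p)
include h

theorem TorusBlocks.moment_smul_eq (a : A) (w : W) :
    moment ω (spCentralizer ω A) (a • w) = moment ω (spCentralizer ω A) w := by
  ext x
  have h1 : (x : End F W) (a • w) = a • (x : End F W) w := x.2.2 a a.2 w
  rw [moment_apply, moment_apply, h1]
  congr 1
  exact h.form_apply_apply a _ _

/-- The element `w ↦ ω(u, w) v + ω(v, w) u` of `sp(W)`, for `u` and `v` in dual blocks, commutes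
with the torus. -/
theorem TorusBlocks.symm_mem (k : K) (u v : W) :
    (ω (p (bar k) u)).smulRight (p k v) + (ω (p k v)).smulRight (p (bar k) u) ∈
      spCentralizer ω A := by
  refine ⟨fun x y => ?_, fun a ha w => ?_⟩
  · simp only [LinearMap.add_apply, LinearMap.smulRight_apply, map_add, map_smul,
      LinearMap.smul_apply, smul_eq_mul]
    rw [h.skew x (p k v), h.skew x (p (bar k) u)]
    ring
  · have h1 : ∀ l z, ω (p l z) (a w) = weight p (⟨a, ha⟩ : A) (bar l) * ω (p l z) w := by
      intro l z
      conv_lhs => rw [← h.block_block, h.adj, h.block_apply ⟨a, ha⟩, map_smul, ← h.adj,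
        h.block_block, smul_eq_mul]
    have h2 : ∀ l z, a (p l z) = weight p (⟨a, ha⟩ : A) l • p l z := h.apply_block ⟨a, ha⟩
    simp only [LinearMap.add_apply, LinearMap.smulRight_apply, map_add, map_smul, h1, h2, h.bar_bar,
      smul_smul]
    rw [mul_comm _ (ω (p (bar k) u) w), mul_comm _ (ω (p k v) w)]

theorem TorusBlocks.injective_flip : Function.Injective ω.flip := by
  rw [← LinearMap.ker_eq_bot, LinearMap.ker_eq_bot']
  intro w hw
  exact h.nondeg w fun u => LinearMap.congr_fun hw u

variable [FiniteDimensional F W]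

theorem TorusBlocks.exists_vnorm_le_of_pairing : ∃ C : ℝ, 0 < C ∧ ∀ (v : W) (M : ℝ), 0 ≤ M →
    (∀ u, vnorm F u ≤ 1 → ‖ω u v‖ ≤ M) → vnorm F v ≤ C * M := by
  obtain ⟨C, hC, hC'⟩ := exists_vnorm_le_of_injective h.injective_flip
  obtain ⟨C₁, hC₁, hC₁'⟩ := exists_vnorm_dual_le F W 1 one_pos
  refine ⟨C * C₁, by positivity, fun v M hM hv => (hC' v).trans ?_⟩
  rw [mul_assoc]
  exact mul_le_mul_of_nonneg_left (hC₁' _ M hM hv) hC.le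

variable [CharZero F]

/-- The product of the norms of the components of `w` in dual blocks is bounded by the norm of the
moment map, whose values at the elements of `symm_mem` are `ω(u, w) ω(v, w) / 2`. -/
theorem TorusBlocks.exists_mul_le : ∃ C : ℝ, 0 < C ∧ ∀ (k : K) (w : W),
    vnorm F (p k w) * vnorm F (p (bar k) w) ≤ C * vnorm F (moment ω (spCentralizer ω A) w) := by
  obtain ⟨C, hC, hC'⟩ := h.exists_vnorm_le_of_pairing
  obtain ⟨C₁, hC₁, hC₁'⟩ := exists_norm_dual_apply_le F (spCentralizer ω A)
  have hbil : ∀ k, ∃ C : ℝ, 0 < C ∧ ∀ u v : W, vnorm F u ≤ 1 → vnorm F v ≤ 1 →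
      vnorm F (⟨_, h.symm_mem k u v⟩ : spCentralizer ω A) ≤ C := by
    intro k
    let f : W →ₗ[F] W →ₗ[F] spCentralizer ω A :=
      LinearMap.mk₂ F (fun u v => ⟨_, h.symm_mem k u v⟩)
        (fun a b c => by ext w; simp [add_smul]; abel)
        (fun r a b => by ext w; simp [smul_smul, mul_comm])
        (fun a b c => by ext w; simp [add_smul]; abel)
        (fun r a b => by ext w; simp [smul_smul, mul_comm])
    obtain ⟨C, hC, hC'⟩ := exists_vnorm_apply₂_le f
    refine ⟨C, hC, fun u v hu hv => (hC' u v).trans ?_⟩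
    have h1 := mul_le_mul hu hv (vnorm_nonneg v) zero_le_one
    rw [mul_assoc]
    nlinarith
  choose C₂ hC₂ hC₂' using hbil
  refine ⟨∑ k, C * (C * (‖(2 : F)‖ * (C₁ * C₂ k))) + 1, ?_, fun k w => ?_⟩
  · have : 0 ≤ ∑ k, C * (C * (‖(2 : F)‖ * (C₁ * C₂ k))) := Finset.sum_nonneg fun k _ => by
      have := hC₂ k
      positivity
    linarith
  set T := vnorm F (moment ω (spCentralizer ω A) w)
  have hT : 0 ≤ T := vnorm_nonneg _
  set R := ‖(2 : F)‖ * (C₁ * T * C₂ k) with hR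
  have hR0 : 0 ≤ R := by have := hC₂ k; positivity
  have h1 : ∀ u v : W, vnorm F u ≤ 1 → vnorm F v ≤ 1 →
      ‖ω (p (bar k) u) w‖ * ‖ω (p k v) w‖ ≤ R := by
    intro u v hu hv
    have h2 : ω (p (bar k) u) w * ω (p k v) w = 2 * moment ω (spCentralizer ω A) w
        ⟨_, h.symm_mem k u v⟩ := by
      rw [moment_apply]
      simp only [LinearMap.add_apply, LinearMap.smulRight_apply, map_add, map_smul,
        LinearMap.smul_apply, smul_eq_mul]
      ring
    rw [← norm_mul, h2, norm_mul]
    refine mul_le_mul_of_nonneg_left ((hC₁' _ _).trans ?_) (norm_nonneg _)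
    exact mul_le_mul_of_nonneg_left (hC₂' k u v hu hv) (by positivity)
  have h3 : ∀ v : W, vnorm F v ≤ 1 → vnorm F (p k w) * ‖ω v (p (bar k) w)‖ ≤ C * R := by
    intro v hv
    rw [← h.adj]
    rcases (norm_nonneg (ω (p k v) w)).eq_or_lt with h0 | h0
    · rw [← h0, mul_zero]; positivity
    · rw [← le_div_iff₀ h0, mul_div_assoc]
      refine hC' _ _ (div_nonneg hR0 h0.le) fun u hu => ?_
      rw [le_div_iff₀ h0]
      have h4 := h.adj (bar k) u w
      rw [h.bar_bar] at h4
      rw [← h4]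
      exact h1 u v hu hv
  have h5 : vnorm F (p k w) * vnorm F (p (bar k) w) ≤ C * (C * R) := by
    rcases (vnorm_nonneg (F := F) (p k w)).eq_or_lt with h0 | h0
    · rw [← h0, zero_mul]; positivity
    · rw [← le_div_iff₀' h0, mul_div_assoc]
      refine hC' _ _ (by positivity) fun v hv => ?_
      rw [le_div_iff₀' h0]
      exact h3 v hv
  refine h5.trans ?_
  rw [add_mul, one_mul]
  refine le_add_of_le_of_nonneg ?_ hT
  rw [Finset.sum_mul]
  refine le_trans (le_of_eq ?_) (Finset.single_le_sum (f := fun k =>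
    C * (C * (‖(2 : F)‖ * (C₁ * C₂ k))) * T) (fun k _ => by
      have := hC₂ k
      positivity) (Finset.mem_univ k))
  rw [hR]
  ring

/-- Reduction theory: on the set where the moment map is bounded, every orbit of the torus has a
bounded representative. -/
theorem TorusBlocks.exists_bounded_representative (R : ℝ) : ∃ R' : ℝ, ∀ w : W,
    vnorm F (moment ω (spCentralizer ω A) w) ≤ R →
      ∃ a : A, ∀ k, vnorm F (p k (a • w)) ≤ R' := by
  obtain ⟨C, hC, hC'⟩ := h.exists_mul_le
  obtain ⟨R', h1, hM, hbal⟩ := exists_balance F (C * max R 0) (by positivity)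
  refine ⟨R', fun w hw => ?_⟩
  have hprod : ∀ k, vnorm F (p k w) * vnorm F (p (bar k) w) ≤ C * max R 0 := fun k =>
    (hC' k w).trans (mul_le_mul_of_nonneg_left (hw.trans (le_max_left _ _)) hC.le)
  choose t ht ht' using fun k =>
    hbal (vnorm F (p k w)) (vnorm F (p (bar k) w)) (vnorm_nonneg _) (vnorm_nonneg _) (hprod k)
  -- an ordering of the blocks selects one block from each pair of dual blocks
  let e := Fintype.equivFin K
  let c : K → Fˣ := fun k => if e k < e (bar k) then t k else
    if e (bar k) < e k then (t (bar k))⁻¹ else 1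
  obtain ⟨a, -, ha⟩ := h.exists_of_scalars c (fun k => by
    simp only [c, h.bar_bar]
    rcases lt_trichotomy (e k) (e (bar k)) with hlt | heq | hlt
    · simp [hlt, hlt.asymm]
    · simp [heq]
    · simp [hlt, hlt.asymm]) (fun k hk => by simp [c, hk])
  refine ⟨a, fun k => ?_⟩
  have h2 : p k (a • w) = (c k : F) • p k w := ha k w
  rw [h2, vnorm_smul]
  rcases lt_trichotomy (e k) (e (bar k)) with hlt | heq | hlt
  · simp only [c, hlt, if_true]
    exact ht k
  · have hk : bar k = k := (e.injective heq).symm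
    simp only [c, hk, lt_irrefl, if_false, Units.val_one, norm_one, one_mul]
    have h3 := hprod k
    rw [hk] at h3
    have h0 := vnorm_nonneg (F := F) (p k w)
    by_contra! h4
    nlinarith
  · simp only [c, hlt, hlt.asymm, if_true, if_false]
    have := ht' (bar k)
    rwa [h.bar_bar] at this

theorem TorusBlocks.vnorm_le_of_block_le {w : W} {R : ℝ} (hw : ∀ k, vnorm F (p k w) ≤ R) :
    vnorm F w ≤ Fintype.card K * R := by
  conv_lhs => rw [← h.sum_apply w]
  refine (vnorm_sum_le _ _).trans ((Finset.sum_le_sum fun k _ => hw k).trans ?_)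
  simp

end MomentMap

/-! ### Sets of bounded moment have finite measure -/

section Finiteness

open Topology ENNReal

variable {F : Type*} [NontriviallyNormedField F] [LocallyCompactSpace F] [CharZero F]
variable [IsUltrametricDist F]
variable {W : Type*} [AddCommGroup W] [Module F W] [FiniteDimensional F W]
variable [TopologicalSpace W] [IsModuleTopology F W] [MeasurableSpace W] [BorelSpace W]
variable {ω : W →ₗ[F] W →ₗ[F] F} {A : Subgroup (W ≃ₗ[F] W)} {K : Type*} [Fintype K]
variable {bar : K → K} {p : K → End F W}
variable [TopologicalSpace A] [MeasurableSpace A] [BorelSpace A]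
variable (h : TorusBlocks ω A bar p) (hcl : IsClosedEmbedding (weight p : A → K → F))

include h hcl

/-- The set of orbits on which the moment map is bounded has finite measure. -/
theorem TorusBlocks.measure_moment_le_lt_top (dw : Measure W) [dw.IsAddHaarMeasure]
    (da : Measure A) [da.IsHaarMeasure] {ν : Measure (MulAction.orbitRel.Quotient A W)}
    (hν : IsOrbitMeasure dw da ν) (R : ℝ) :
    ν {q | vnorm F (moment ω (spCentralizer ω A) (Quotient.out q : W)) ≤ R} < ∞ := by
  have := h.isTopologicalGroup hcl
  have := secondCountableTopology hcl
  have := TorusBlocks.locallyCompactSpace hcl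
  have := h.measurableSMul₂ hcl
  have := (h.invariance hcl da).1
  obtain ⟨R', hR'⟩ := h.exists_bounded_representative R
  let B : Set W := ⋂ k, {w : W | vnorm F (p k w) ≤ R'}
  have hBm : ∀ w, w ∈ B ↔ ∀ k, vnorm F (p k w) ≤ R' := fun w => Set.mem_iInter
  have hpc : ∀ k, Continuous (p k) := fun k =>
    have : ContinuousAdd W := IsModuleTopology.toContinuousAdd F W
    IsModuleTopology.continuous_of_linearMap (p k)
  have hB : MeasurableSet B := MeasurableSet.iInter fun k =>
    (isClosed_le (continuous_vnorm.comp (hpc k)) continuous_const).measurableSet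
  have hBf : dw B < ∞ := (measure_mono fun w hw =>
    h.vnorm_le_of_block_le ((hBm w).1 hw)).trans_lt (measure_vnorm_le_lt_top (F := F) dw _)
  have hK0 : da {a : A | ∀ k, ‖weight p a k‖ ≤ 1} ≠ 0 :=
    ((isOpen_weight_le hcl).measure_pos da ⟨1, fun k => by
      by_cases hk : p k = 0
      · rw [h.weight_of_eq_zero _ hk, norm_zero]; exact zero_le_one
      · rw [h.weight_one hk, norm_one]⟩).ne'
  refine hν.measure_lt_top (S := {w : W | vnorm F (moment ω (spCentralizer ω A) w) ≤ R}) hB hBf hK0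
    fun w hw => ?_
  obtain ⟨a₀, ha₀⟩ := hR' w hw
  rw [← measure_preimage_mul_right da a₀⁻¹]
  refine measure_mono fun a ha => (hBm _).2 fun k => ?_
  have h1 : a • w = (a * a₀⁻¹) • a₀ • w := by rw [smul_smul, inv_mul_cancel_right]
  have h2 : p k ((a * a₀⁻¹) • a₀ • w) = weight p (a * a₀⁻¹) k • p k (a₀ • w) :=
    h.block_apply _ _ _
  rw [h1, h2, vnorm_smul]
  exact (mul_le_of_le_one_left (vnorm_nonneg _) (ha k)).trans (ha₀ k)

end Finiteness

/-! ### The cone over the image of the moment map is closed -/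

section Closedness

open Topology

variable {F : Type*} [NontriviallyNormedField F] [LocallyCompactSpace F] [CharZero F]
variable {W : Type*} [AddCommGroup W] [Module F W] [FiniteDimensional F W]

theorem continuous_moment [TopologicalSpace W] [IsModuleTopology F W]
    (ω : W →ₗ[F] W →ₗ[F] F) (𝔞 : Submodule F (End F W))
    [TopologicalSpace (Dual F 𝔞)] [IsModuleTopology F (Dual F 𝔞)] :
    Continuous (moment ω 𝔞) := by
  let f : W →ₗ[F] W →ₗ[F] Dual F 𝔞 := LinearMap.mk₂ F
    (fun u v => (4⁻¹ : F) • (ω.flip v ∘ₗ LinearMap.applyₗ u ∘ₗ 𝔞.subtype))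
    (fun a b c => by ext x; simp [mul_add]) (fun r a b => by ext x; simp; ring)
    (fun a b c => by ext x; simp [mul_add]) (fun r a b => by ext x; simp; ring)
  have : ContinuousAdd (Dual F 𝔞) := IsModuleTopology.toContinuousAdd F _
  have : ContinuousAdd W := IsModuleTopology.toContinuousAdd F _
  have h1 := IsModuleTopology.continuous_bilinear_of_finite_left f
  exact h1.comp (continuous_id.prodMk continuous_id)

variable {ω : W →ₗ[F] W →ₗ[F] F} {A : Subgroup (W ≃ₗ[F] W)} {K : Type*} [Fintype K]
variable {bar : K → K} {p : K → End F W} (h : TorusBlocks ω A bar p)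
include h

/-- The cone over the image of the moment map is closed. Scaling `w` moves the factor `t` to a
compact set, and then reduction theory moves `w` to a compact set. -/
theorem TorusBlocks.exists_moment_eq {ξ : Dual F (spCentralizer ω A)}
    (hξ : ∀ ε : ℝ, 0 < ε → ∃ (t : F) (w : W), t ≠ 0 ∧
      vnorm F (t • moment ω (spCentralizer ω A) w - ξ) < ε) :
    ∃ (t : F) (w : W), ξ = t • moment ω (spCentralizer ω A) w := by
  have : ProperSpace F := ProperSpace.of_locallyCompactSpace F
  let tW : TopologicalSpace W := moduleTopology F W
  have : IsModuleTopology F W := ⟨rfl⟩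
  let tD : TopologicalSpace (Dual F (spCentralizer ω A)) := moduleTopology F _
  have : IsModuleTopology F (Dual F (spCentralizer ω A)) := ⟨rfl⟩
  have := t2Space_of_isModuleTopology F (Dual F (spCentralizer ω A))
  obtain ⟨c, hc⟩ := NormedField.exists_one_lt_norm F
  have hc0 : c ≠ 0 := norm_pos_iff.1 (by linarith)
  have hcc : 1 < ‖c * c‖ := by rw [norm_mul]; nlinarith
  obtain ⟨R', hR'⟩ := h.exists_bounded_representative (vnorm F ξ + 1)
  let S : Set (F × W) :=
    Metric.closedBall (0 : F) ‖c * c‖ ×ˢ {w : W | vnorm F w ≤ Fintype.card K * R'}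
  let f : F × W → Dual F (spCentralizer ω A) := fun x => x.1 • moment ω (spCentralizer ω A) x.2
  have hf : Continuous f := continuous_fst.smul ((continuous_moment ω _).comp continuous_snd)
  have hS : IsCompact (f '' S) :=
    ((isCompact_closedBall _ _).prod (isCompact_vnorm_le _)).image hf
  have hmem : ξ ∈ f '' S := by
    rw [← hS.isClosed.closure_eq, mem_closure_iff_nhds_basis (nhds_basis_vnorm (F := F) ξ)]
    intro ε hε
    obtain ⟨t, w, ht0, htw⟩ := hξ (min ε 1) (lt_min hε one_pos)
    -- write `t` as a square times an element `r` of norm between `1` and `‖c‖ ^ 2`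
    obtain ⟨n, hn1, hn2⟩ := exists_mem_Ico_zpow (norm_pos_iff.2 ht0) hcc
    set r := t * ((c * c) ^ n)⁻¹ with hr
    have hcn : (c * c) ^ n ≠ 0 := zpow_ne_zero _ (mul_ne_zero hc0 hc0)
    have hrn : ‖r‖ = ‖t‖ / ‖c * c‖ ^ n := by rw [hr, norm_mul, norm_inv, norm_zpow, div_eq_mul_inv]
    have hpos : 0 < ‖c * c‖ ^ n := zpow_pos (by linarith) n
    have hr1 : 1 ≤ ‖r‖ := by rw [hrn, one_le_div hpos]; exact hn1
    have hr2 : ‖r‖ ≤ ‖c * c‖ := by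
      rw [hrn, div_le_iff₀ hpos, ← zpow_one_add₀ (by linarith), add_comm]
      exact hn2.le
    have hrt : t • moment ω (spCentralizer ω A) w =
        r • moment ω (spCentralizer ω A) (c ^ n • w) := by
      rw [moment_smul, smul_smul, hr, ← mul_zpow, inv_mul_cancel_right₀ hcn]
    have h1 : vnorm F (moment ω (spCentralizer ω A) (c ^ n • w)) ≤ vnorm F ξ + 1 := by
      have h2 : vnorm F (t • moment ω (spCentralizer ω A) w) ≤ vnorm F ξ + 1 := by
        have h3 := vnorm_add_le (F := F) (t • moment ω (spCentralizer ω A) w - ξ) ξ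
        rw [sub_add_cancel] at h3
        have h4 := htw.le.trans (min_le_right _ _)
        linarith
      rw [hrt, vnorm_smul] at h2
      exact (le_mul_of_one_le_left (vnorm_nonneg _) hr1).trans h2
    obtain ⟨a, ha⟩ := hR' _ h1
    refine ⟨f (r, a • c ^ n • w), ⟨(r, a • c ^ n • w), ⟨?_, h.vnorm_le_of_block_le ha⟩, rfl⟩, ?_⟩
    · simpa using hr2
    · rw [Set.mem_ofPred_eq]
      change vnorm F (r • moment ω (spCentralizer ω A) (a • c ^ n • w) - ξ) < ε
      rw [h.moment_smul_eq, ← hrt]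
      exact htw.trans_le (min_le_left _ _)
  obtain ⟨⟨t, w⟩, -, htw⟩ := hmem
  exact ⟨t, w, htw.symm⟩

end Closedness

/-! ### Fourier transforms of test functions -/

section Fourier

open Topology

variable {F : Type*} [NontriviallyNormedField F] [IsUltrametricDist F]
variable (χ : UnramifiedChar F)

theorem UnramifiedChar.val_add (a b : F) : χ.val (a + b) = χ.val a * χ.val b := by
  rw [val, AddChar.map_add_eq_mul, Circle.coe_mul]
  rfl

theorem UnramifiedChar.norm_val (a : F) : ‖χ.val a‖ = 1 := Circle.norm_coe _

theorem UnramifiedChar.val_eq_one_iff (a : F) : χ.val a = 1 ↔ ‖a‖ ≤ 1 := by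
  rw [← χ.ker_iff, val, ← Circle.coe_one, Circle.coe_inj]

theorem UnramifiedChar.continuous_val : Continuous χ.val := χ.isLocallyConstant.continuous

variable {E : Type*} [AddCommGroup E] [Module F E] [FiniteDimensional F E]
variable [TopologicalSpace E] [IsModuleTopology F E]

theorem SchwartzBruhat.isLocallyConstant (ψ : SchwartzBruhat F E) : IsLocallyConstant ψ.1 := by
  have h := ψ.2.1
  rwa [← eq_moduleTopology F E] at h

theorem SchwartzBruhat.hasCompactSupport (ψ : SchwartzBruhat F E) : HasCompactSupport ψ.1 := by
  have h := ψ.2.2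
  rwa [← eq_moduleTopology F E] at h

/-- A Schwartz-Bruhat function is invariant under a lattice. -/
theorem SchwartzBruhat.exists_invariant (ψ : SchwartzBruhat F E) :
    ∃ r : ℝ, 0 < r ∧ ∀ x l, vnorm F l ≤ r → ψ.1 (x + l) = ψ.1 x := by
  have : T2Space E := t2Space_of_isModuleTopology F E
  let U : ℕ → Set E := fun n => {x | ∀ l, vnorm F l ≤ 1 / ((n : ℝ) + 1) → ψ.1 (x + l) = ψ.1 x}
  have hpos : ∀ n : ℕ, 0 < 1 / ((n : ℝ) + 1) := fun n => Nat.one_div_pos_of_nat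
  have hUo : ∀ n, IsOpen (U n) := by
    intro n
    rw [isOpen_iff_mem_nhds]
    intro x hx
    filter_upwards [(nhds_basis_vnorm (F := F) x).mem_of_mem (hpos n)] with y hy l hl
    have hy' : vnorm F (y - x) ≤ 1 / ((n : ℝ) + 1) := le_of_lt hy
    have h1 : y = x + (y - x) := by abel
    have h2 : y + l = x + ((y - x) + l) := by abel
    rw [h2, hx _ (vnorm_add_le_of_le hy' hl)]
    conv_rhs => rw [h1, hx _ hy']
  have hUd : Directed (· ⊆ ·) U := by
    refine (monotone_nat_of_le_succ fun n x hx l hl => hx l (hl.trans ?_)).directed_le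
    exact Nat.one_div_le_one_div n.le_succ
  have hcov : tsupport ψ.1 ⊆ ⋃ n, U n := by
    intro x _
    have h1 := (IsLocallyConstant.iff_eventually_eq ψ.1).1 (SchwartzBruhat.isLocallyConstant ψ) x
    obtain ⟨ε, hε, h2⟩ := (nhds_basis_vnorm (F := F) x).mem_iff.1 h1
    obtain ⟨n, hn⟩ := exists_nat_one_div_lt hε
    refine Set.mem_iUnion.2 ⟨n, fun l hl => h2 ?_⟩
    rw [Set.mem_ofPred_eq, add_sub_cancel_left]
    exact hl.trans_lt hn
  obtain ⟨n, hn⟩ := (SchwartzBruhat.hasCompactSupport ψ).isCompact.elim_directed_cover U hUo hcov hUd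
  refine ⟨_, hpos n, fun x l hl => ?_⟩
  by_cases h1 : x ∈ tsupport ψ.1
  · exact hn h1 l hl
  by_cases h2 : x + l ∈ tsupport ψ.1
  · have := hn h2 (-l) (by rwa [vnorm_neg])
    rw [add_neg_cancel_right] at this
    exact this.symm
  · rw [image_eq_zero_of_notMem_tsupport h1, image_eq_zero_of_notMem_tsupport h2]

variable [MeasurableSpace E] (dx : Measure E)

/-- The Fourier transform of `ψ`, as a function on the dual space. -/
def fourierInt (ψ : E → ℂ) (ξ : Dual F E) : ℂ := ∫ x, ψ x * χ.val (ξ x) ∂dx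

theorem fourierInt_modulate (φ : SchwartzBruhat F E) (η ξ : Dual F E) :
    fourierInt χ dx (modulate χ φ η).1 ξ = fourierInt χ dx φ.1 (ξ - η) := by
  refine integral_congr_ae (Filter.Eventually.of_forall fun x => ?_)
  change φ.1 x * χ.val (-(η x)) * χ.val (ξ x) = φ.1 x * χ.val ((ξ - η) x)
  rw [mul_assoc, ← χ.val_add, LinearMap.sub_apply, neg_add_eq_sub]

theorem norm_fourierInt_le (ψ : E → ℂ) (ξ : Dual F E) :
    ‖fourierInt χ dx ψ ξ‖ ≤ ∫ x, ‖ψ x‖ ∂dx := by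
  refine (norm_integral_le_integral_norm _).trans (le_of_eq ?_)
  simp only [norm_mul, χ.norm_val, mul_one]

variable [BorelSpace E]

theorem integrable_mul_char [dx.IsAddHaarMeasure] (ψ : SchwartzBruhat F E) (ξ : Dual F E) :
    Integrable (fun x => ψ.1 x * χ.val (ξ x)) dx := by
  have h1 : Continuous fun x => ψ.1 x * χ.val (ξ x) := (SchwartzBruhat.isLocallyConstant ψ).continuous.mul
    (χ.continuous_val.comp (IsModuleTopology.continuous_of_linearMap ξ))
  exact h1.integrable_of_hasCompactSupport (SchwartzBruhat.hasCompactSupport ψ).mul_right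

/-- The Fourier transform of a Schwartz-Bruhat function has bounded support. -/
theorem exists_vnorm_le_of_fourierInt_ne_zero [dx.IsAddHaarMeasure] (ψ : SchwartzBruhat F E) :
    ∃ R : ℝ, ∀ ξ : Dual F E, fourierInt χ dx ψ.1 ξ ≠ 0 → vnorm F ξ ≤ R := by
  have : IsTopologicalAddGroup E := IsModuleTopology.topologicalAddGroup F E
  obtain ⟨r, hr, hψ⟩ := SchwartzBruhat.exists_invariant ψ
  obtain ⟨C, hC, hC'⟩ := exists_vnorm_dual_le F E r hr
  refine ⟨C * 1, fun ξ hξ => hC' ξ 1 zero_le_one fun l hl => ?_⟩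
  have h1 : fourierInt χ dx ψ.1 ξ * χ.val (ξ l) = fourierInt χ dx ψ.1 ξ := by
    conv_rhs => rw [fourierInt, ← integral_add_right_eq_self _ l]
    rw [fourierInt, ← integral_mul_const]
    refine integral_congr_ae (Filter.Eventually.of_forall fun x => ?_)
    simp only [hψ x l hl, map_add, χ.val_add, mul_assoc]
  exact (χ.val_eq_one_iff _).1 (mul_left_cancel₀ hξ (h1.trans (mul_one _).symm))

end Fourier

/-! ### Convergence of the integral -/

section Chc

open Topology ENNReal

variable {F : Type*} [NontriviallyNormedField F] [LocallyCompactSpace F] [CharZero F]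
variable [IsUltrametricDist F] (χ : UnramifiedChar F)
variable {W : Type*} [AddCommGroup W] [Module F W] [FiniteDimensional F W]
variable [TopologicalSpace W] [IsModuleTopology F W] [MeasurableSpace W] [BorelSpace W]
variable {ω : W →ₗ[F] W →ₗ[F] F} {A : Subgroup (W ≃ₗ[F] W)} {K : Type*} [Fintype K]
variable {bar : K → K} {p : K → End F W}

section General

variable (ω) (𝔞 : Submodule F (End F W))
variable [TopologicalSpace 𝔞] [IsModuleTopology F 𝔞] [MeasurableSpace 𝔞] [BorelSpace 𝔞]
variable (dx : Measure 𝔞)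

theorem gaussianIntegral_eq (ψ : 𝔞 → ℂ) (w : W) :
    gaussianIntegral χ ω 𝔞 dx ψ w = fourierInt χ dx ψ (moment ω 𝔞 w) := rfl

theorem measurable_gaussianIntegral [dx.IsAddHaarMeasure] (ψ : SchwartzBruhat F 𝔞) :
    Measurable (gaussianIntegral χ ω 𝔞 dx ψ.1) := by
  have := secondCountable_of_isModuleTopology F 𝔞
  have := secondCountable_of_isModuleTopology F W
  have := locallyCompactSpace_of_isModuleTopology F 𝔞
  let tD : TopologicalSpace (Dual F 𝔞) := moduleTopology F _
  have : IsModuleTopology F (Dual F 𝔞) := ⟨rfl⟩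
  have h1 : Continuous fun x : W × 𝔞 => moment ω 𝔞 x.1 x.2 :=
    (IsModuleTopology.continuous_bilinear_of_finite_left
      (LinearMap.id : Dual F 𝔞 →ₗ[F] 𝔞 →ₗ[F] F)).comp
      (((continuous_moment ω 𝔞).comp continuous_fst).prodMk continuous_snd)
  have h2 : Continuous fun x : W × 𝔞 => ψ.1 x.2 * χ.val (moment ω 𝔞 x.1 x.2) :=
    ((SchwartzBruhat.isLocallyConstant ψ).continuous.comp continuous_snd).mul (χ.continuous_val.comp h1)
  exact (h2.stronglyMeasurable.integral_prod_right (ν := dx)).measurable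

end General

variable [TopologicalSpace A] [MeasurableSpace A] [BorelSpace A]
variable (h : TorusBlocks ω A bar p) (hcl : IsClosedEmbedding (weight p : A → K → F))
variable [TopologicalSpace (spCentralizer ω A)] [IsModuleTopology F (spCentralizer ω A)]
variable [MeasurableSpace (spCentralizer ω A)] [BorelSpace (spCentralizer ω A)]
variable (dx : Measure (spCentralizer ω A)) [dx.IsAddHaarMeasure]

include h

theorem TorusBlocks.gaussianIntegral_smul (ψ : spCentralizer ω A → ℂ) (a : A) (w : W) :
    gaussianIntegral χ ω (spCentralizer ω A) dx ψ (a • w) =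
      gaussianIntegral χ ω (spCentralizer ω A) dx ψ w := by
  rw [gaussianIntegral_eq, gaussianIntegral_eq, h.moment_smul_eq]

include hcl

/-- The inner integral is a bounded function of `w`, and it vanishes unless the moment of `w` lies in
the bounded support of the Fourier transform of `ψ`. -/
theorem TorusBlocks.integrable_gaussianIntegral (dw : Measure W) [dw.IsAddHaarMeasure]
    (da : Measure A) [da.IsHaarMeasure] {ν : Measure (MulAction.orbitRel.Quotient A W)}
    (hν : IsOrbitMeasure dw da ν) (ψ : SchwartzBruhat F (spCentralizer ω A)) :
    Integrable (fun q : MulAction.orbitRel.Quotient A W =>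
      gaussianIntegral χ ω (spCentralizer ω A) dx ψ.1 (Quotient.out q)) ν := by
  have := h.measurableSMul₂ hcl
  obtain ⟨R, hR⟩ := exists_vnorm_le_of_fourierInt_ne_zero χ dx ψ
  let tD : TopologicalSpace (Dual F (spCentralizer ω A)) := moduleTopology F _
  have : IsModuleTopology F (Dual F (spCentralizer ω A)) := ⟨rfl⟩
  have hm : Measurable fun q : MulAction.orbitRel.Quotient A W =>
      vnorm F (moment ω (spCentralizer ω A) (Quotient.out q)) :=
    measurable_comp_out (H := fun w => vnorm F (moment ω (spCentralizer ω A) w))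
      (continuous_vnorm.comp (continuous_moment ω _)).measurable
      fun a w => by rw [h.moment_smul_eq]
  let S : Set (MulAction.orbitRel.Quotient A W) :=
    {q | vnorm F (moment ω (spCentralizer ω A) (Quotient.out q : W)) ≤ R}
  have hS : MeasurableSet S := hm measurableSet_Iic
  have hSf : ν S < ∞ := h.measure_moment_le_lt_top hcl dw da hν R
  have h1 : Integrable (S.indicator fun _ => ∫ x, ‖ψ.1 x‖ ∂dx) ν :=
    (integrable_indicator_iff hS).2 (integrableOn_const hSf.ne)
  have hG1 : Measurable (gaussianIntegral χ ω (spCentralizer ω A) dx ψ.1) :=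
    measurable_gaussianIntegral χ ω (spCentralizer ω A) dx ψ
  have hG2 : ∀ (a : A) (w : W), gaussianIntegral χ ω (spCentralizer ω A) dx ψ.1 (a • w) =
      gaussianIntegral χ ω (spCentralizer ω A) dx ψ.1 w :=
    fun a w => h.gaussianIntegral_smul χ dx ψ.1 a w
  have h2 : Measurable fun q : MulAction.orbitRel.Quotient A W =>
      gaussianIntegral χ ω (spCentralizer ω A) dx ψ.1 (Quotient.out q) :=
    measurable_comp_out hG1 hG2
  refine h1.mono' h2.aestronglyMeasurable (Filter.Eventually.of_forall fun q => ?_)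
  by_cases hq : q ∈ S
  · rw [Set.indicator_of_mem hq, gaussianIntegral_eq]
    exact norm_fourierInt_le χ dx ψ.1 (moment ω (spCentralizer ω A) (Quotient.out q))
  · rw [Set.indicator_of_notMem hq, gaussianIntegral_eq]
    by_contra hne
    exact hq (hR _ fun h0 => hne (by rw [h0, norm_zero]))

theorem TorusBlocks.exists_chc (dw : Measure W) [dw.IsAddHaarMeasure]
    (da : Measure A) [da.IsHaarMeasure] {ν : Measure (MulAction.orbitRel.Quotient A W)}
    (hν : IsOrbitMeasure dw da ν) :
    ∃ chc : Distribution F (spCentralizer ω A), IsChc χ ω A (spCentralizer ω A) dx ν chc := by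
  have hi := h.integrable_gaussianIntegral χ hcl dx dw da hν
  refine ⟨{ toFun := fun ψ => ∫ q : MulAction.orbitRel.Quotient A W,
              gaussianIntegral χ ω (spCentralizer ω A) dx ψ.1 (Quotient.out q) ∂ν
            map_add' := fun ψ φ => ?_
            map_smul' := fun c ψ => ?_ }, fun ψ => ⟨hi ψ, rfl⟩⟩
  · rw [← integral_add (hi ψ) (hi φ)]
    refine integral_congr_ae (Filter.Eventually.of_forall fun q => ?_)
    have := integral_add (integrable_mul_char χ dx ψ (moment ω _ (Quotient.out q)))
      (integrable_mul_char χ dx φ (moment ω _ (Quotient.out q)))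
    simp only [gaussianIntegral_eq, fourierInt]
    rw [← this]
    refine integral_congr_ae (Filter.Eventually.of_forall fun x => ?_)
    exact add_mul _ _ _
  · rw [RingHom.id_apply, smul_eq_mul, ← integral_const_mul]
    refine integral_congr_ae (Filter.Eventually.of_forall fun q => ?_)
    simp only [gaussianIntegral_eq, fourierInt]
    rw [← integral_const_mul]
    refine integral_congr_ae (Filter.Eventually.of_forall fun x => ?_)
    exact mul_assoc _ _ _

end Chc

/-! ### Covectors in wave front sets -/

section WaveFront

open Topology

variable {F : Type*} [NontriviallyNormedField F] [IsUltrametricDist F]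
variable (χ : UnramifiedChar F)
variable {E : Type*} [AddCommGroup E] [Module F E] [FiniteDimensional F E]

/-- At a point `(x, ξ)` of the wave front set of `u`, the Fourier transform of `φ u` is non-zero at
arbitrarily large multiples of vectors close to `ξ`. -/
theorem exists_of_mem_waveFrontSet {Λ : Subgroup Fˣ} {u : Distribution F E} {x : E} {ξ : Dual F E}
    (hx : (x, ξ) ∈ waveFrontSet χ Λ u) {φ : SchwartzBruhat F E} (hφ : φ.1 x ≠ 0) {ε : ℝ}
    (hε : 0 < ε) (R : ℝ) :
    ∃ (t : F) (η : Dual F E), t ≠ 0 ∧ R < ‖t‖ ∧ vnorm F (η - ξ) < ε ∧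
      fourierCutoff χ u φ (t • η) ≠ 0 := by
  let tD : TopologicalSpace (Dual F E) := moduleTopology F _
  have : IsModuleTopology F (Dual F E) := ⟨rfl⟩
  have : ContinuousSMul F (Dual F E) := IsModuleTopology.toContinuousSMul F _
  have : IsTopologicalAddGroup (Dual F E) := IsModuleTopology.topologicalAddGroup F _
  have hξ : ξ ≠ 0 := hx.1
  have hξ' : 0 < vnorm F ξ := vnorm_pos hξ
  set δ := min ε (vnorm F ξ) with hδ
  have hδ0 : 0 < δ := lt_min hε hξ'
  let C : Set (Dual F E) := {v | ∃ t : F, t ≠ 0 ∧ vnorm F (t⁻¹ • v - ξ) < δ}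
  have hCo : IsOpen C := by
    have : C = ⋃ t : {t : F // t ≠ 0}, (fun v => vnorm F ((t : F)⁻¹ • v - ξ)) ⁻¹' Set.Iio δ := by
      ext v
      simp [C]
    rw [this]
    refine isOpen_iUnion fun t => isOpen_Iio.preimage (continuous_vnorm.comp ?_)
    exact (continuous_const_smul _).sub continuous_const
  -- `C` consists of the multiples of the vectors close to `ξ`; it is a cone for all of `Fˣ`
  have hC : IsOpenCone Λ C := by
    refine ⟨hCo, ?_, ?_⟩
    · rintro ⟨t, -, ht⟩
      rw [smul_zero, zero_sub, vnorm_neg] at ht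
      exact absurd (ht.trans_le (min_le_right _ _)) (lt_irrefl _)
    · rintro c - v ⟨t, ht, hv⟩
      refine ⟨(c : F) * t, mul_ne_zero c.ne_zero ht, ?_⟩
      rwa [mul_inv_rev, smul_smul, mul_assoc, inv_mul_cancel₀ c.ne_zero, mul_one]
  have hξC : ξ ∈ C := ⟨1, one_ne_zero, by rwa [inv_one, one_smul, sub_self, vnorm_zero]⟩
  have h1 := (hx.2 φ hφ).2 C hC hξC
  obtain ⟨v, ⟨hvC, hvS⟩, hvR⟩ : ∃ v ∈ C ∩ closure {ξ | fourierCutoff χ u φ ξ ≠ 0},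
      R * vnorm F ξ < vnorm F v := by
    by_contra! h2
    exact h1 (isBddSet_of_vnorm_le h2)
  have hO : IsOpen (C ∩ vnorm F ⁻¹' Set.Ioi (R * vnorm F ξ)) :=
    hCo.inter (isOpen_Ioi.preimage continuous_vnorm)
  obtain ⟨η, ⟨⟨t, ht, hη⟩, hηR⟩, hηS⟩ := mem_closure_iff.1 hvS _ hO ⟨hvC, hvR⟩
  refine ⟨t, t⁻¹ • η, ht, ?_, hη.trans_le (min_le_left _ _), by rwa [smul_inv_smul₀ ht]⟩
  have h3 : vnorm F (t⁻¹ • η) ≤ vnorm F ξ := by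
    have := vnorm_add_le_of_le (hη.le.trans (min_le_right _ _)) (le_refl (vnorm F ξ))
    rwa [sub_add_cancel] at this
  have h4 : vnorm F η = ‖t‖ * vnorm F (t⁻¹ • η) := by rw [← vnorm_smul, smul_inv_smul₀ ht]
  have h5 : R * vnorm F ξ < ‖t‖ * vnorm F ξ := lt_of_lt_of_le hηR
    (h4.trans_le (mul_le_mul_of_nonneg_left h3 (norm_nonneg _)))
  exact lt_of_mul_lt_mul_right h5 hξ'.le

/-- The indicator function of a ball. -/
def ballIndicator [LocallyCompactSpace F] (x : E) {r : ℝ} (hr : 0 < r) : SchwartzBruhat F E :=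
  ⟨Set.indicator {y | vnorm F (y - x) ≤ r} 1, by
    let tE : TopologicalSpace E := moduleTopology F E
    have : IsModuleTopology F E := ⟨rfl⟩
    have : IsTopologicalAddGroup E := IsModuleTopology.topologicalAddGroup F _
    have : T2Space E := t2Space_of_isModuleTopology F E
    have hc : IsCompact {y : E | vnorm F (y - x) ≤ r} := by
      have h1 := (isCompact_vnorm_le (F := F) (E := E) r).image (continuous_id.add_const x)
      convert h1 using 1
      ext y
      refine ⟨fun hy => ⟨y - x, hy, sub_add_cancel y x⟩, ?_⟩
      rintro ⟨z, hz, rfl⟩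
      change vnorm F (z + x - x) ≤ r
      rwa [add_sub_cancel_right]
    refine ⟨?_, HasCompactSupport.intro hc fun y hy => Set.indicator_of_notMem hy _⟩
    have hcl : IsClopen {y : E | vnorm F (y - x) ≤ r} := ⟨hc.isClosed, isOpen_vnorm_le x hr⟩
    rw [← LocallyConstant.coe_charFn ℂ hcl]
    exact (LocallyConstant.charFn ℂ hcl).isLocallyConstant⟩

theorem ballIndicator_of_le [LocallyCompactSpace F] {x y : E} {r : ℝ} (hr : 0 < r)
    (h : vnorm F (y - x) ≤ r) : (ballIndicator (F := F) x hr).1 y = 1 :=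
  Set.indicator_of_mem (s := {y | vnorm F (y - x) ≤ r}) h _

theorem ballIndicator_of_not_le [LocallyCompactSpace F] {x y : E} {r : ℝ} (hr : 0 < r)
    (h : ¬ vnorm F (y - x) ≤ r) : (ballIndicator (F := F) x hr).1 y = 0 :=
  Set.indicator_of_notMem (s := {y | vnorm F (y - x) ≤ r}) h _

theorem ballIndicator_self_ne_zero [LocallyCompactSpace F] (x : E) {r : ℝ} (hr : 0 < r) :
    (ballIndicator (F := F) x hr).1 x ≠ 0 := by
  rw [ballIndicator_of_le hr (by rw [sub_self, vnorm_zero]; exact hr.le)]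
  exact one_ne_zero

end WaveFront

/-! ### The wave front set and the moment map -/

section Moment

open Topology

variable {F : Type*} [NontriviallyNormedField F] [LocallyCompactSpace F] [CharZero F]
variable [IsUltrametricDist F] {χ : UnramifiedChar F}
variable {W : Type*} [AddCommGroup W] [Module F W] [FiniteDimensional F W]
variable [TopologicalSpace W] [IsModuleTopology F W] [MeasurableSpace W] [BorelSpace W]
variable {ω : W →ₗ[F] W →ₗ[F] F} {A : Subgroup (W ≃ₗ[F] W)} {K : Type*} [Fintype K]
variable {bar : K → K} {p : K → End F W}
variable (h : TorusBlocks ω A bar p)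
variable [TopologicalSpace (spCentralizer ω A)] [IsModuleTopology F (spCentralizer ω A)]
variable [MeasurableSpace (spCentralizer ω A)] [BorelSpace (spCentralizer ω A)]
variable {dx : Measure (spCentralizer ω A)} [dx.IsAddHaarMeasure]
variable {ν : Measure (MulAction.orbitRel.Quotient A W)}
variable {chc : Distribution F (spCentralizer ω A)}

include h in
/-- The wave front set of `chc` lies over the cone generated by the image of the moment map: the
Fourier transform of `φ chc` is supported near that image. -/
theorem TorusBlocks.exists_moment_eq_of_mem_waveFrontSet
    (hchc : IsChc χ ω A (spCentralizer ω A) dx ν chc) {Λ : Subgroup Fˣ} {x : spCentralizer ω A}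
    {ξ : Dual F (spCentralizer ω A)} (hx : (x, ξ) ∈ waveFrontSet χ Λ chc) :
    ∃ (t : F) (w : W), ξ = t • moment ω (spCentralizer ω A) w := by
  refine h.exists_moment_eq fun ε hε => ?_
  let φ : SchwartzBruhat F (spCentralizer ω A) := ballIndicator x one_pos
  have hφ : φ.1 x ≠ 0 := ballIndicator_self_ne_zero x one_pos
  obtain ⟨R, hR⟩ := exists_vnorm_le_of_fourierInt_ne_zero χ dx φ
  obtain ⟨t, η, ht, htR, hη, hne⟩ := exists_of_mem_waveFrontSet χ hx hφ hε (R / ε)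
  obtain ⟨w, hw⟩ : ∃ w : W, fourierInt χ dx φ.1 (moment ω (spCentralizer ω A) w - t • η) ≠ 0 := by
    by_contra! h0
    refine hne ?_
    rw [fourierCutoff, (hchc _).2]
    refine integral_eq_zero_of_ae (Filter.Eventually.of_forall fun q => ?_)
    change gaussianIntegral χ ω _ dx _ _ = 0
    rw [gaussianIntegral_eq, fourierInt_modulate, h0]
  refine ⟨t⁻¹, w, inv_ne_zero ht, ?_⟩
  have h1 : vnorm F (t⁻¹ • (moment ω (spCentralizer ω A) w - t • η)) < ε := by
    rw [vnorm_smul, norm_inv, inv_mul_lt_iff₀ (norm_pos_iff.2 ht)]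
    exact (hR _ hw).trans_lt ((div_lt_iff₀ hε).1 htR)
  rw [smul_sub, inv_smul_smul₀ ht] at h1
  have h2 : t⁻¹ • moment ω (spCentralizer ω A) w - ξ =
      (t⁻¹ • moment ω (spCentralizer ω A) w - η) + (η - ξ) := by abel
  rw [h2]
  refine (vnorm_add_le_of_le (r := max _ _) (le_max_left _ _) (le_max_right _ _)).trans_lt ?_
  exact max_lt h1 hη

end Moment

/-! ### The action of the commutant of a torus -/

section Conjugation

variable {F : Type*} [NontriviallyNormedField F] {W : Type*} [AddCommGroup W] [Module F W]
variable {ω : W →ₗ[F] W →ₗ[F] F} {A : Subgroup (W ≃ₗ[F] W)} {Y Ys : End F W}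

/-- For `Y` in the commutant of `A`, with `ω`-adjoint `Ys`, the derivative `x ↦ Ys x + x Y` of the
action `x ↦ k^* x k` preserves the centralizer of `A` in `sp(W)`. -/
theorem mul_add_mul_mem_spCentralizer (hadj : ∀ u v, ω (Y u) v = ω u (Ys v))
    (hadj' : ∀ u v, ω (Ys u) v = ω u (Y v)) (hY : ∀ a ∈ A, ∀ w, Y (a w) = a (Y w))
    (hYs : ∀ a ∈ A, ∀ w, Ys (a w) = a (Ys w)) {x : End F W} (hx : x ∈ spCentralizer ω A) :
    Ys * x + x * Y ∈ spCentralizer ω A := by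
  refine ⟨fun u v => ?_, fun a ha w => ?_⟩
  · simp only [LinearMap.add_apply, Module.End.mul_apply, map_add]
    rw [hadj', ← hadj]
    linear_combination hx.1 u (Y v) + hx.1 (Y u) v
  · simp only [LinearMap.add_apply, Module.End.mul_apply, map_add]
    rw [hx.2 a ha, hYs a ha, hY a ha, hx.2 a ha]

theorem mul_mul_mem_spCentralizer (hadj : ∀ u v, ω (Y u) v = ω u (Ys v))
    (hadj' : ∀ u v, ω (Ys u) v = ω u (Y v)) (hY : ∀ a ∈ A, ∀ w, Y (a w) = a (Y w))
    (hYs : ∀ a ∈ A, ∀ w, Ys (a w) = a (Ys w)) {x : End F W} (hx : x ∈ spCentralizer ω A) :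
    Ys * (x * Y) ∈ spCentralizer ω A := by
  refine ⟨fun u v => ?_, fun a ha w => ?_⟩
  · simp only [Module.End.mul_apply]
    rw [hadj', ← hadj]
    exact hx.1 (Y u) (Y v)
  · simp only [Module.End.mul_apply]
    rw [hY a ha, hx.2 a ha, hYs a ha]

end Conjugation

/-! ### Linear maps close to the identity -/

section SmallPerturbation

variable {F : Type*} [NontriviallyNormedField F] [IsUltrametricDist F]
variable {E : Type*} [AddCommGroup E] [Module F E] [FiniteDimensional F E]
variable {N : End F E} {C : ℝ} {s : F}

theorem vnorm_le_vnorm_add_smul (hN : ∀ y, vnorm F (N y) ≤ C * vnorm F y) (hs : ‖s‖ * C < 1)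
    (y : E) : vnorm F y ≤ vnorm F (y + s • N y) := by
  by_contra! h1
  have h2 : vnorm F (s • N y) < vnorm F y := by
    have h3 : 0 < vnorm F y := (vnorm_nonneg _).trans_lt h1
    rw [vnorm_smul]
    calc ‖s‖ * vnorm F (N y) ≤ ‖s‖ * (C * vnorm F y) :=
          mul_le_mul_of_nonneg_left (hN y) (norm_nonneg s)
      _ = (‖s‖ * C) * vnorm F y := (mul_assoc _ _ _).symm
      _ < vnorm F y := mul_lt_of_lt_one_left h3 hs
  have h5 := vnorm_sub_le_of_le (F := F) (r := max (vnorm F (y + s • N y)) (vnorm F (s • N y)))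
    (le_max_left _ _) (le_max_right _ _)
  rw [add_sub_cancel_right] at h5
  exact absurd h5 (not_le.2 (max_lt h1 h2))

theorem injective_one_add_smul (hN : ∀ y, vnorm F (N y) ≤ C * vnorm F y) (hs : ‖s‖ * C < 1) :
    Function.Injective (1 + s • N : End F E) := by
  rw [← LinearMap.ker_eq_bot, LinearMap.ker_eq_bot']
  intro y hy
  have h1 := vnorm_le_vnorm_add_smul hN hs y
  rw [show y + s • N y = 0 from hy, vnorm_zero] at h1
  exact vnorm_eq_zero.1 (le_antisymm h1 (vnorm_nonneg _))

/-- A linear transformation close to the identity preserves balls. -/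
theorem vnorm_add_smul_sub_le_iff (hN : ∀ y, vnorm F (N y) ≤ C * vnorm F y) (hC : 0 ≤ C)
    (hs : ‖s‖ * C < 1) {x : E} {r B : ℝ} (hB : vnorm F x + r ≤ B) (hsB : ‖s‖ * (C * B) ≤ r)
    (y : E) : vnorm F (y + s • N y - x) ≤ r ↔ vnorm F (y - x) ≤ r := by
  have h1 : ∀ z, vnorm F (z - x) ≤ r → vnorm F z ≤ B := fun z hz => by
    have := vnorm_add_le (F := F) (z - x) x
    rw [sub_add_cancel] at this
    linarith
  have h2 : vnorm F y ≤ B → vnorm F (s • N y) ≤ r := fun hy => by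
    rw [vnorm_smul]
    exact (mul_le_mul_of_nonneg_left ((hN y).trans (mul_le_mul_of_nonneg_left hy hC))
      (norm_nonneg s)).trans hsB
  have h3 : y + s • N y - x = (y - x) + s • N y := by abel
  refine ⟨fun hy => ?_, fun hy => ?_⟩
  · have h4 : y - x = (y + s • N y - x) - s • N y := by abel
    rw [h4]
    exact vnorm_sub_le_of_le hy (h2 ((vnorm_le_vnorm_add_smul hN hs y).trans (h1 _ hy)))
  · rw [h3]
    exact vnorm_add_le_of_le hy (h2 (h1 y hy))

variable [LocallyCompactSpace F] (χ : UnramifiedChar F)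

/-- The product of the indicator function of a small ball around `x` and the character
`χ(-t η)` is an eigenvector of the transformation `y ↦ y + s D y + s ^ 2 Q y` if `t` is large and
`s` is so small that `t s η (D x)` stays bounded. -/
theorem modulate_ballIndicator_apply {D Q : End F E} (hDC : ∀ y, vnorm F (D y) ≤ C * vnorm F y)
    (hQC : ∀ y, vnorm F (Q y) ≤ C * vnorm F y) (hC : 0 ≤ C) (hs : ‖s‖ * C < 1) (hs1 : ‖s‖ ≤ 1)
    {x : E} {r B : ℝ} (hr : 0 < r) (hB : vnorm F x + r ≤ B) (hsB : ‖s‖ * (C * B) ≤ r)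
    {η : Dual F E} {H : ℝ} (hH : 0 ≤ H) (hη : ∀ y, ‖η y‖ ≤ H * vnorm F y) {t c : F}
    (hc : t * s * η (D x) = c) (h1 : ‖t * s‖ * (H * (C * r)) ≤ 1)
    (h2 : ‖s‖ * (‖t * s‖ * (H * (C * B))) ≤ 1) (y : E) :
    (modulate χ (ballIndicator x hr) (t • η)).1 (y + s • (D + s • Q) y) =
      χ.val (-c) * (modulate χ (ballIndicator x hr) (t • η)).1 y := by
  have hN : ∀ y, vnorm F ((D + s • Q) y) ≤ C * vnorm F y := by
    intro y
    refine vnorm_add_le_of_le (hDC y) ?_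
    change vnorm F (s • Q y) ≤ _
    rw [vnorm_smul]
    exact (mul_le_of_le_one_left (vnorm_nonneg _) hs1).trans (hQC y)
  have hball := vnorm_add_smul_sub_le_iff hN hC hs hB hsB y
  change (ballIndicator x hr).1 (y + s • (D + s • Q) y) *
      χ.val (-((t • η) (y + s • (D + s • Q) y))) =
    χ.val (-c) * ((ballIndicator x hr).1 y * χ.val (-((t • η) y)))
  by_cases hy : vnorm F (y - x) ≤ r
  · have hyB : vnorm F y ≤ B := by
      have := vnorm_add_le (F := F) (y - x) x
      rw [sub_add_cancel] at this
      linarith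
    rw [ballIndicator_of_le hr hy, ballIndicator_of_le hr (hball.2 hy), one_mul, one_mul]
    have h3 : -((t • η) (y + s • (D + s • Q) y)) =
        -(t * s * (η (D (y - x)) + s * η (Q y))) + (-c + -((t • η) y)) := by
      simp only [LinearMap.smul_apply, LinearMap.add_apply, map_add, map_sub, map_smul, smul_eq_mul]
      linear_combination -hc
    rw [h3, χ.val_add, χ.val_add, (χ.val_eq_one_iff _).2, one_mul]
    rw [norm_neg, norm_mul]
    have hts := norm_nonneg (t * s)
    have h4 : ‖t * s‖ * ‖η (D (y - x))‖ ≤ 1 := by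
      refine (mul_le_mul_of_nonneg_left ((hη _).trans ?_) hts).trans h1
      exact mul_le_mul_of_nonneg_left ((hDC _).trans (mul_le_mul_of_nonneg_left hy hC)) hH
    have h5 : ‖t * s‖ * ‖s * η (Q y)‖ ≤ 1 := by
      rw [norm_mul s, mul_left_comm]
      refine (mul_le_mul_of_nonneg_left ?_ (norm_nonneg s)).trans h2
      refine mul_le_mul_of_nonneg_left ((hη _).trans ?_) hts
      exact mul_le_mul_of_nonneg_left ((hQC _).trans (mul_le_mul_of_nonneg_left hyB hC)) hH
    refine (mul_le_mul_of_nonneg_left (IsUltrametricDist.norm_add_le_max _ _) hts).trans ?_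
    rw [mul_max_of_nonneg _ _ hts]
    exact max_le h4 h5
  · rw [ballIndicator_of_not_le hr hy, ballIndicator_of_not_le hr (mt hball.1 hy), zero_mul,
      zero_mul, mul_zero]

end SmallPerturbation

/-! ### The wave front set and the commutant of the torus -/

section Invariance

open Topology ENNReal

variable {F : Type*} [NontriviallyNormedField F] [LocallyCompactSpace F] [CharZero F]
variable [IsUltrametricDist F] {χ : UnramifiedChar F}
variable {W : Type*} [AddCommGroup W] [Module F W] [FiniteDimensional F W]
variable [TopologicalSpace W] [IsModuleTopology F W] [MeasurableSpace W] [BorelSpace W]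
variable {ω : W →ₗ[F] W →ₗ[F] F} {A : Subgroup (W ≃ₗ[F] W)} {K : Type*} [Fintype K]
variable {bar : K → K} {p : K → End F W}
variable [TopologicalSpace A] [MeasurableSpace A] [BorelSpace A]
variable (h : TorusBlocks ω A bar p) (hcl : IsClosedEmbedding (weight p : A → K → F))
variable [TopologicalSpace (spCentralizer ω A)] [IsModuleTopology F (spCentralizer ω A)]
variable [MeasurableSpace (spCentralizer ω A)] [BorelSpace (spCentralizer ω A)]
variable {dx : Measure (spCentralizer ω A)} [dx.IsAddHaarMeasure]
variable {dw : Measure W} [dw.IsAddHaarMeasure] {da : Measure A} [da.IsHaarMeasure]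
variable {ν : Measure (MulAction.orbitRel.Quotient A W)}
variable {chc : Distribution F (spCentralizer ω A)}

include h hcl

/-- An element `k` of the commutant of `A` in `GL(W)` scales `chc` by a positive factor under
`x ↦ k^* x k`. Hence `chc` kills every eigenvector of this transformation with an eigenvalue
`μ ≠ 1` of absolute value one. -/
theorem TorusBlocks.chc_eq_zero_of_eigenvector (hν : IsOrbitMeasure dw da ν)
    (hchc : IsChc χ ω A (spCentralizer ω A) dx ν chc) (k : W ≃ₗ[F] W)
    (hk : ∀ a ∈ A, ∀ w, k (a w) = a (k w)) (M : spCentralizer ω A ≃ₗ[F] spCentralizer ω A)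
    (hM : ∀ x w, moment ω (spCentralizer ω A) (k w) x = moment ω (spCentralizer ω A) w (M x))
    (ψ : SchwartzBruhat F (spCentralizer ω A)) {μ : ℂ} (hμ : ‖μ‖ = 1) (hμ1 : μ ≠ 1)
    (hψ : ∀ x, ψ.1 (M x) = μ * ψ.1 x) : chc ψ = 0 := by
  have := h.isTopologicalGroup hcl
  have := TorusBlocks.secondCountableTopology hcl
  have := TorusBlocks.locallyCompactSpace hcl
  have := h.measurableSMul₂ hcl
  have := (h.invariance hcl da).1
  have := (h.invariance hcl da).2
  have := secondCountable_of_isModuleTopology F W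
  have := locallyCompactSpace_of_isModuleTopology F W
  have : IsTopologicalAddGroup W := IsModuleTopology.topologicalAddGroup F W
  have : IsTopologicalAddGroup (spCentralizer ω A) := IsModuleTopology.topologicalAddGroup F _
  obtain ⟨c, hc0, hct, hc⟩ := exists_map_eq_smul dx M
  obtain ⟨c', hc0', hct', hc'⟩ := exists_map_eq_smul dw k
  have hkc : Continuous k := IsModuleTopology.continuous_of_linearMap k.toLinearMap
  have hMc : Continuous M := IsModuleTopology.continuous_of_linearMap M.toLinearMap
  have hMc' : Continuous M.symm := IsModuleTopology.continuous_of_linearMap M.symm.toLinearMap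
  have hMe : MeasurableEmbedding M :=
    (Homeomorph.mk M.toEquiv hMc hMc').measurableEmbedding
  have hG : ∀ w, μ * gaussianIntegral χ ω (spCentralizer ω A) dx ψ.1 (k w) =
      c.toReal • gaussianIntegral χ ω (spCentralizer ω A) dx ψ.1 w := by
    intro w
    rw [gaussianIntegral_eq, gaussianIntegral_eq, fourierInt, fourierInt, ← integral_smul_measure,
      ← hc, hMe.integral_map, ← integral_const_mul]
    refine integral_congr_ae (Filter.Eventually.of_forall fun x => ?_)
    simp only
    rw [hψ, hM, mul_assoc]
  have h1 : μ * ∫ q : MulAction.orbitRel.Quotient A W,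
      gaussianIntegral χ ω (spCentralizer ω A) dx ψ.1 (k (Quotient.out q)) ∂ν =
        c.toReal • chc ψ := by
    rw [(hchc ψ).2, ← integral_const_mul, ← integral_smul]
    exact integral_congr_ae (Filter.Eventually.of_forall fun q => hG _)
  have hGm : Measurable (gaussianIntegral χ ω (spCentralizer ω A) dx ψ.1) :=
    measurable_gaussianIntegral χ ω (spCentralizer ω A) dx ψ
  have hGi : ∀ (a : A) (w : W), gaussianIntegral χ ω (spCentralizer ω A) dx ψ.1 (a • w) =
      gaussianIntegral χ ω (spCentralizer ω A) dx ψ.1 w :=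
    fun a w => h.gaussianIntegral_smul χ dx ψ.1 a w
  have h2 := hν.integral_comp (fun _ _ c _ => h.orbitMeasure_unique hcl dw da c) hkc.measurable
    (fun a w => hk a a.2 w) hct' hc' hGm hGi
  rw [h2, ← (hchc ψ).2] at h1
  by_contra hne
  have h3 : μ * c'.toReal = c.toReal := by
    simp only [Complex.real_smul, ← mul_assoc] at h1
    exact mul_right_cancel₀ hne h1
  have h4 : c'.toReal = c.toReal := by
    have := congrArg norm h3
    rwa [norm_mul, hμ, one_mul, Complex.norm_real, Complex.norm_real, Real.norm_of_nonneg
      ENNReal.toReal_nonneg, Real.norm_of_nonneg ENNReal.toReal_nonneg] at this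
  have h5 : (c.toReal : ℂ) ≠ 0 :=
    Complex.ofReal_ne_zero.2 (ENNReal.toReal_pos hc0 hct).ne'
  rw [h4] at h3
  exact hμ1 (mul_right_cancel₀ h5 (h3.trans (one_mul _).symm))

set_option maxHeartbeats 400000 in
/-- The wave front set of `chc` is characteristic for the vector fields `x ↦ Ys x + x Y` that the
commutant of `A` in `End(W)` induces on `𝔞`. Otherwise, with `k = 1 + s Y` for a small `s`, the
transformation `x ↦ k^* x k` would multiply a test function `φ χ(-t η)`, with `φ` the indicator
function of a small ball, by a constant of the form `χ(-c) ≠ 1`. -/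
theorem TorusBlocks.apply_eq_zero_of_mem_waveFrontSet (hν : IsOrbitMeasure dw da ν)
    (hchc : IsChc χ ω A (spCentralizer ω A) dx ν chc) {Λ : Subgroup Fˣ} {Y Ys : End F W}
    (hadj : ∀ u v, ω (Y u) v = ω u (Ys v)) (hY : ∀ a ∈ A, ∀ w, Y (a w) = a (Y w))
    (hYs : ∀ a ∈ A, ∀ w, Ys (a w) = a (Ys w)) {x : spCentralizer ω A}
    {ξ : Dual F (spCentralizer ω A)} (hx : (x, ξ) ∈ waveFrontSet χ Λ chc)
    {d : spCentralizer ω A} (hd : (d : End F W) = Ys * x + x * Y) : ξ d = 0 := by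
  have hadj' : ∀ u v, ω (Ys u) v = ω u (Y v) := fun u v => by
    rw [h.skew, ← hadj, ← h.skew]
  let D : spCentralizer ω A →ₗ[F] spCentralizer ω A := (LinearMap.mulLeft F Ys + LinearMap.mulRight F Y).restrict
    fun x hx => mul_add_mul_mem_spCentralizer hadj hadj' hY hYs hx
  let Q : spCentralizer ω A →ₗ[F] spCentralizer ω A := (LinearMap.mulLeft F Ys ∘ₗ LinearMap.mulRight F Y).restrict
    fun x hx => mul_mul_mem_spCentralizer hadj hadj' hY hYs hx
  have hdD : d = D x := Subtype.ext hd
  rw [hdD]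
  by_contra hne
  set δ := ‖ξ (D x)‖ with hδ
  have hδ0 : 0 < δ := norm_pos_iff.2 hne
  obtain ⟨c, hc⟩ := NormedField.exists_one_lt_norm F
  obtain ⟨CD, hCD0, hCD⟩ := exists_vnorm_apply_le D
  obtain ⟨CQ, hCQ0, hCQ⟩ := exists_vnorm_apply_le Q
  obtain ⟨CY, hCY0, hCY⟩ := exists_vnorm_apply_le Y
  obtain ⟨C₁, hC₁0, hC₁⟩ := exists_norm_dual_apply_le F (spCentralizer ω A)
  set C := max (max CD CQ) CY with hC
  have hC0 : 0 < C := lt_max_of_lt_right hCY0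
  have hDC : ∀ y, vnorm F (D y) ≤ C * vnorm F y := fun y => (hCD y).trans
    (mul_le_mul_of_nonneg_right ((le_max_left _ _).trans (le_max_left _ _)) (vnorm_nonneg _))
  have hQC : ∀ y, vnorm F (Q y) ≤ C * vnorm F y := fun y => (hCQ y).trans
    (mul_le_mul_of_nonneg_right ((le_max_right _ _).trans (le_max_left _ _)) (vnorm_nonneg _))
  have hYC : ∀ w, vnorm F (Y w) ≤ C * vnorm F w := fun y => (hCY y).trans
    (mul_le_mul_of_nonneg_right (le_max_right _ _) (vnorm_nonneg _))
  set G := ‖c‖ / δ with hG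
  have hG0 : 0 < G := div_pos (zero_lt_one.trans hc) hδ0
  set B := vnorm F x + 1 with hB
  have hB0 : 0 < B := add_pos_of_nonneg_of_pos (vnorm_nonneg _) one_pos
  set E := C₁ * (vnorm F ξ + 1) with hE
  have hE0 : 0 < E := mul_pos hC₁0 (add_pos_of_nonneg_of_pos (vnorm_nonneg _) one_pos)
  -- the radius of the ball, and the bound for `s`
  set r := min 1 (1 / (G * E * C)) with hr
  have hr0 : 0 < r := lt_min one_pos (by positivity)
  have hr1 : r ≤ 1 := min_le_left _ _
  have hr2 : G * (E * (C * r)) ≤ 1 := by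
    have : r ≤ 1 / (G * E * C) := min_le_right _ _
    rw [le_div_iff₀ (by positivity)] at this
    linarith
  set S := 1 + C + C * B + G * (E * (C * B)) with hS
  have hS1 : 0 < C * B := by positivity
  have hS2 : 0 < G * (E * (C * B)) := by positivity
  have hS0 : 0 < S := by positivity
  set ε := min 1 (δ / (C₁ * (vnorm F (D x) + 1))) with hε
  have hDx := vnorm_nonneg (F := F) (D x)
  have hε0 : 0 < ε := lt_min one_pos (by positivity)
  -- `t` is taken so large that `s`, for which `t s η (D x) = c`, is small
  obtain ⟨t, η, ht, htR, hη, hne'⟩ := exists_of_mem_waveFrontSet χ hx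
    (ballIndicator_self_ne_zero x hr0) hε0 (G * S / r)
  have hηE : ∀ y, ‖η y‖ ≤ E * vnorm F y := by
    intro y
    refine (hC₁ η y).trans (mul_le_mul_of_nonneg_right ?_ (vnorm_nonneg _))
    refine mul_le_mul_of_nonneg_left ?_ hC₁0.le
    have h1 : vnorm F η ≤ vnorm F (η - ξ) + vnorm F ξ := by
      have := vnorm_add_le (F := F) (η - ξ) ξ
      rwa [sub_add_cancel] at this
    have h2 : vnorm F (η - ξ) < 1 := hη.trans_le (min_le_left _ _)
    linarith
  have hηδ : ‖η (D x)‖ = δ := by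
    have h1 : ‖(η - ξ) (D x)‖ < δ := by
      refine (hC₁ (η - ξ) (D x)).trans_lt ?_
      have h2 : vnorm F (η - ξ) < δ / (C₁ * (vnorm F (D x) + 1)) := hη.trans_le (min_le_right _ _)
      rw [lt_div_iff₀ (by positivity)] at h2
      have h3 := mul_nonneg hC₁0.le (vnorm_nonneg (F := F) (η - ξ))
      linarith
    have h2 : η (D x) = (η - ξ) (D x) + ξ (D x) := by
      rw [LinearMap.sub_apply, sub_add_cancel]
    rw [h2, IsUltrametricDist.norm_add_eq_max_of_norm_ne_norm h1.ne, max_eq_right h1.le]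
  have hηne : η (D x) ≠ 0 := norm_pos_iff.1 (hηδ ▸ hδ0)
  set s : F := c / (t * η (D x)) with hs
  have ht0 : 0 < ‖t‖ := norm_pos_iff.2 ht
  have hts : ‖t‖ * ‖s‖ = G := by
    rw [hs, norm_div, norm_mul, hηδ, hG]
    field_simp
  have hsS : ‖s‖ * S < r := by
    rw [div_lt_iff₀ hr0, ← hts] at htR
    have : ‖t‖ * (‖s‖ * S) < ‖t‖ * r := by linarith
    exact lt_of_mul_lt_mul_left this ht0.le
  have hs0 := norm_nonneg s
  have hsX : ∀ X, X ≤ S → ‖s‖ * X < r := fun X hX =>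
    (mul_le_mul_of_nonneg_left hX hs0).trans_lt hsS
  have hs1 : ‖s‖ ≤ 1 := by
    have := hsX 1 (by linarith)
    linarith
  have hsC : ‖s‖ * C < 1 := (hsX C (by linarith)).trans_le hr1
  have hsB : ‖s‖ * (C * B) ≤ r := (hsX _ (by linarith)).le
  have hsG : ‖s‖ * (G * (E * (C * B))) ≤ 1 := ((hsX _ (by linarith)).trans_le hr1).le
  -- the transformations `k` and `x ↦ k^* x k`
  have hkinj := injective_one_add_smul hYC hsC
  let k : W ≃ₗ[F] W := LinearEquiv.ofInjectiveEndo _ hkinj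
  have hkw : ∀ w, k w = w + s • Y w := fun w => rfl
  let N : End F (spCentralizer ω A) := D + s • Q
  have hNC : ∀ y, vnorm F (N y) ≤ C * vnorm F y := by
    intro y
    refine vnorm_add_le_of_le (hDC y) ?_
    change vnorm F (s • Q y) ≤ _
    rw [vnorm_smul]
    exact (mul_le_of_le_one_left (vnorm_nonneg _) hs1).trans (hQC y)
  let M : spCentralizer ω A ≃ₗ[F] spCentralizer ω A := LinearEquiv.ofInjectiveEndo _ (injective_one_add_smul hNC hsC)
  have hM : ∀ y, M y = y + s • N y := fun y => rfl
  have hNy : ∀ (y : spCentralizer ω A) w, (N y : End F W) w =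
      Ys ((y : End F W) w) + (y : End F W) (Y w) + s • Ys ((y : End F W) (Y w)) := fun y w => rfl
  have hmom : ∀ y w, moment ω (spCentralizer ω A) (k w) y = moment ω (spCentralizer ω A) w (M y) := by
    intro y w
    rw [moment_apply, moment_apply]
    congr 1
    have h1 : (M y : End F W) w = (y : End F W) w + s • (N y : End F W) w := rfl
    rw [h1, hNy, hkw]
    simp only [map_add, map_smul, LinearMap.add_apply, LinearMap.smul_apply, smul_eq_mul, hadj']
    ring
  refine hne' (h.chc_eq_zero_of_eigenvector hcl hν hchc k ?_ M hmom
    (modulate χ (ballIndicator x hr0) (t • η)) (μ := χ.val (-c)) (χ.norm_val _) ?_ ?_)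
  · intro a ha w
    rw [hkw, hkw, hY a ha, map_add, map_smul]
  · rw [Ne, χ.val_eq_one_iff, norm_neg, not_le]
    exact hc
  · have h2 : t * s * η (D x) = c := by
      rw [hs]
      field_simp
    exact modulate_ballIndicator_apply χ hDC hQC hC0.le hsC hs1 hr0
      (add_le_add_right hr1 (vnorm F x)) hsB hE0.le hηE h2 ((norm_mul t s).trans hts ▸ hr2)
      ((norm_mul t s).trans hts ▸ hsG)

end Invariance

/-! ### The conormal bundle -/

section Conclusion

open Topology

variable {F : Type*} [NontriviallyNormedField F]
variable {W : Type*} [AddCommGroup W] [Module F W] [FiniteDimensional F W]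
variable {ω : W →ₗ[F] W →ₗ[F] F} {A : Subgroup (W ≃ₗ[F] W)} {K : Type*} [Fintype K]
variable {bar : K → K} {p : K → End F W}

section Algebra

variable (h : TorusBlocks ω A bar p)
include h

theorem TorusBlocks.form_apply_left (a : A) (u w : W) :
    ω u ((a : W ≃ₗ[F] W) w) = ω ((a⁻¹ : A) • u) w := by
  have h1 := h.form_apply_apply a⁻¹ u ((a : W ≃ₗ[F] W) w)
  have h2 : ((a⁻¹ : A) : W ≃ₗ[F] W) ((a : W ≃ₗ[F] W) w) = w := by
    rw [← LinearEquiv.mul_apply, ← Subgroup.coe_mul, inv_mul_cancel, Subgroup.coe_one]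
    rfl
  rw [h2] at h1
  exact h1.symm

/-- Rank one transformations that map the block `k` to itself commute with the torus. -/
theorem TorusBlocks.smulRight_commute (k : K) (u v : W) :
    ∀ a ∈ A, ∀ w, (ω (p (bar k) u)).smulRight (p k v) (a w) =
      a ((ω (p (bar k) u)).smulRight (p k v) w) := by
  intro a ha w
  have h1 : ω (p (bar k) u) (a w) = weight p (⟨a, ha⟩ : A) k * ω (p (bar k) u) w := by
    have h2 : ((⟨a, ha⟩⁻¹ : A) : A) • p (bar k) u = weight p (⟨a, ha⟩ : A) k • p (bar k) u := by
      have := h.apply_block (⟨a, ha⟩⁻¹ : A) (bar k) u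
      rw [h.weight_inv, h.bar_bar] at this
      exact this
    rw [h.form_apply_left ⟨a, ha⟩, h2, map_smul]
    rfl
  rw [LinearMap.smulRight_apply, LinearMap.smulRight_apply, h1, map_smul,
    h.apply_block ⟨a, ha⟩ k v, smul_smul, mul_comm]

/-- If the covector `moment w` is characteristic at `x` for the commutant of the torus, then `x w`
vanishes in the duals of the blocks where `w` does not vanish. -/
theorem TorusBlocks.block_bar_apply_eq_zero {x : spCentralizer ω A} {w : W}
    (hx : ∀ Y Ys : End F W, (∀ u v, ω (Y u) v = ω u (Ys v)) →
      (∀ a ∈ A, ∀ w, Y (a w) = a (Y w)) → (∀ a ∈ A, ∀ w, Ys (a w) = a (Ys w)) →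
      ω (Ys ((x : End F W) w) + (x : End F W) (Y w)) w = 0) [CharZero F] {k : K}
    (hk : p k w ≠ 0) : p (bar k) ((x : End F W) w) = 0 := by
  obtain ⟨u, hu⟩ : ∃ u, ω (p (bar k) u) w ≠ 0 := by
    by_contra! h0
    have := h.eq_zero_of_pairing h0
    rw [h.bar_bar] at this
    exact hk this
  refine h.eq_zero_of_pairing fun v => ?_
  have hc := h.smulRight_commute (bar k) (-v) u
  have h1 := hx ((ω (p (bar k) u)).smulRight (p k v)) ((ω (p k (-v))).smulRight (p (bar k) u)) ?_
    (h.smulRight_commute k u v) ?_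
  · simp only [LinearMap.smulRight_apply, map_add, map_smul, LinearMap.add_apply,
      LinearMap.smul_apply, smul_eq_mul, map_neg, LinearMap.neg_apply] at h1
    have h2 := x.2.1 (p k v) w
    have h3 : (2 : F) * (ω (p (bar k) u) w * ω (p k v) ((x : End F W) w)) = 0 := by
      linear_combination -h1 + ω (p (bar k) u) w * h2
    simpa [hu] using h3
  · intro y z
    simp only [LinearMap.smulRight_apply, map_smul, LinearMap.smul_apply, smul_eq_mul, map_neg,
      LinearMap.neg_apply]
    rw [h.skew y (p (bar k) u)]
    ring
  · rwa [h.bar_bar] at hc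

/-- The moment map does not change when the blocks of `w` whose dual blocks do not contribute to `w`
are removed: torus elements that rescale these blocks stabilize the moment of `w`. -/
theorem TorusBlocks.exists_moment_eq_of_blocks [CharZero F] (w : W) :
    ∃ w' : W, moment ω (spCentralizer ω A) w' = moment ω (spCentralizer ω A) w ∧
      ∀ k, p k w' = 0 ∨ p k w' = p k w ∧ p (bar k) w ≠ 0 := by
  classical
  obtain ⟨S, hSw⟩ : ∃ S : K → Prop, ∀ k, S k ↔ p k w ≠ 0 ∧ p (bar k) w = 0 := ⟨_, fun _ => Iff.rfl⟩
  have hS : ∀ k, S k → ¬ S (bar k) := fun k hk hk' => ((hSw _).1 hk').1 ((hSw k).1 hk).2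
  let w₁ : W := ∑ k, (if S k then (0 : F) else 1) • p k w
  let w₂ : W := ∑ k, (if S k then (1 : F) else 0) • p k w
  have hl : ∀ l : F, l ≠ 0 →
      moment ω (spCentralizer ω A) (w₁ + l • w₂) = moment ω (spCentralizer ω A) w := by
    intro l hl
    let u : Fˣ := Units.mk0 l hl
    obtain ⟨a, ha, -⟩ := h.exists_of_scalars
      (fun k => if S k then u else if S (bar k) then u⁻¹ else 1) (fun k => by
        rw [h.bar_bar]
        by_cases h1 : S k
        · simp [h1, hS k h1]
        · by_cases h2 : S (bar k)
          · simp [h1, h2]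
          · simp [h1, h2]) (fun k hk => by
        have h1 : ¬ S k := fun h1 => hS k h1 (hk.symm ▸ h1)
        simp only [hk, h1, if_false])
    rw [← h.moment_smul_eq a w]
    congr 1
    change _ = (a : W ≃ₗ[F] W) w
    rw [ha, Finset.smul_sum, ← Finset.sum_add_distrib]
    refine Finset.sum_congr rfl fun k _ => ?_
    by_cases h1 : S k
    · simp [h1, u]
    · by_cases h2 : S (bar k)
      · have : p k w = 0 := by
          have := ((hSw _).1 h2).2
          rwa [h.bar_bar] at this
        simp [this]
      · simp [h1, h2]
  refine ⟨w₁, LinearMap.ext fun x => ?_, fun k => ?_⟩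
  · -- the quadratic polynomial `moment (w₁ + l w₂) x` in `l` is constant
    have e1 := LinearMap.congr_fun (hl 1 one_ne_zero) x
    have e2 := LinearMap.congr_fun (hl 2 two_ne_zero) x
    have e3 := LinearMap.congr_fun (hl (-1) (neg_ne_zero.2 one_ne_zero)) x
    simp only [moment_apply, map_add, map_smul, LinearMap.add_apply, LinearMap.smul_apply,
      smul_eq_mul] at e1 e2 e3 ⊢
    refine mul_left_cancel₀ (three_ne_zero (α := F)) ?_
    linear_combination 3 * e1 - e2 + e3
  · rw [h.block_sum_smul fun k => if S k then (0 : F) else 1]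
    by_cases h1 : p k w = 0
    · exact Or.inl (by rw [h1, smul_zero])
    by_cases h2 : p (bar k) w = 0
    · exact Or.inl (by rw [if_pos ((hSw k).2 ⟨h1, h2⟩), zero_smul])
    · exact Or.inr ⟨by rw [if_neg fun h3 => h2 ((hSw k).1 h3).2, one_smul], h2⟩

/-- A vector that some element of the torus multiplies by `2` has moment zero. -/
theorem TorusBlocks.moment_eq_zero [CharZero F] {w : W} {ζ : K → ℤ} (hζ : ∀ k, ζ (bar k) = -ζ k)
    (hw : ∀ k, p k w ≠ 0 → ζ k = 1) : moment ω (spCentralizer ω A) w = 0 := by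
  let u : Fˣ := Units.mk0 2 two_ne_zero
  obtain ⟨a, ha, -⟩ := h.exists_of_scalars (fun k => u ^ ζ k)
    (fun k => by rw [hζ, ← zpow_add, add_neg_cancel, zpow_zero])
    (fun k hk => by
      have := hζ k
      rw [hk] at this
      rw [show ζ k = 0 by omega, zpow_zero])
  have h1 : a • w = (2 : F) • w := by
    change (a : W ≃ₗ[F] W) w = _
    rw [ha]
    conv_rhs => rw [← h.sum_apply w, Finset.smul_sum]
    refine Finset.sum_congr rfl fun k _ => ?_
    by_cases hk : p k w = 0
    · rw [hk, smul_zero, smul_zero]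
    · rw [hw k hk, zpow_one]
      rfl
  have h2 := h.moment_smul_eq a w
  rw [h1] at h2
  ext x
  have h3 := LinearMap.congr_fun h2 x
  simp only [moment_apply, map_smul, LinearMap.smul_apply, smul_eq_mul] at h3
  rw [moment_apply, LinearMap.zero_apply]
  refine mul_left_cancel₀ (three_ne_zero (α := F)) ?_
  linear_combination h3

end Algebra

section Analysis

variable [LocallyCompactSpace F] [CharZero F] [IsUltrametricDist F] {χ : UnramifiedChar F}
variable [TopologicalSpace W] [IsModuleTopology F W] [MeasurableSpace W] [BorelSpace W]
variable [TopologicalSpace A] [MeasurableSpace A] [BorelSpace A]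
variable [TopologicalSpace (spCentralizer ω A)] [IsModuleTopology F (spCentralizer ω A)]
variable [MeasurableSpace (spCentralizer ω A)] [BorelSpace (spCentralizer ω A)]
variable {dx : Measure (spCentralizer ω A)} [dx.IsAddHaarMeasure]
variable {dw : Measure W} [dw.IsAddHaarMeasure] {da : Measure A} [da.IsHaarMeasure]
variable {ν : Measure (MulAction.orbitRel.Quotient A W)}
variable {chc : Distribution F (spCentralizer ω A)}

/-- A point of the wave front set in the conormal bundle would have a covector proportional to the
moment of a vector that the torus can rescale. -/
theorem TorusBlocks.waveFrontSet_inter_conormalBundle (h : TorusBlocks ω A bar p)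
    (hcl : IsClosedEmbedding (weight p : A → K → F)) {𝔤 : Submodule F (End F W)} {X' : End F W}
    (hc : ConormalCondition ω A bar p 𝔤 X') (hν : IsOrbitMeasure dw da ν)
    (hchc : IsChc χ ω A (spCentralizer ω A) dx ν chc) (Λ : Subgroup Fˣ) :
    waveFrontSet χ Λ chc ∩ conormalBundle (spCentralizer ω A) 𝔤 X' = ∅ := by
  refine Set.eq_empty_iff_forall_notMem.2 ?_
  rintro ⟨x, ξ⟩ ⟨hWF, ⟨z, hz, hxz⟩, hξ𝔤⟩
  obtain ⟨t, w, hξ⟩ := h.exists_moment_eq_of_mem_waveFrontSet hchc hWF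
  have hξ0 : ξ ≠ 0 := hWF.1
  have ht : t ≠ 0 := by
    rintro rfl
    exact hξ0 (hξ.trans (zero_smul _ _))
  have h4 : (4 : F)⁻¹ ≠ 0 := inv_ne_zero (by norm_num)
  have hxw : ∀ k, p k w ≠ 0 → p (bar k) ((x : End F W) w) = 0 := fun k =>
    h.block_bar_apply_eq_zero fun Y Ys hadj hY hYs => by
      have hadj' : ∀ u v, ω (Ys u) v = ω u (Y v) := fun u v => by
        rw [h.skew, ← hadj, ← h.skew]
      have h1 := h.apply_eq_zero_of_mem_waveFrontSet hcl hν hchc hadj hY hYs hWF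
        (d := ⟨Ys * x + x * Y, mul_add_mul_mem_spCentralizer hadj hadj' hY hYs x.2⟩) rfl
      rw [hξ, LinearMap.smul_apply, moment_apply, smul_eq_mul] at h1
      exact (mul_eq_zero.1 ((mul_eq_zero.1 h1).resolve_left ht)).resolve_left h4
  obtain ⟨w', hw', hblocks⟩ := h.exists_moment_eq_of_blocks w
  have hcomm : ∀ k v, p k ((x : End F W) v) = (x : End F W) (p k v) := fun k v => by
    rw [hxz]
    exact (LinearMap.congr_fun (hc.commute_block z hz k) v).symm
  have hx0 : (X' + z) w' = 0 := by
    rw [← hxz, ← h.sum_apply ((x : End F W) w')]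
    refine Finset.sum_eq_zero fun k _ => ?_
    rw [hcomm]
    rcases hblocks k with h1 | ⟨h1, h2⟩
    · rw [h1, map_zero]
    · rw [h1, ← hcomm]
      have := hxw _ h2
      rwa [h.bar_bar] at this
  have hY : ∀ Y ∈ 𝔤, ω (Y w') w' = 0 := by
    intro Y hY
    have hmem : ∀ z ∈ 𝔤, X' + z ∈ spCentralizer ω A := fun z hz =>
      ⟨hc.symplectic z hz, hc.commute_torus z hz⟩
    have hY𝔞 : Y ∈ spCentralizer ω A := by
      have := sub_mem (hmem Y hY) (hmem 0 (zero_mem _))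
      rwa [add_zero, add_sub_cancel_left] at this
    have h1 := hξ𝔤 ⟨Y, hY𝔞⟩ hY
    change ξ _ = 0 at h1
    rw [hξ, ← hw', LinearMap.smul_apply, moment_apply, smul_eq_mul] at h1
    exact (mul_eq_zero.1 ((mul_eq_zero.1 h1).resolve_left ht)).resolve_left h4
  obtain ⟨ζ, hζ, hζw⟩ := hc.exponents z hz w' hx0 hY
  rw [← hw', h.moment_eq_zero hζ hζw, smul_zero] at hξ
  exact hξ0 hξ

end Analysis

theorem TorusBlocks.chcAvoidsConormal [LocallyCompactSpace F] [CharZero F] [IsUltrametricDist F]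
    (χ : UnramifiedChar F) (Λ : Subgroup Fˣ) (h : TorusBlocks ω A bar p)
    {𝔤 : Submodule F (End F W)} {X' : End F W} (hc : ConormalCondition ω A bar p 𝔤 X') :
    ChcAvoidsConormal χ Λ ω A 𝔤 X' := by
  let tW : TopologicalSpace W := moduleTopology F W
  have : IsModuleTopology F W := ⟨rfl⟩
  let mW : MeasurableSpace W := borel W
  have : BorelSpace W := ⟨rfl⟩
  let t𝔞 : TopologicalSpace (spCentralizer ω A) := moduleTopology F _
  have : IsModuleTopology F (spCentralizer ω A) := ⟨rfl⟩
  let m𝔞 : MeasurableSpace (spCentralizer ω A) := borel _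
  have : BorelSpace (spCentralizer ω A) := ⟨rfl⟩
  let tA : TopologicalSpace A :=
    TopologicalSpace.induced (fun a : A => ((a : W ≃ₗ[F] W) : End F W)) (moduleTopology F (End F W))
  let mA : MeasurableSpace A := borel A
  have : BorelSpace A := ⟨rfl⟩
  have hcl : IsClosedEmbedding (weight p : A → K → F) := h.isClosedEmbedding_weight
  refine ⟨fun z hz => ⟨hc.symplectic z hz, hc.commute_torus z hz⟩, ?_⟩
  intro dw da dx hdw hda hdx
  refine ⟨h.existsUnique_orbitMeasure hcl dw da, fun ν hν => ?_⟩
  obtain ⟨chc, hchc⟩ := h.exists_chc χ hcl dx dw da hν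
  exact ⟨chc, hchc, h.waveFrontSet_inter_conormalBundle hcl hc hν hchc Λ⟩

end Conclusion

end PadicPair

end

theorem mainTheorem7
    {F : Type*} [NontriviallyNormedField F] [IsUltrametricDist F] [LocallyCompactSpace F] [CharZero F]
    (χ : PadicPair.UnramifiedChar F)
    (Λ : Subgroup Fˣ) [Λ.FiniteIndex]
    (hΛ : ∃ ϖ ∈ Λ, ‖(ϖ : F)‖ < 1 ∧ ∀ a : F, ‖a‖ < 1 → ‖a‖ ≤ ‖(ϖ : F)‖)
    {D : Type*} [DivisionRing D] [Algebra F D] [FiniteDimensional F D]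
    {V : Type*} [AddCommGroup V] [Module F V] [Module Dᵐᵒᵖ V] [IsScalarTower F Dᵐᵒᵖ V]
    [FiniteDimensional F V]
    {V' : Type*} [AddCommGroup V'] [Module F V'] [Module Dᵐᵒᵖ V'] [IsScalarTower F Dᵐᵒᵖ V']
    [FiniteDimensional F V'] :
    -- pairs of type II
    (∀ 𝔥' : LieSubalgebra F (Module.End Dᵐᵒᵖ V'), PadicPair.IsCartan ⊤ 𝔥' →
      ∀ x' : (⊤ : LieSubalgebra F (Module.End Dᵐᵒᵖ V')),
        (x' : Module.End Dᵐᵒᵖ V') ∈ 𝔥' → LieAlgebra.IsRegular F x' →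
        PadicPair.ChcAvoidsConormal χ Λ (PadicPair.symplecticII F D V V')
          ((PadicPair.splitPartGL 𝔥').map (PadicPair.groupActII F D V V'))
          (LinearMap.range (PadicPair.leftActII F D V V'))
          (PadicPair.rightActII F D V V' (x' : Module.End Dᵐᵒᵖ V'))) ∧
    -- pairs of type I
    (∀ [StarRing D] (hσ : ∀ a : F, star (algebraMap F D a) = algebraMap F D a) (ε : ℤˣ)
      (B : PadicPair.HermForm D ε V) (B' : PadicPair.HermForm D (-ε) V')
      (𝔥' : LieSubalgebra F (Module.End Dᵐᵒᵖ V')), PadicPair.IsCartan (B'.lieAlgebra hσ) 𝔥' →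
      ∀ x' : B'.lieAlgebra hσ,
        (x' : Module.End Dᵐᵒᵖ V') ∈ 𝔥' → LieAlgebra.IsRegular F x' →
        PadicPair.ChcAvoidsConormal χ Λ (PadicPair.symplecticI hσ B B')
          ((B'.splitPart 𝔥').map (PadicPair.groupActI F D V V'))
          ((B.lieAlgebra hσ).toSubmodule.map (PadicPair.leftActI F D V V'))
          (PadicPair.rightActI F D V V' (x' : Module.End Dᵐᵒᵖ V'))) := by
  refine ⟨fun 𝔥' h𝔥 x' hx' hreg => ?_, fun {_} hσ ε B B' 𝔥' h𝔥 x' hx' hreg => ?_⟩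
  · have hL := PadicPair.traceNondeg_top (F := F) (D := D) (V := V')
    obtain ⟨S, hS, hSc⟩ := h𝔥.exists_subalgebra
    obtain ⟨n, e, he⟩ := PadicPair.exists_primitiveIdempotents S
      (fun x hx y hy => h𝔥.commute hL ((hS x).1 hx) ((hS y).1 hy))
      fun x hx hn => h𝔥.eq_zero_of_isNilpotent hL ((hS x).1 hx) hn
    exact (PadicPair.torusBlocks_typeII h𝔥 hS hSc he).chcAvoidsConormal χ Λ
      (PadicPair.conormalCondition_typeII h𝔥 hS hSc he x' hx' hreg)
  · obtain ⟨n, e, he⟩ := PadicPair.exists_primitiveIdempotents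
      (Algebra.adjoin F (𝔥' : Set (Module.End Dᵐᵒᵖ V')))
      (fun x hx y hy => h𝔥.commute_of_mem_adjoin hx hy) fun x hx hn => h𝔥.adjoin_reduced hx hn
    obtain ⟨σ, hσσ, hσe⟩ := h𝔥.exists_adj_perm he
    exact (PadicPair.torusBlocks_typeI h𝔥 he hσσ hσe).chcAvoidsConormal χ Λ
      (PadicPair.conormalCondition_typeI h𝔥 he hσσ hσe x' hx' hreg)
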